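/- **Setting.** Let $\Sigma=\mathbb R^2/\Lambda$ be a flat two-torus and $n\ge 2$. For $f,g:\Sigma\to\mathbb R^3$ write $\langle f,g\rangle=\int_\Sigma f\cdot g$; let $H^k=H^k(\Sigma,\mathbb R^3)$ be the Sobolev space with norm $\|f\|_k^2=\sum_{|\alpha|\le k}\|D_\alpha f\|_{L^2}^2$. Let $\mathsf M_n$ be the space of holomorphic maps $\Sigma\to S^2\subset\mathbb R^3$ of degree $n$. For a smooth map $\phi:\Sigma\to S^2$ put $$J_\phi V=-\Delta V-(|\phi_x|^2+|\phi_y|^2)V-2(\phi_x\cdot V_x+\phi_y\cdot V_y)\phi ,$$ $$L_\phi V=J_\phi V+2\{(\phi\cdot V)\Delta\phi+(\phi\cdot V)_x\phi_x+(\phi\cdot V)_y\phi_y\},$$ so that $L_\phi$ is $J_\phi$ plus the $L^2$-adjoint of its non-self-adjoint part $V\mapsto-2(\phi_x\cdot V_x+\phi_y\cdot V_y)\phi$, and $$Q_1(V)=\int_\Sigma\{|V_x|^2+|V_y|^2-(|\phi_x|^2+|\phi_y|^2)|V|^2-4(\phi_x\cdot V_x+\phi_y\cdot V_y)(\phi\cdot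 V)\},\qquad Q_2(V)=Q_1(L_\phi V).$$ Let $U\subset\mathbb R^{4n}$ be open and $\psi:U\times\Sigma\to S^2$ a smooth local parametrization of $\mathsf M_n$: for every $q\in U$, $\psi(q,\cdot)\in\mathsf M_n$, and the derivatives $\psi_\mu=\partial\psi/\partial q^\mu$, $\mu=1,\dots,4n$, form a basis of the kernel of $J_{\psi(q)}$ on smooth sections of $\psi(q)^{-1}TS^2$. Write $\psi_{\mu\nu},\psi_{\mu\nu\lambda}$ for the higher $q$-derivatives, $\gamma_{\mu\nu}=\langle\psi_\mu,\psi_\nu\rangle$, $(\gamma^{\mu\nu})$ for the inverse matrix, $G^\mu_{\lambda\nu}=\gamma^{\mu\alpha}\langle\psi_\alpha,\psi_{\lambda\nu}\rangle$ (repeated indices are summed). Let $K\subset U$ be compact. For $\varepsilon>0$ let a dot denote differentiation with respect to $\tau=\varepsilon t$, so $\dot q=\varepsilon^{-1}q_t$, and put $\psi_\tau=\psi_\mu\dot q^\mu$, $\psi_{\tau\tau}=\psi_\mu\ddot q^\mu+\psi_{\mu\nu}\dot q^\mu\dot q^\nu$. The coupled system for $(q,Y)$ is $$Y_{tt}+L_{\psi(q)}Y=k+\varepsilon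 j',\qquad \ddot q^\mu+G^\mu_{\nu\lambda}\dot q^\nu\dot q^\lambda=\varepsilon h^\mu+\varepsilon^2\gamma^{\mu\nu}\langle Y,\psi_{\nu\lambda}\rangle\ddot q^\lambda,$$ where $k=-(\psi_{\tau\tau}+|\psi_\tau|^2\psi)$ and $$\begin{aligned}-j'={}&2(\psi_\tau\cdot Y_t)\psi+\varepsilon\{(|Y_t|^2-|Y_x|^2-|Y_y|^2)\psi+(|\psi_\tau|^2-2\psi_x\cdot Y_x-2\psi_y\cdot Y_y)Y\}\\&+2\varepsilon^2(\psi_\tau\cdot Y_t)Y+\varepsilon^3(|Y_t|^2-|Y_x|^2-|Y_y|^2)Y\\&+\varepsilon\{|Y|^2\Delta\psi+2(Y\cdot Y_x)\psi_x+2(Y\cdot Y_y)\psi_y\},\end{aligned}$$ $$h^\mu=\gamma^{\mu\nu}\{\langle j',\psi_\nu\rangle+2\langle Y_t,\psi_{\nu\lambda}\rangle\dot q^\lambda+\varepsilon\langle Y,\psi_{\nu\lambda\rho}\rangle\dot q^\lambda\dot q^\rho\}.$$ **Theorem (quasi-conservation of $E_2$).** There are constants $\kappa,C>0$ and a smooth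 positive function $c$ of five non-negative real arguments, increasing in each of them, all depending only on $\Sigma$, $n$, $\psi$, $K$, and for all $q_0,q_1\in\mathbb R^{4n}$, $Y_0\in H^3$, $Y_1\in H^2$ there is a constant $C_0>0$, depending in addition only on $(q_0,q_1,Y_0,Y_1)$, such that the following holds. Let $\Gamma,d,T>0$, let $q_0\in K$ with $\mathrm{dist}(q_0,\partial K)>d$ and $|q_1|,\|Y_0\|_3,\|Y_1\|_2<\Gamma$, and let $0<\varepsilon\le1$ with $\varepsilon<\kappa/\sqrt\Gamma$. Let $(q,Y)$ be a solution of the coupled system on $[0,T]$ with $$q\in C^3([0,T],K),\qquad Y\in C^0([0,T],H^3)\cap C^1([0,T],H^2)\cap C^2([0,T],H^1)$$ and $q(0)=q_0$, $q_t(0)=\varepsilon q_1$, $Y(0)=Y_0$, $Y_t(0)=Y_1$. Then the energy $$E_2(t)=\tfrac12\|(L_{\psi(q(t))}Y(t))_t\|_0^2+\tfrac12Q_2(Y(t))$$ (where $Q_2$ is taken with $\phi=\psi(q(t))$) satisfies, for all $t\in[0,T]$, $$E_2(t)\le C_0+C\,(|\ddot q(t)|+|\dot q(t)|^2)\,\|Y(t)\|_2+\varepsilon\int_0^t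 c\big(|\dot q(s)|,|\ddot q(s)|,|\dddot q(s)|,\|Y(s)\|_3,\|Y_t(s)\|_2\big)\,ds .$$ -/

import Mathlib

open MeasureTheory Set
open scoped ContDiff RealInnerProductSpace

namespace WaveMapTorus

noncomputable section

/-- The Euclidean plane, the universal cover of the flat torus; coordinate `0` is `x`, coordinate
`1` is `y`. -/
abbrev Plane := EuclideanSpace ℝ (Fin 2)

/-- Euclidean three-space, which contains the unit sphere `S²`. -/
abbrev R3 := EuclideanSpace ℝ (Fin 3)

/-- The coordinate space `ℝ⁴ⁿ` for the space of degree `n` holomorphic maps. -/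
abbrev Coord (n : ℕ) := EuclideanSpace ℝ (Fin (4 * n))

/-! ### The flat torus

A flat two-torus is `Σ = Plane / Λ`, where `Λ` is the lattice spanned over `ℤ` by a basis `b` of the
plane. Functions on `Σ` are `Λ`-periodic functions on the plane, and integrals over `Σ` are
integrals over the fundamental parallelogram of `b`. -/

/-- `f` is invariant under the lattice spanned by `b`. -/
def Periodic (b : Module.Basis (Fin 2) ℝ Plane) {F : Type*} (f : Plane → F) : Prop :=
  ∀ (i : Fin 2) (p : Plane), f (p + b i) = f p

/-- Lebesgue measure on the fundamental parallelogram, that is, the area measure of `Σ`. -/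
def torusMeasure (b : Module.Basis (Fin 2) ℝ Plane) : Measure Plane :=
  volume.restrict (ZSpan.fundamentalDomain b)

/-- The classical partial derivative `∂ᵢ f` on the plane. -/
def pd {F : Type*} [NormedAddCommGroup F] [NormedSpace ℝ F] (i : Fin 2) (f : Plane → F) :
    Plane → F :=
  fun p => fderiv ℝ f p (EuclideanSpace.single i 1)

/-- The `L²` inner product `⟨f, g⟩ = ∫_Σ f · g`. -/
def ip (b : Module.Basis (Fin 2) ℝ Plane) (f g : Plane → R3) : ℝ :=
  ∫ p, ⟪f p, g p⟫ ∂(torusMeasure b)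

/-! ### Sobolev spaces -/

/-- The space `L²(Σ, ℝ³)`. -/
abbrev L2 (b : Module.Basis (Fin 2) ℝ Plane) := Lp R3 2 (torusMeasure b)

/-- `g` is the weak partial derivative `∂ᵢ f` on the torus. -/
def IsWeakPartial (b : Module.Basis (Fin 2) ℝ Plane) (i : Fin 2) (f g : L2 b) : Prop :=
  ∀ χ : Plane → ℝ, ContDiff ℝ ∞ χ → Periodic b χ →
    ∫ p, pd i χ p • f p ∂(torusMeasure b) = -∫ p, χ p • g p ∂(torusMeasure b)

/-- Multi-indices with values in `{x, y}` of length at most `k`. -/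
abbrev MultiIndex (k : ℕ) := {α : List (Fin 2) // α.length ≤ k}

instance (k : ℕ) : Fintype (MultiIndex k) := (List.finite_length_le (Fin 2) k).fintype

/-- A smooth function times an `L²` function is integrable. -/
lemma integrable_smul_L2 {b : Module.Basis (Fin 2) ℝ Plane} {χ : Plane → ℝ} (hχ : Continuous χ)
    (f : L2 b) : Integrable (fun p => χ p • f p) (torusMeasure b) := by
  have hbdd := ZSpan.fundamentalDomain_isBounded b
  have : IsFiniteMeasure (torusMeasure b) := by
    refine ⟨?_⟩
    rw [torusMeasure, Measure.restrict_apply_univ]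
    exact hbdd.measure_lt_top
  have hf : Integrable (fun p => f p) (torusMeasure b) :=
    (Lp.memLp f).integrable one_le_two
  obtain ⟨M, hM⟩ := (hbdd.isCompact_closure.image hχ).isBounded.exists_norm_le
  refine hf.bdd_smul M hχ.aestronglyMeasurable ?_
  rw [torusMeasure, ae_restrict_iff' (ZSpan.fundamentalDomain_measurableSet b)]
  exact Filter.Eventually.of_forall fun p hp => hM _ ⟨p, subset_closure hp, rfl⟩

/-- The classical partial derivative of a smooth function is continuous. -/
lemma continuous_pd {χ : Plane → ℝ} (hχ : ContDiff ℝ ∞ χ) (i : Fin 2) : Continuous (pd i χ) :=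
  (hχ.continuous_fderiv (by simp)).clm_apply continuous_const

/-- The Sobolev space `Hᵏ = Hᵏ(Σ, ℝ³)`. A function in `Hᵏ` is recorded by the family
`(D_α f)_{|α| ≤ k}` of its weak derivatives, all of them in `L²`; the entry at the empty multi-index
is `f` itself and determines the rest. The norm is the inherited one,
`‖f‖ₖ² = ∑_{|α| ≤ k} ‖D_α f‖²`. -/
def H (b : Module.Basis (Fin 2) ℝ Plane) (k : ℕ) :
    Submodule ℝ (PiLp 2 fun _ : MultiIndex k => L2 b) where
  carrier := {u | ∀ (i : Fin 2) (α : List (Fin 2)) (h : (i :: α).length ≤ k),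
    IsWeakPartial b i (u ⟨α, (Nat.le_succ _).trans h⟩) (u ⟨i :: α, h⟩)}
  zero_mem' := by
    intro i α h χ _ _
    have h0 : ((0 : L2 b) : Plane → R3) =ᵐ[torusMeasure b] 0 := Lp.coeFn_zero _ _ _
    have h1 (η : Plane → ℝ) : ∫ p, η p • ((0 : L2 b) : Plane → R3) p ∂(torusMeasure b) = 0 := by
      rw [integral_congr_ae (g := fun _ => (0 : R3))]
      · simp
      · filter_upwards [h0] with p hp
        rw [hp, Pi.zero_apply, smul_zero]
    simp only [PiLp.zero_apply, h1, neg_zero]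
  add_mem' := by
    intro u v hu hv i α h χ hχ hper
    have key (η : Plane → ℝ) (hη : Continuous η) (f g : L2 b) :
        ∫ p, η p • ((f + g : L2 b) : Plane → R3) p ∂(torusMeasure b)
          = ∫ p, η p • f p ∂(torusMeasure b) + ∫ p, η p • g p ∂(torusMeasure b) := by
      rw [← integral_add (integrable_smul_L2 hη f) (integrable_smul_L2 hη g)]
      refine integral_congr_ae ?_
      filter_upwards [Lp.coeFn_add f g] with p hp
      rw [hp, Pi.add_apply, smul_add]
    simp only [PiLp.add_apply]
    rw [key _ (continuous_pd hχ i), key _ hχ.continuous, hu i α h χ hχ hper, hv i α h χ hχ hper]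
    abel
  smul_mem' := by
    intro c u hu i α h χ hχ hper
    have key (η : Plane → ℝ) (f : L2 b) :
        ∫ p, η p • ((c • f : L2 b) : Plane → R3) p ∂(torusMeasure b)
          = c • ∫ p, η p • f p ∂(torusMeasure b) := by
      rw [← integral_smul]
      refine integral_congr_ae ?_
      filter_upwards [Lp.coeFn_smul c f] with p hp
      rw [hp, Pi.smul_apply, smul_comm]
    simp only [PiLp.smul_apply]
    rw [key, key, hu i α h χ hχ hper, smul_neg]

/-- The weak derivative `D_α u` of `u ∈ Hᵏ`, for `|α| ≤ k`; `D u []` is the function `u` itself. -/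
def D {b : Module.Basis (Fin 2) ℝ Plane} {k : ℕ} (u : H b k) (α : List (Fin 2)) : Plane → R3 :=
  if h : α.length ≤ k then (u.1 ⟨α, h⟩ : L2 b) else 0

/-- The inclusion `Hᵏ ⊆ Hᵐ` for `m ≤ k`. -/
def incl {b : Module.Basis (Fin 2) ℝ Plane} {k m : ℕ} (hmk : m ≤ k) (u : H b k) : H b m :=
  ⟨WithLp.toLp 2 fun α => u.1 ⟨α.1, α.2.trans hmk⟩, fun i α h => u.2 i α (h.trans hmk)⟩

/-- The element of `Hᵏ` represented by the function `f` (zero if `f` does not represent one). Weak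
derivatives are unique, so there is at most one such element. -/
def toH (b : Module.Basis (Fin 2) ℝ Plane) (k : ℕ) (f : Plane → R3) : H b k :=
  open Classical in
  if h : ∃ u : H b k, D u [] =ᵐ[torusMeasure b] f then h.choose else 0

/-! ### Holomorphic maps to the sphere -/

/-- The cross product on `ℝ³`. -/
def cross (u v : R3) : R3 := WithLp.toLp 2 (crossProduct u.ofLp v.ofLp)

/-- The classical Laplacian `∂ₓ∂ₓ f + ∂ᵧ∂ᵧ f`. -/
def lap (f : Plane → R3) : Plane → R3 := fun p => ∑ i, pd i (pd i f) p

/-- The space `M_n` of holomorphic maps `Σ → S²` of degree `n`. The complex structure of `S²` at `p`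
is `v ↦ p × v`, so the Cauchy-Riemann equation is `φ_y = φ × φ_x`; the degree is
`(4π)⁻¹ ∫_Σ φ · (φ_x × φ_y)`. -/
structure IsLump (b : Module.Basis (Fin 2) ℝ Plane) (n : ℕ) (φ : Plane → R3) : Prop where
  smooth : ContDiff ℝ ∞ φ
  periodic : Periodic b φ
  sphere : ∀ p, ‖φ p‖ = 1
  holomorphic : ∀ p, pd 1 φ p = cross (φ p) (pd 0 φ p)
  degree : (4 * Real.pi)⁻¹ * ip b φ (fun p => cross (pd 0 φ p) (pd 1 φ p)) = n

/-- The Jacobi operator `J_φ V = -ΔV - (|φ_x|² + |φ_y|²) V - 2 (φ_x · V_x + φ_y · V_y) φ` on smooth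
`V`. -/
def jacobi (φ V : Plane → R3) : Plane → R3 := fun p =>
  -lap V p - (∑ i, ‖pd i φ p‖ ^ 2) • V p - (2 * ∑ i, ⟪pd i φ p, pd i V p⟫) • φ p

/-- The kernel of `J_φ` on smooth sections of `φ⁻¹TS²`. -/
def jacobiKer (b : Module.Basis (Fin 2) ℝ Plane) (φ : Plane → R3) : Set (Plane → R3) :=
  {V | ContDiff ℝ ∞ V ∧ Periodic b V ∧ (∀ p, ⟪φ p, V p⟫ = 0) ∧ ∀ p, jacobi φ V p = 0}

/-- The derivative `∂F/∂q^μ` of a family `F(q, ·)` of maps. -/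
def dq {n : ℕ} (μ : Fin (4 * n)) (F : Coord n → Plane → R3) : Coord n → Plane → R3 :=
  fun q p => fderiv ℝ (fun q' => F q' p) q (EuclideanSpace.single μ 1)

/-- `ψ : U × Σ → S²` is a smooth local parametrization of `M_n` by coordinates `q ∈ U ⊆ ℝ⁴ⁿ`, the
partial derivatives `ψ_μ` of which form a basis of `ker J_ψ` at every point. -/
structure IsParametrization (b : Module.Basis (Fin 2) ℝ Plane) (n : ℕ) (U : Set (Coord n))
    (ψ : Coord n → Plane → R3) : Prop where
  isOpen : IsOpen U
  smooth : ContDiffOn ℝ ∞ (fun x : Coord n × Plane => ψ x.1 x.2) (U ×ˢ univ)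
  mem : ∀ q ∈ U, IsLump b n (ψ q)
  linearIndependent : ∀ q ∈ U, LinearIndependent ℝ fun μ => dq μ ψ q
  span : ∀ q ∈ U, (Submodule.span ℝ (range fun μ => dq μ ψ q) : Set (Plane → R3))
    = jacobiKer b (ψ q)

/-- The `L²` metric `γ_{μν}(q) = ⟨ψ_μ, ψ_ν⟩`. -/
def metric (b : Module.Basis (Fin 2) ℝ Plane) {n : ℕ} (ψ : Coord n → Plane → R3) (q : Coord n) :
    Matrix (Fin (4 * n)) (Fin (4 * n)) ℝ :=
  Matrix.of fun μ ν => ip b (dq μ ψ q) (dq ν ψ q)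

/-- The Christoffel symbol `G^μ_{λν} = γ^{μα} ⟨ψ_α, ψ_{λν}⟩`. -/
def christoffel (b : Module.Basis (Fin 2) ℝ Plane) {n : ℕ} (ψ : Coord n → Plane → R3)
    (q : Coord n) (μ l ν : Fin (4 * n)) : ℝ :=
  ∑ α, (metric b ψ q)⁻¹ μ α * ip b (dq α ψ q) (dq ν (dq l ψ) q)

/-! ### The improved Jacobi operator and its quadratic forms -/

/-- `J_φ u` for `u` in a Sobolev space. -/
def jacobiSob {b : Module.Basis (Fin 2) ℝ Plane} {k : ℕ} (φ : Plane → R3) (u : H b k) :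
    Plane → R3 := fun p =>
  -(∑ i, D u [i, i] p) - (∑ i, ‖pd i φ p‖ ^ 2) • D u [] p
    - (2 * ∑ i, ⟪pd i φ p, D u [i] p⟫) • φ p

/-- The `L²` adjoint of the first order part `A_φ Z = -2 (φ_x · Z_x + φ_y · Z_y) φ` of `J_φ`, namely
`A_φ† Z = 2 {(φ · Z) Δφ + (φ · Z)_x φ_x + (φ · Z)_y φ_y}`. -/
def adjointA {b : Module.Basis (Fin 2) ℝ Plane} {k : ℕ} (φ : Plane → R3) (u : H b k) :
    Plane → R3 := fun p =>
  (2 : ℝ) • (⟪φ p, D u [] p⟫ • lap φ p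
    + ∑ i, (⟪pd i φ p, D u [] p⟫ + ⟪φ p, D u [i] p⟫) • pd i φ p)

/-- The improved Jacobi operator `L_φ = J_φ + A_φ† : Hᵏ⁺² → Hᵏ`. For smooth periodic `φ` the function
in the definition does represent an element of `Hᵏ`, by the Leibniz rule. -/
def improvedJacobi {b : Module.Basis (Fin 2) ℝ Plane} {k : ℕ} (φ : Plane → R3) (u : H b (k + 2)) :
    H b k :=
  toH b k fun p => jacobiSob φ u p + adjointA φ u p

/-- The quadratic form `Q₁ : H¹ → ℝ`. -/
def Q1 {b : Module.Basis (Fin 2) ℝ Plane} (φ : Plane → R3) (u : H b 1) : ℝ :=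
  ∫ p, (∑ i, ‖D u [i] p‖ ^ 2 - (∑ i, ‖pd i φ p‖ ^ 2) * ‖D u [] p‖ ^ 2
    - 4 * (∑ i, ⟪pd i φ p, D u [i] p⟫) * ⟪φ p, D u [] p⟫) ∂(torusMeasure b)

/-- The quadratic form `Q₂ : H³ → ℝ`, `Q₂(Y) = Q₁(L Y)`. -/
def Q2 {b : Module.Basis (Fin 2) ℝ Plane} (φ : Plane → R3) (u : H b 3) : ℝ :=
  Q1 φ (improvedJacobi (k := 1) φ u)

/-! ### The right hand sides of the coupled system

Here `v`, `a` stand for the first and second derivatives of `q` with respect to the slow time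
`τ = ε t`, and `Z` stands for `Y_t`. -/

/-- `ψ_τ = ψ_μ v^μ`. -/
def psiTau {n : ℕ} (ψ : Coord n → Plane → R3) (q v : Coord n) : Plane → R3 :=
  fun p => ∑ μ, v μ • dq μ ψ q p

/-- `ψ_ττ = ψ_μ a^μ + ψ_{μν} v^μ v^ν`. -/
def psiTauTau {n : ℕ} (ψ : Coord n → Plane → R3) (q v a : Coord n) : Plane → R3 :=
  fun p => ∑ μ, a μ • dq μ ψ q p + ∑ μ, ∑ ν, (v μ * v ν) • dq ν (dq μ ψ) q p

/-- `k = -(ψ_ττ + |ψ_τ|² ψ)`. -/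
def kTerm {n : ℕ} (ψ : Coord n → Plane → R3) (q v a : Coord n) : Plane → R3 :=
  fun p => -(psiTauTau ψ q v a p + ‖psiTau ψ q v p‖ ^ 2 • ψ q p)

/-- `|Y_t|² - |Y_x|² - |Y_y|²`. -/
def lorentz {b : Module.Basis (Fin 2) ℝ Plane} (Y : H b 3) (Z : H b 2) : Plane → ℝ :=
  fun p => ‖D Z [] p‖ ^ 2 - ∑ i, ‖D Y [i] p‖ ^ 2

/-- The nonlinear term `j'` of the equation `Y_tt + L Y = k + ε j'`. The last summand, with its sign,
is `ε⁻¹ A_ψ† Y` for `Y` with `ψ · Y = -ε² |Y|² / 2`; the others are what remains when `ψ + ε² Y` is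
substituted in the wave map equation `φ_tt - Δφ + (|φ_t|² - |φ_x|² - |φ_y|²) φ = 0`, divided by `ε²`
and written as `Y_tt + J_ψ Y = k + ε (…)`. -/
def jTerm {b : Module.Basis (Fin 2) ℝ Plane} {n : ℕ} (ψ : Coord n → Plane → R3) (ε : ℝ)
    (q v : Coord n) (Y : H b 3) (Z : H b 2) : Plane → R3 := fun p =>
  -((2 * ⟪psiTau ψ q v p, D Z [] p⟫) • ψ q p
    + ε • (lorentz Y Z p • ψ q p
      + (‖psiTau ψ q v p‖ ^ 2 - 2 * ∑ i, ⟪pd i (ψ q) p, D Y [i] p⟫) • D Y [] p)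
    + (2 * ε ^ 2 * ⟪psiTau ψ q v p, D Z [] p⟫ + ε ^ 3 * lorentz Y Z p) • D Y [] p
    + ε • (‖D Y [] p‖ ^ 2 • lap (ψ q) p
      + ∑ i, (2 * ⟪D Y [] p, D Y [i] p⟫) • pd i (ψ q) p))

/-- The term `h` of the equation for `q`:
`h^μ = γ^{μν} {⟨j', ψ_ν⟩ + 2 ⟨Y_t, ψ_{νλ}⟩ v^λ + ε ⟨Y, ψ_{νλρ}⟩ v^λ v^ρ}`. -/
def hTerm {b : Module.Basis (Fin 2) ℝ Plane} {n : ℕ} (ψ : Coord n → Plane → R3) (ε : ℝ)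
    (q v : Coord n) (Y : H b 3) (Z : H b 2) (μ : Fin (4 * n)) : ℝ :=
  ∑ ν, (metric b ψ q)⁻¹ μ ν *
    (ip b (jTerm ψ ε q v Y Z) (dq ν ψ q)
      + 2 * ∑ l, ip b (D Z []) (dq l (dq ν ψ) q) * v l
      + ε * ∑ l, ∑ r, ip b (D Y []) (dq r (dq l (dq ν ψ)) q) * v l * v r)

/-! ### Solutions of the coupled system -/

/-- The `m`-th derivative of a curve on `[0, T]` with respect to the slow time `τ = ε t`. -/
def slowDeriv {n : ℕ} (ε T : ℝ) (m : ℕ) (q : ℝ → Coord n) (t : ℝ) : Coord n :=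
  (ε ^ m)⁻¹ • iteratedDerivWithin m q (Icc 0 T) t

/-- `Y_t : [0, T] → H²`. -/
def Yt {b : Module.Basis (Fin 2) ℝ Plane} (T : ℝ) (Y : ℝ → H b 3) (t : ℝ) : H b 2 :=
  derivWithin (fun s => incl (m := 2) (by norm_num) (Y s)) (Icc 0 T) t

/-- `Y_tt : [0, T] → H¹`. -/
def Ytt {b : Module.Basis (Fin 2) ℝ Plane} (T : ℝ) (Y : ℝ → H b 3) (t : ℝ) : H b 1 :=
  iteratedDerivWithin 2 (fun s => incl (m := 1) (by norm_num) (Y s)) (Icc 0 T) t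

/-- `(q, Y) : [0, T] → K × H³` solves the coupled system with initial data `q(0) = q₀`,
`q_t(0) = ε q₁`, `Y(0) = Y₀`, `Y_t(0) = Y₁`, and `q ∈ C³([0,T], K)`,
`Y ∈ C⁰([0,T], H³) ∩ C¹([0,T], H²) ∩ C²([0,T], H¹)`. -/
structure IsSolution (b : Module.Basis (Fin 2) ℝ Plane) {n : ℕ} (ψ : Coord n → Plane → R3)
    (K : Set (Coord n)) (ε T : ℝ) (q₀ q₁ : Coord n) (Y₀ : H b 3) (Y₁ : H b 2)
    (q : ℝ → Coord n) (Y : ℝ → H b 3) : Prop where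
  q_mem : ∀ t ∈ Icc 0 T, q t ∈ K
  q_C3 : ContDiffOn ℝ 3 q (Icc 0 T)
  Y_C0 : ContinuousOn Y (Icc 0 T)
  Y_C1 : ContDiffOn ℝ 1 (fun t => incl (m := 2) (by norm_num) (Y t)) (Icc 0 T)
  Y_C2 : ContDiffOn ℝ 2 (fun t => incl (m := 1) (by norm_num) (Y t)) (Icc 0 T)
  q_init : q 0 = q₀
  qt_init : derivWithin q (Icc 0 T) 0 = ε • q₁
  Y_init : Y 0 = Y₀
  Yt_init : Yt T Y 0 = Y₁
  Y_eq : ∀ t ∈ Icc 0 T, ∀ᵐ p ∂(torusMeasure b),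
    D (Ytt T Y t) [] p + D (improvedJacobi (k := 1) (ψ (q t)) (Y t)) [] p
      = kTerm ψ (q t) (slowDeriv ε T 1 q t) (slowDeriv ε T 2 q t) p
        + ε • jTerm ψ ε (q t) (slowDeriv ε T 1 q t) (Y t) (Yt T Y t) p
  q_eq : ∀ t ∈ Icc 0 T, ∀ μ,
    slowDeriv ε T 2 q t μ
        + ∑ l, ∑ ν, christoffel b ψ (q t) μ l ν * slowDeriv ε T 1 q t l * slowDeriv ε T 1 q t ν
      = ε * hTerm ψ ε (q t) (slowDeriv ε T 1 q t) (Y t) (Yt T Y t) μ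
        + ε ^ 2 * ∑ ν, ∑ l, (metric b ψ (q t))⁻¹ μ ν
            * ip b (D (Y t) []) (dq l (dq ν ψ) (q t)) * slowDeriv ε T 2 q t l

/-- The energy `E₂(t) = ½ ‖(L Y)_t‖₀² + ½ Q₂(Y)`. -/
def E2 {b : Module.Basis (Fin 2) ℝ Plane} {n : ℕ} (ψ : Coord n → Plane → R3) (T : ℝ)
    (q : ℝ → Coord n) (Y : ℝ → H b 3) (t : ℝ) : ℝ :=
  1 / 2 * ‖derivWithin (fun s => (improvedJacobi (k := 0) (ψ (q s))
      (incl (m := 2) (by norm_num) (Y s)) : H b 0)) (Icc 0 T) t‖ ^ 2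
    + 1 / 2 * Q2 (ψ (q t)) (Y t)

/-- A bounding function of `m` non-negative real arguments: smooth, positive and increasing in each
argument. -/
structure IsBoundingFunction {m : ℕ} (c : (Fin m → ℝ) → ℝ) : Prop where
  smooth : ContDiffOn ℝ ∞ c (Ici 0)
  pos : ∀ x ∈ Ici (0 : Fin m → ℝ), 0 < c x
  increasing : StrictMonoOn c (Ici 0)

end

end WaveMapTorus

open WaveMapTorus

namespace WaveMapTorus

open scoped Pointwise

noncomputable section

/-! ### Periodic functions on the plane -/

section Periodic

variable {b : Module.Basis (Fin 2) ℝ Plane} {E F G : Type*}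

/-! Write L = -Δ + N along the solution, where N = `lowerOrder` has order one and depends on time
only through q, and put w = LY. Applying L to the equation for Y and collecting the time derivatives
of N gives

w_tt + Lw = F, F = L(k + εj') + 2 N_t Y_t + N_tt Y.

The form of N is symmetric (`inner_lowerOrder_comm`). By `Q1_eq` the energy ½‖w_t‖² + ½(∫|∇w|² +
⟨Nw, w⟩) is E₂, and its derivative is ⟨F, w_t⟩ + ½⟨N_t w, w⟩.

Each time derivative of N costs a factor ε, because q_t = ε q̇, and j' carries its own ε. The only
term which is not of order ε is ⟨Lk, w_t⟩. It is integrated by parts in time: Lk depends on t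
through q, q̇, q̈ alone, so (Lk)_t is ε times an expression in q, q̇, q̈ and the third slow
derivative of q. Hence E₂ - ⟨Lk, LY⟩ has a derivative of order ε (`E2_add_inner_sub`,
`exists_energyRate_le`). As k is linear in q̈ and quadratic in q̇, the correction at time t is at
most C(|q̈| + |q̇|²)‖Y‖₂, which is the middle term of the estimate. The corrected energy at time 0
goes into C₀. This needs a bound for q̈(0), which is not an initial datum. The equation for q
supplies it: on its right hand side q̈ occurs with a coefficient of size ε²‖Y₀‖, and ε < κ/√Γ makes
this small enough to absorb (`exists_norm_acceleration_le`).

Three analytic points carry the argument.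

Regularity in time: w is continuous in H¹ and w_t in L², while w_tt is available only when paired
with elements of H¹, so w_t is not an admissible test function. The energy identity is proved for
weak solutions (`waveEnergy_sub`): average in time over windows of length h, test the averaged
equation with the derivative of the averaged curve, and let h tend to 0.

Products: Lj' must lie in L², so j' must lie in H². Its summands are products of three factors out
of Y, ∂Y, Y_t and smooth fields, all of them in H². Thus it suffices that H² is closed under (u ·
v)w (`exists_tri`). This follows from the embedding of H² in the bounded functions and a
Gagliardo-Nirenberg inequality, both proved for smooth fields and transferred by density
(`exists_seq_smoothH_tendsto`), which in turn rests on Fourier series.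

Uniformity: the constants depend on K only, because the coefficient operators are smooth functions
of q in operator norm (`contDiffOn_bcf`, `contDiffOn_lowerOrder`). They and their derivatives are
therefore bounded on the compact set K. -/

instance isFiniteMeasure_torusMeasure (b : Module.Basis (Fin 2) ℝ Plane) :
    IsFiniteMeasure (torusMeasure b) := by
  refine ⟨?_⟩
  rw [torusMeasure, Measure.restrict_apply_univ]
  exact (ZSpan.fundamentalDomain_isBounded b).measure_lt_top

lemma Periodic.add_of_mem_span {f : Plane → E} (hf : Periodic b f) {v : Plane}
    (hv : v ∈ Submodule.span ℤ (range b)) (p : Plane) : f (p + v) = f p := by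
  induction hv using Submodule.span_induction generalizing p with
  | mem x hx => obtain ⟨i, rfl⟩ := hx; exact hf i p
  | zero => rw [add_zero]
  | add x y _ _ hx hy => rw [← add_assoc, hy, hx]
  | smul a x _ hx =>
    induction a using Int.induction_on generalizing p with
    | zero => simp
    | succ i ih => rw [add_smul, one_smul, ← add_assoc, hx, ih]
    | pred i ih => rw [sub_smul, one_smul, ← hx (p + _), add_assoc, sub_add_cancel, ih]

lemma Periodic.fract {f : Plane → E} (hf : Periodic b f) (p : Plane) :
    f (ZSpan.fract b p) = f p := by
  rw [← hf.add_of_mem_span (ZSpan.floor b p).2, ZSpan.fract_apply, sub_add_cancel]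

lemma Periodic.comp {f : Plane → E} (hf : Periodic b f) (g : E → F) : Periodic b fun p => g (f p) :=
  fun i p => congrArg g (hf i p)

lemma Periodic.comp₂ {f : Plane → E} {f' : Plane → F} (hf : Periodic b f) (hf' : Periodic b f')
    (g : E → F → G) : Periodic b fun p => g (f p) (f' p) :=
  fun i p => congrArg₂ g (hf i p) (hf' i p)

lemma Periodic.pd [NormedAddCommGroup E] [NormedSpace ℝ E] {f : Plane → E} (hf : Periodic b f)
    (i : Fin 2) : Periodic b (pd i f) := by
  intro j p
  have : f = fun p => f (p + b j) := funext fun p => (hf j p).symm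
  unfold WaveMapTorus.pd
  conv_rhs => rw [this]
  rw [fderiv_comp_add_right]

/-- The closed fundamental parallelogram. -/
def cell (b : Module.Basis (Fin 2) ℝ Plane) : Set Plane := closure (ZSpan.fundamentalDomain b)

lemma isCompact_cell (b : Module.Basis (Fin 2) ℝ Plane) : IsCompact (cell b) :=
  (ZSpan.fundamentalDomain_isBounded b).isCompact_closure

lemma fract_mem_cell (p : Plane) : ZSpan.fract b p ∈ cell b :=
  subset_closure (ZSpan.fract_mem_fundamentalDomain b p)

/-- The closed cell is compact and contains a representative of every point. -/
lemma Periodic.exists_norm_le [NormedAddCommGroup E] {f : Plane → E} (hf : Periodic b f)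
    (hc : Continuous f) : ∃ C, ∀ p, ‖f p‖ ≤ C := by
  obtain ⟨C, hC⟩ := (isCompact_cell b).exists_bound_of_continuousOn hc.continuousOn
  exact ⟨C, fun p => hf.fract p ▸ hC _ (fract_mem_cell p)⟩

/-- The bounded continuous function with the values of `f` (zero if `f` is not of this kind). -/
def bcf [NormedAddCommGroup E] (f : Plane → E) : BoundedContinuousFunction Plane E :=
  open Classical in
  if h : Continuous f ∧ ∃ C, ∀ p, ‖f p‖ ≤ C then
    BoundedContinuousFunction.ofNormedAddCommGroup f h.1 h.2.choose h.2.choose_spec else 0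

lemma bcf_apply [NormedAddCommGroup E] {f : Plane → E} (hf : Periodic b f) (hc : Continuous f)
    (p : Plane) : bcf f p = f p := by
  rw [bcf, dif_pos ⟨hc, hf.exists_norm_le hc⟩]
  rfl

variable [NormedAddCommGroup E] [NormedSpace ℝ E] [NormedAddCommGroup F] [NormedSpace ℝ F]
  [NormedAddCommGroup G] [NormedSpace ℝ G]

/-- Smooth functions on the torus. -/
structure IsSmooth (b : Module.Basis (Fin 2) ℝ Plane) (f : Plane → E) : Prop where
  contDiff : ContDiff ℝ ∞ f
  periodic : Periodic b f

namespace IsSmooth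

variable {f g : Plane → E}

lemma continuous (hf : IsSmooth b f) : Continuous f := hf.contDiff.continuous

lemma differentiable (hf : IsSmooth b f) : Differentiable ℝ f :=
  hf.contDiff.differentiable (by simp)

lemma bcf_apply (hf : IsSmooth b f) (p : Plane) : bcf f p = f p :=
  WaveMapTorus.bcf_apply hf.periodic hf.continuous p

lemma pd (hf : IsSmooth b f) (i : Fin 2) : IsSmooth b (pd i f) :=
  ⟨(hf.contDiff.fderiv_right (by simp)).clm_apply contDiff_const, hf.periodic.pd i⟩

lemma const (b : Module.Basis (Fin 2) ℝ Plane) (c : E) : IsSmooth b fun _ => c :=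
  ⟨contDiff_const, fun _ _ => rfl⟩

lemma add (hf : IsSmooth b f) (hg : IsSmooth b g) : IsSmooth b (f + g) :=
  ⟨hf.contDiff.add hg.contDiff, hf.periodic.comp₂ hg.periodic (· + ·)⟩

lemma sub (hf : IsSmooth b f) (hg : IsSmooth b g) : IsSmooth b (f - g) :=
  ⟨hf.contDiff.sub hg.contDiff, hf.periodic.comp₂ hg.periodic (· - ·)⟩

lemma bilin (B : E →L[ℝ] F →L[ℝ] G) {g : Plane → F} (hf : IsSmooth b f) (hg : IsSmooth b g) :
    IsSmooth b fun p => B (f p) (g p) :=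
  ⟨(B.contDiff.comp hf.contDiff).clm_apply hg.contDiff, hf.periodic.comp₂ hg.periodic (B · ·)⟩

lemma clm (B : E →L[ℝ] F) (hf : IsSmooth b f) : IsSmooth b fun p => B (f p) :=
  ⟨B.contDiff.comp hf.contDiff, hf.periodic.comp B⟩

lemma smul {a : Plane → ℝ} (ha : IsSmooth b a) (hf : IsSmooth b f) :
    IsSmooth b fun p => a p • f p :=
  bilin (ContinuousLinearMap.lsmul ℝ ℝ) ha hf

lemma inner {f g : Plane → R3} (hf : IsSmooth b f) (hg : IsSmooth b g) :
    IsSmooth b fun p => ⟪f p, g p⟫ :=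
  bilin (innerSL ℝ) hf hg

lemma sum {ι : Type*} {s : Finset ι} {f : ι → Plane → E} (hf : ∀ i ∈ s, IsSmooth b (f i)) :
    IsSmooth b fun p => ∑ i ∈ s, f i p :=
  ⟨ContDiff.sum fun i hi => (hf i hi).contDiff,
    fun j p => Finset.sum_congr rfl fun i hi => (hf i hi).periodic j p⟩

lemma pd_add (hf : IsSmooth b f) (hg : IsSmooth b g) (i : Fin 2) :
    WaveMapTorus.pd i (f + g) = WaveMapTorus.pd i f + WaveMapTorus.pd i g := by
  funext p
  simp [WaveMapTorus.pd, fderiv_add (hf.differentiable p) (hg.differentiable p)]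

lemma pd_sub (hf : IsSmooth b f) (hg : IsSmooth b g) (i : Fin 2) :
    WaveMapTorus.pd i (f - g) = WaveMapTorus.pd i f - WaveMapTorus.pd i g := by
  funext p
  simp [WaveMapTorus.pd, fderiv_sub (hf.differentiable p) (hg.differentiable p)]

lemma pd_bilin (B : E →L[ℝ] F →L[ℝ] G) {g : Plane → F} (hf : IsSmooth b f) (hg : IsSmooth b g)
    (i : Fin 2) (p : Plane) : WaveMapTorus.pd i (fun p => B (f p) (g p)) p
      = B (WaveMapTorus.pd i f p) (g p) + B (f p) (WaveMapTorus.pd i g p) := by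
  have := B.hasFDerivAt_of_bilinear (hf.differentiable p).hasFDerivAt
    (hg.differentiable p).hasFDerivAt
  unfold WaveMapTorus.pd
  rw [this.fderiv]
  simp [add_comm]

lemma pd_inner {f g : Plane → R3} (hf : IsSmooth b f) (hg : IsSmooth b g) (i : Fin 2) (p : Plane) :
    WaveMapTorus.pd i (fun p => ⟪f p, g p⟫) p
      = ⟪WaveMapTorus.pd i f p, g p⟫ + ⟪f p, WaveMapTorus.pd i g p⟫ :=
  pd_bilin (innerSL ℝ) hf hg i p

lemma pd_smul {a : Plane → ℝ} (ha : IsSmooth b a) (hf : IsSmooth b f) (i : Fin 2) (p : Plane) :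
    WaveMapTorus.pd i (fun p => a p • f p) p
      = WaveMapTorus.pd i a p • f p + a p • WaveMapTorus.pd i f p :=
  pd_bilin (ContinuousLinearMap.lsmul ℝ ℝ) ha hf i p

end IsSmooth

lemma integrable_of_periodic {E : Type*} [NormedAddCommGroup E] {f : Plane → E} (hf : Periodic b f) (hc : Continuous f) :
    Integrable f (torusMeasure b) := by
  obtain ⟨C, hC⟩ := hf.exists_norm_le hc
  exact Integrable.of_bound hc.aestronglyMeasurable C (Filter.Eventually.of_forall hC)

/-- The parallelogram and its translate by `v` are fundamental domains of the same lattice action,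
and an invariant function has the same integral over both. -/
lemma integral_add_right_eq {f : Plane → E} (hf : Periodic b f) (v : Plane) :
    ∫ p, f (p + v) ∂(torusMeasure b) = ∫ p, f p ∂(torusMeasure b) := by
  have h0 := ZSpan.isAddFundamentalDomain b (volume : Measure Plane)
  have h1 := h0.vadd_of_comm v
  have : VAddInvariantMeasure (Submodule.span ℤ (range b)) Plane volume :=
    ⟨fun c s _ => measure_preimage_add volume (c : Plane) s⟩
  have h2 := h0.setIntegral_eq h1 (f := f) (fun g x => by
    rw [Submodule.vadd_def, vadd_eq_add, add_comm]
    exact hf.add_of_mem_span g.2 x)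
  rw [torusMeasure, h2]
  have h3 : v +ᵥ ZSpan.fundamentalDomain b = (fun p => p + v) '' ZSpan.fundamentalDomain b := by
    ext p
    simp only [Set.mem_vadd_set, mem_image, vadd_eq_add, add_comm]
  rw [h3]
  exact ((measurePreserving_add_right volume v).setIntegral_image_emb
    (measurableEmbedding_addRight v) _ _).symm

/-- The integral of p ↦ f(p + s e) does not depend on s. Differentiating under the integral sign at
s = 0 gives the claim; this is the source of all integrations by parts on the torus. -/
lemma integral_pd_eq_zero [CompleteSpace E] {f : Plane → E} (hf : IsSmooth b f) (i : Fin 2) :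
    ∫ p, pd i f p ∂(torusMeasure b) = 0 := by
  set e : Plane := EuclideanSpace.single i 1
  obtain ⟨C, hC⟩ := (hf.pd i).periodic.exists_norm_le (hf.pd i).continuous
  have key := hasDerivAt_integral_of_dominated_loc_of_deriv_le (μ := torusMeasure b)
    (F := fun (s : ℝ) p => f (p + s • e)) (F' := fun s p => pd i f (p + s • e)) (x₀ := 0)
    (s := univ) (bound := fun _ => C) Filter.univ_mem
    (Filter.Eventually.of_forall fun s =>
      (hf.continuous.comp (continuous_id.add continuous_const)).aestronglyMeasurable)
    (by simpa using integrable_of_periodic hf.periodic hf.continuous)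
    ((hf.pd i).continuous.comp (continuous_id.add continuous_const)).aestronglyMeasurable
    (Filter.Eventually.of_forall fun p s _ => hC _) (integrable_const _)
    (Filter.Eventually.of_forall fun p s _ => by
      have h1 : HasDerivAt (fun s : ℝ => p + s • e) e s := by
        simpa using ((hasDerivAt_id s).smul_const e).const_add p
      exact (hf.differentiable _).hasFDerivAt.comp_hasDerivAt s h1)
  have h2 := key.2
  simp only [integral_add_right_eq hf.periodic] at h2
  simpa using h2.unique (hasDerivAt_const _ _)

end Periodic

end

end WaveMapTorus

namespace WaveMapTorus

noncomputable section

/-! ### Operators on `L²` and on the Sobolev spaces -/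

section Operators

open scoped ENNReal

variable {b : Module.Basis (Fin 2) ℝ Plane}

/-- The class in `L²` of a continuous periodic vector field. -/
def emb (b : Module.Basis (Fin 2) ℝ Plane) (f : Plane → R3) : L2 b :=
  BoundedContinuousFunction.toLp 2 (torusMeasure b) ℝ (bcf f)

lemma IsSmooth.coeFn_emb {f : Plane → R3} (hf : IsSmooth b f) : emb b f =ᵐ[torusMeasure b] f := by
  filter_upwards [BoundedContinuousFunction.coeFn_toLp 2 (torusMeasure b) ℝ (bcf f)] with p hp
  exact hp.trans (hf.bcf_apply p)

/-- Multiplication of `L²` vector fields by bounded continuous endomorphism fields. -/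
def mulL (b : Module.Basis (Fin 2) ℝ Plane) :
    BoundedContinuousFunction Plane (R3 →L[ℝ] R3) →L[ℝ] L2 b →L[ℝ] L2 b :=
  ((ContinuousLinearMap.id ℝ (R3 →L[ℝ] R3)).holderL (torusMeasure b) ∞ 2 2).comp
    (BoundedContinuousFunction.toLp ∞ (torusMeasure b) ℝ)

lemma coeFn_mulL (A : BoundedContinuousFunction Plane (R3 →L[ℝ] R3)) (f : L2 b) :
    mulL b A f =ᵐ[torusMeasure b] fun p => A p (f p) := by
  filter_upwards [BoundedContinuousFunction.coeFn_toLp ∞ (torusMeasure b) ℝ A,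
    ContinuousLinearMap.coeFn_holder (r := 2) (ContinuousLinearMap.id ℝ (R3 →L[ℝ] R3))
      (BoundedContinuousFunction.toLp ∞ (torusMeasure b) ℝ A) f] with p hp hq
  rw [hp] at hq
  exact hq

lemma IsSmooth.coeFn_mulL {A : Plane → R3 →L[ℝ] R3} (hA : IsSmooth b A) (f : L2 b) :
    mulL b (bcf A) f =ᵐ[torusMeasure b] fun p => A p (f p) := by
  filter_upwards [WaveMapTorus.coeFn_mulL (bcf A) f] with p hp
  rw [hp, hA.bcf_apply]

lemma IsSmooth.inner_emb {f : Plane → R3} (hf : IsSmooth b f) (g : L2 b) :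
    ⟪emb b f, g⟫ = ∫ p, ⟪f p, g p⟫ ∂(torusMeasure b) := by
  rw [L2.inner_def]
  refine integral_congr_ae ?_
  filter_upwards [hf.coeFn_emb] with p hp
  rw [hp]

lemma IsSmooth.inner_emb_emb {f g : Plane → R3} (hf : IsSmooth b f) (hg : IsSmooth b g) :
    ⟪emb b f, emb b g⟫ = ∫ p, ⟪f p, g p⟫ ∂(torusMeasure b) := by
  rw [hf.inner_emb]
  refine integral_congr_ae ?_
  filter_upwards [hg.coeFn_emb] with p hp
  rw [hp]

lemma IsSmooth.emb_add {f g : Plane → R3} (hf : IsSmooth b f) (hg : IsSmooth b g) :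
    emb b (f + g) = emb b f + emb b g := by
  refine Lp.ext ?_
  filter_upwards [hf.coeFn_emb, hg.coeFn_emb, (hf.add hg).coeFn_emb,
    Lp.coeFn_add (emb b f) (emb b g)] with p h1 h2 h3 h4
  rw [h3, h4, Pi.add_apply, Pi.add_apply, h1, h2]

lemma IsSmooth.emb_sub {f g : Plane → R3} (hf : IsSmooth b f) (hg : IsSmooth b g) :
    emb b (f - g) = emb b f - emb b g := by
  refine Lp.ext ?_
  filter_upwards [hf.coeFn_emb, hg.coeFn_emb, (hf.sub hg).coeFn_emb,
    Lp.coeFn_sub (emb b f) (emb b g)] with p h1 h2 h3 h4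
  rw [h3, h4, Pi.sub_apply, Pi.sub_apply, h1, h2]

lemma IsSmooth.norm_emb_sq {f : Plane → R3} (hf : IsSmooth b f) :
    ‖emb b f‖ ^ 2 = ∫ p, ‖f p‖ ^ 2 ∂(torusMeasure b) := by
  rw [← real_inner_self_eq_norm_sq, hf.inner_emb_emb hf]
  simp only [real_inner_self_eq_norm_sq]

/-- Testing with vector fields turns the definition into identities between `L²` inner products,
which are continuous in `f` and `g`. A field splits into three scalar test functions times basis
vectors; conversely, the fields χ e recover the vector identity by pairing it with every e. -/
lemma isWeakPartial_iff {i : Fin 2} {f g : L2 b} : IsWeakPartial b i f g ↔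
    ∀ ξ : Plane → R3, IsSmooth b ξ → ⟪emb b (pd i ξ), f⟫ = -⟪emb b ξ, g⟫ := by
  have key (e : R3) {χ : Plane → ℝ} (hχ : IsSmooth b χ) (f : L2 b) :
      ⟪emb b (fun p => χ p • e), f⟫ = ⟪e, ∫ p, χ p • f p ∂(torusMeasure b)⟫ := by
    rw [(hχ.smul (.const b e)).inner_emb, ← integral_inner (integrable_smul_L2 hχ.continuous f)]
    simp only [real_inner_smul_left, real_inner_smul_right]
  have hpd (e : R3) {χ : Plane → ℝ} (hχ : IsSmooth b χ) :
      pd i (fun p => χ p • e) = fun p => pd i χ p • e := by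
    funext p
    rw [hχ.pd_smul (.const b e)]
    simp [pd]
  constructor
  · intro h ξ hξ
    have hc (c : Fin 3) : IsSmooth b fun p => ξ p c := hξ.clm (EuclideanSpace.proj c)
    have hdec : ξ = ∑ c, fun p => ξ p c • EuclideanSpace.basisFun (Fin 3) ℝ c := by
      funext p
      rw [Finset.sum_apply]
      exact ((EuclideanSpace.basisFun (Fin 3) ℝ).sum_repr (ξ p)).symm
    have h1 (c : Fin 3) := (hc c).smul (.const b (EuclideanSpace.basisFun (Fin 3) ℝ c))
    rw [hdec, Fin.sum_univ_three, ((h1 0).add (h1 1)).pd_add (h1 2), (h1 0).pd_add (h1 1),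
      (((h1 0).pd i).add ((h1 1).pd i)).emb_add ((h1 2).pd i), ((h1 0).pd i).emb_add ((h1 1).pd i),
      ((h1 0).add (h1 1)).emb_add (h1 2), (h1 0).emb_add (h1 1)]
    simp only [hpd _ (hc _), inner_add_left, key _ ((hc _).pd i), key _ (hc _)]
    simp only [h _ (hc _).contDiff (hc _).periodic, inner_neg_right]
    ring
  · intro h χ hχ hper
    have hs : IsSmooth b χ := ⟨hχ, hper⟩
    refine ext_inner_left ℝ fun e => ?_
    rw [← key e (hs.pd i), inner_neg_right, ← key e hs, ← hpd e hs, h _ (hs.smul (.const b e))]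

/-- Each smooth test field imposes one closed condition on the pair. Closedness gives completeness
of `H b k` and lets product rules pass to limits. -/
lemma isClosed_isWeakPartial (i : Fin 2) :
    IsClosed {x : L2 b × L2 b | IsWeakPartial b i x.1 x.2} := by
  simp only [isWeakPartial_iff, ofPred_forall]
  refine isClosed_iInter fun ξ => isClosed_iInter fun _ => isClosed_eq ?_ ?_ <;> fun_prop

lemma isClosed_H (b : Module.Basis (Fin 2) ℝ Plane) (k : ℕ) :
    IsClosed (H b k : Set (PiLp 2 fun _ : MultiIndex k => L2 b)) := by
  have : (H b k : Set (PiLp 2 fun _ : MultiIndex k => L2 b))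
      = ⋂ (i : Fin 2) (α : List (Fin 2)) (h : (i :: α).length ≤ k),
        (fun u : PiLp 2 fun _ : MultiIndex k => L2 b =>
          (u ⟨α, (Nat.le_succ _).trans h⟩, u ⟨i :: α, h⟩)) ⁻¹'
          {x : L2 b × L2 b | IsWeakPartial b i x.1 x.2} := by
    ext u
    simp only [mem_iInter]
    rfl
  rw [this]
  exact isClosed_iInter fun i => isClosed_iInter fun α => isClosed_iInter fun h =>
    (isClosed_isWeakPartial i).preimage (by fun_prop)

instance (k : ℕ) : CompleteSpace (H b k) := (isClosed_H b k).completeSpace_coe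

/-- The weak derivative `D_α` as a continuous linear map to `L²`. -/
def der {k : ℕ} (α : List (Fin 2)) (h : α.length ≤ k) : H b k →L[ℝ] L2 b :=
  (PiLp.proj 2 (fun _ : MultiIndex k => L2 b) ⟨α, h⟩).comp (H b k).subtypeL

lemma der_apply {k : ℕ} (α : List (Fin 2)) (h : α.length ≤ k) (u : H b k) :
    der α h u = u.1 ⟨α, h⟩ := rfl

lemma D_eq_der {k : ℕ} {α : List (Fin 2)} (h : α.length ≤ k) (u : H b k) :
    D u α = der α h u := by
  rw [D, dif_pos h, der_apply]

lemma norm_der_le {k : ℕ} (α : List (Fin 2)) (h : α.length ≤ k) (u : H b k) :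
    ‖der α h u‖ ≤ ‖u‖ :=
  PiLp.norm_apply_le u.1 _

lemma isWeakPartial_der {k : ℕ} {i : Fin 2} {α : List (Fin 2)} (h : (i :: α).length ≤ k)
    (u : H b k) : IsWeakPartial b i (der α ((Nat.le_succ _).trans h) u) (der (i :: α) h u) :=
  u.2 i α h

lemma norm_H_le {k : ℕ} (u : H b k) : ‖u‖ ≤ ∑ α : MultiIndex k, ‖der α.1 α.2 u‖ := by
  have h1 : ‖u‖ ^ 2 = ∑ α : MultiIndex k, ‖der α.1 α.2 u‖ ^ 2 :=
    PiLp.norm_sq_eq_of_L2 _ u.1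
  refine (pow_le_pow_iff_left₀ (norm_nonneg _)
    (Finset.sum_nonneg fun _ _ => norm_nonneg _) two_ne_zero).1 ?_
  rw [h1]
  exact Finset.sum_sq_le_sq_sum_of_nonneg fun _ _ => norm_nonneg _

lemma continuous_H {X : Type*} [TopologicalSpace X] {k : ℕ} {f : X → H b k}
    (h : ∀ α : MultiIndex k, Continuous fun x => der α.1 α.2 (f x)) : Continuous f := by
  refine Continuous.subtype_mk (f := fun x => (f x).1) ?_ fun x => (f x).2
  exact (PiLp.continuous_toLp 2 _).comp (continuous_pi h)

/-- The inclusion of Sobolev spaces as a continuous linear map. -/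
def inclL {k m : ℕ} (h : m ≤ k) : H b k →L[ℝ] H b m where
  toFun := incl h
  map_add' _ _ := rfl
  map_smul' _ _ := rfl
  cont := continuous_H fun α => (der α.1 (α.2.trans h)).continuous

lemma inclL_apply {k m : ℕ} (h : m ≤ k) (u : H b k) : inclL h u = incl h u := rfl

lemma der_incl {k m : ℕ} (h : m ≤ k) (u : H b k) (α : List (Fin 2)) (hα : α.length ≤ m) :
    der α hα (incl h u) = der α (hα.trans h) u := rfl

/-- `L²` vector fields as elements of `H⁰`. -/
def ofL2 (b : Module.Basis (Fin 2) ℝ Plane) : L2 b →L[ℝ] H b 0 where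
  toFun f := ⟨WithLp.toLp 2 fun _ => f, fun i α h => absurd h (by simp)⟩
  map_add' _ _ := rfl
  map_smul' _ _ := rfl
  cont := continuous_H fun _ => continuous_id

lemma der_ofL2 (f : L2 b) : der [] le_rfl (ofL2 b f) = f := rfl

lemma norm_ofL2 (f : L2 b) : ‖ofL2 b f‖ = ‖f‖ := by
  have h1 : ‖ofL2 b f‖ ^ 2 = ∑ α : MultiIndex 0, ‖f‖ ^ 2 := PiLp.norm_sq_eq_of_L2 _ _
  have h2 : Fintype.card (MultiIndex 0) = 1 :=
    Fintype.card_eq_one_iff.2 ⟨⟨[], le_rfl⟩, fun α => Subtype.ext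
      (List.length_eq_zero_iff.1 (Nat.le_zero.1 α.2))⟩
  rw [Finset.sum_const, Finset.card_univ, h2, one_smul] at h1
  exact (sq_eq_sq₀ (norm_nonneg _) (norm_nonneg _)).1 h1

/-- The shift `∂ᵢ : Hᵏ⁺¹ → Hᵏ`. -/
def shift {k : ℕ} (i : Fin 2) : H b (k + 1) →L[ℝ] H b k where
  -- The head of a list is the derivative taken last, so differentiating by ∂ᵢ before D_α appends
  -- `i` at the end.
  toFun u := ⟨WithLp.toLp 2 fun α => u.1 ⟨α.1 ++ [i], by simpa using α.2⟩,
    fun j α h => u.2 j (α ++ [i]) (by simpa using h)⟩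
  map_add' _ _ := rfl
  map_smul' _ _ := rfl
  cont := continuous_H fun α => (der (α.1 ++ [i]) (by simpa using α.2)).continuous

lemma der_shift {k : ℕ} (i : Fin 2) (u : H b (k + 1)) (α : List (Fin 2)) (hα : α.length ≤ k) :
    der α hα (shift i u) = der (α ++ [i]) (by simpa using hα) u := rfl

/-- Iterated classical partial derivatives. -/
def pdl {E : Type*} [NormedAddCommGroup E] [NormedSpace ℝ E] :
    List (Fin 2) → (Plane → E) → Plane → E
  | [], f => f
  | i :: α, f => pd i (pdl α f)

lemma IsSmooth.pdl {E : Type*} [NormedAddCommGroup E] [NormedSpace ℝ E] {f : Plane → E}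
    (hf : IsSmooth b f) : ∀ α, IsSmooth b (pdl α f)
  | [] => hf
  | i :: α => (hf.pdl α).pd i

lemma IsSmooth.pdl_sub {E : Type*} [NormedAddCommGroup E] [NormedSpace ℝ E] {f g : Plane → E}
    (hf : IsSmooth b f) (hg : IsSmooth b g) :
    ∀ α, WaveMapTorus.pdl α (f - g) = WaveMapTorus.pdl α f - WaveMapTorus.pdl α g
  | [] => rfl
  | i :: α => by
    rw [WaveMapTorus.pdl, hf.pdl_sub hg α, (hf.pdl α).pd_sub (hg.pdl α)]
    rfl

lemma IsSmooth.integral_by_parts {f g : Plane → R3} (hf : IsSmooth b f) (hg : IsSmooth b g)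
    (i : Fin 2) : ⟪emb b (WaveMapTorus.pd i f), emb b g⟫ = -⟪emb b f, emb b (WaveMapTorus.pd i g)⟫ := by
  have h := integral_pd_eq_zero (hf.inner hg) i
  simp only [hf.pd_inner hg] at h
  rw [integral_add] at h
  · rw [(hf.pd i).inner_emb_emb hg, hf.inner_emb_emb (hg.pd i)]
    linarith
  · exact integrable_of_periodic ((hf.pd i).inner hg).periodic ((hf.pd i).inner hg).continuous
  · exact integrable_of_periodic (hf.inner (hg.pd i)).periodic (hf.inner (hg.pd i)).continuous

lemma IsSmooth.isWeakPartial {f : Plane → R3} (hf : IsSmooth b f) (i : Fin 2) :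
    IsWeakPartial b i (emb b f) (emb b (WaveMapTorus.pd i f)) :=
  isWeakPartial_iff.2 fun _ hξ => hξ.integral_by_parts hf i

/-- A smooth periodic vector field as an element of `Hᵏ`. -/
def smoothH (k : ℕ) {f : Plane → R3} (hf : IsSmooth b f) : H b k :=
  ⟨WithLp.toLp 2 fun α => emb b (pdl α.1 f), fun i α _ => (hf.pdl α).isWeakPartial i⟩

lemma der_smoothH (k : ℕ) {f : Plane → R3} (hf : IsSmooth b f) (α : List (Fin 2))
    (h : α.length ≤ k) : der α h (smoothH k hf) = emb b (pdl α f) := rfl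

lemma smoothH_sub (k : ℕ) {f g : Plane → R3} (hf : IsSmooth b f) (hg : IsSmooth b g) :
    smoothH k (hf.sub hg) = smoothH k hf - smoothH k hg := by
  refine Subtype.ext (PiLp.ext fun α => ?_)
  change emb b (pdl α.1 (f - g)) = emb b (pdl α.1 f) - emb b (pdl α.1 g)
  rw [hf.pdl_sub hg, (hf.pdl α.1).emb_sub (hg.pdl α.1)]

end Operators

end

end WaveMapTorus

namespace WaveMapTorus

noncomputable section

/-! ### Fourier series on the torus and density of smooth fields -/

section Fourier

open scoped ENNReal NNReal
open Filter Topology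

attribute [local instance] instMeasureSpaceUnitAddCircle

variable {b : Module.Basis (Fin 2) ℝ Plane}

lemma equivFunL_preimage (b : Module.Basis (Fin 2) ℝ Plane) :
    b.equivFunL.symm ⁻¹' ZSpan.fundamentalDomain b = univ.pi fun _ => Ico (0 : ℝ) 1 := by
  ext x
  simp only [mem_preimage, ZSpan.mem_fundamentalDomain, mem_univ_pi]
  refine forall_congr' fun i => ?_
  have : b.repr (b.equivFunL.symm x) i = x i :=
    congrFun (b.equivFunL.apply_symm_apply x) i
  rw [this]

/-- The unit square is mapped to the fundamental parallelogram, up to a factor in the measure. -/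
lemma exists_map_unitSquare (b : Module.Basis (Fin 2) ℝ Plane) : ∃ c : ℝ≥0, 0 < c ∧
    Measure.map b.equivFunL.symm (volume.restrict (univ.pi fun _ => Ico (0 : ℝ) 1))
      = c • torusMeasure b := by
  -- A linear image of Lebesgue measure is a Haar measure, hence a positive multiple of `volume`;
  -- this multiple is `c`.
  have h1 : (Measure.map b.equivFunL.symm (volume : Measure (Fin 2 → ℝ))).IsAddHaarMeasure :=
    ContinuousLinearEquiv.isAddHaarMeasure_map _ _
  refine ⟨_, Measure.addHaarScalarFactor_pos_of_isAddHaarMeasure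
    (Measure.map b.equivFunL.symm (volume : Measure (Fin 2 → ℝ))) volume, ?_⟩
  rw [torusMeasure, ← Measure.restrict_smul, ← Measure.isAddLeftInvariant_eq_smul,
    Measure.restrict_map b.equivFunL.symm.continuous.measurable
      (ZSpan.fundamentalDomain_measurableSet b), equivFunL_preimage]

/-- The section of the projection to the standard torus with values in the parallelogram. -/
def torusSection (b : Module.Basis (Fin 2) ℝ Plane) (θ : UnitAddTorus (Fin 2)) : Plane :=
  b.equivFunL.symm (UnitAddTorus.measurableEquivPiIoc 0 θ).1

/-- Carries `L²` statements from the standard torus to the parallelogram, at the price of the factor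
`c`. The standard section takes values in (0,1]² and the parallelogram corresponds to [0,1)²; the
two squares differ by a null set. -/
lemma exists_measurePreserving_torusSection (b : Module.Basis (Fin 2) ℝ Plane) :
    ∃ c : ℝ≥0, 0 < c ∧ MeasurePreserving (torusSection b) volume (c • torusMeasure b) := by
  obtain ⟨c, hc, h⟩ := exists_map_unitSquare b
  refine ⟨c, hc, ?_⟩
  have h1 := UnitAddTorus.measurePreserving_equivPiIoc (0 : Fin 2 → ℝ)
  have h2 : MeasurableSet {x : Fin 2 → ℝ | ∀ i, x i ∈ Ioc ((0 : Fin 2 → ℝ) i) ((0 : Fin 2 → ℝ) i + 1)} :=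
    MeasurableSet.univ_pi' fun _ => measurableSet_Ioc
  have h3 : {x : Fin 2 → ℝ | ∀ i, x i ∈ Ioc ((0 : Fin 2 → ℝ) i) ((0 : Fin 2 → ℝ) i + 1)}
      = univ.pi fun _ => Ioc (0 : ℝ) 1 := by ext; simp
  refine ⟨b.equivFunL.symm.continuous.measurable.comp
    (measurable_subtype_coe.comp h1.measurable), ?_⟩
  have h4 : torusSection b
      = b.equivFunL.symm ∘ Subtype.val ∘ UnitAddTorus.measurableEquivPiIoc 0 := rfl
  rw [h4, ← Measure.map_map b.equivFunL.symm.continuous.measurable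
    (measurable_subtype_coe.comp h1.measurable), ← Measure.map_map measurable_subtype_coe
    h1.measurable]
  have h5 := map_comap_subtype_coe h2 (volume : Measure (Fin 2 → ℝ))
  rw [h1.map_eq]
  refine (congrArg (Measure.map b.equivFunL.symm) h5).trans ?_
  rw [h3, ← h]
  congr 1
  refine Measure.restrict_congr_set ?_
  exact (Measure.univ_pi_Ioc_ae_eq_Icc (f := fun _ => (0 : ℝ)) (g := fun _ => 1)).trans
    (Measure.univ_pi_Ico_ae_eq_Icc (f := fun _ => (0 : ℝ)) (g := fun _ => 1)).symm

/-- The phase `2π m · p` of a character, in lattice coordinates. -/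
def phase (b : Module.Basis (Fin 2) ℝ Plane) (m : Fin 2 → ℤ) : Plane →L[ℝ] ℝ :=
  ∑ j, (2 * Real.pi * m j) • (ContinuousLinearMap.proj j).comp
    (b.equivFunL : Plane →L[ℝ] Fin 2 → ℝ)

/-- In lattice coordinates `b i` is a unit vector, so the phase changes by an integer multiple of 2π
and its cosine and sine descend to the torus. -/
lemma phase_add_basis (m : Fin 2 → ℤ) (i : Fin 2) (p : Plane) :
    phase b m (p + b i) = phase b m p + m i * (2 * Real.pi) := by
  rw [map_add]
  congr 1
  have (j : Fin 2) : b.equivFunL (b i) j = if j = i then 1 else 0 := by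
    have : b.equivFunL (b i) j = b.repr (b i) j := rfl
    rw [this, b.repr_self, Finsupp.single_apply]
    simp only [eq_comm]
  simp only [phase, sum_apply, smul_apply, ContinuousLinearMap.comp_apply,
    ContinuousLinearMap.proj_apply, ContinuousLinearEquiv.coe_coe, this, smul_eq_mul, mul_ite,
    mul_one, mul_zero, Finset.sum_ite_eq', Finset.mem_univ, if_true]
  ring

lemma isSmooth_cos_phase (m : Fin 2 → ℤ) : IsSmooth b fun p => Real.cos (phase b m p) :=
  ⟨Real.contDiff_cos.comp (phase b m).contDiff, fun i p => by
    simp only [phase_add_basis, Real.cos_add_int_mul_two_pi]⟩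

lemma isSmooth_sin_phase (m : Fin 2 → ℤ) : IsSmooth b fun p => Real.sin (phase b m p) :=
  ⟨Real.contDiff_sin.comp (phase b m).contDiff, fun i p => by
    simp only [phase_add_basis, Real.sin_add_int_mul_two_pi]⟩

lemma pd_cos_phase (m : Fin 2 → ℤ) (i : Fin 2) (p : Plane) :
    pd i (fun p => Real.cos (phase b m p)) p
      = -(phase b m (EuclideanSpace.single i 1)) * Real.sin (phase b m p) := by
  have := ((phase b m).hasFDerivAt (x := p)).cos
  rw [pd, this.fderiv]
  simp [mul_comm]

lemma pd_sin_phase (m : Fin 2 → ℤ) (i : Fin 2) (p : Plane) :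
    pd i (fun p => Real.sin (phase b m p)) p
      = phase b m (EuclideanSpace.single i 1) * Real.cos (phase b m p) := by
  have := ((phase b m).hasFDerivAt (x := p)).sin
  rw [pd, this.fderiv]
  simp [mul_comm]

/-- The cosine coefficients of an `L²` vector field. -/
def cosCoeff (m : Fin 2 → ℤ) (f : L2 b) : R3 :=
  ∫ p, Real.cos (phase b m p) • f p ∂(torusMeasure b)

/-- The sine coefficients of an `L²` vector field. -/
def sinCoeff (m : Fin 2 → ℤ) (f : L2 b) : R3 :=
  ∫ p, Real.sin (phase b m p) • f p ∂(torusMeasure b)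

/-- The cosine of the phase is itself an admissible test function, and its derivative is a multiple
of the sine. -/
lemma IsWeakPartial.cosCoeff {i : Fin 2} {f g : L2 b} (h : IsWeakPartial b i f g)
    (m : Fin 2 → ℤ) :
    cosCoeff m g = phase b m (EuclideanSpace.single i 1) • sinCoeff m f := by
  have h1 := h _ (isSmooth_cos_phase m).contDiff (isSmooth_cos_phase m).periodic
  simp only [pd_cos_phase, neg_mul, neg_smul, mul_smul, integral_neg, integral_smul] at h1
  exact (neg_injective h1).symm

lemma IsWeakPartial.sinCoeff {i : Fin 2} {f g : L2 b} (h : IsWeakPartial b i f g)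
    (m : Fin 2 → ℤ) :
    sinCoeff m g = -(phase b m (EuclideanSpace.single i 1) • WaveMapTorus.cosCoeff m f) := by
  have h1 := h _ (isSmooth_sin_phase m).contDiff (isSmooth_sin_phase m).periodic
  simp only [pd_sin_phase, mul_smul, integral_smul] at h1
  rw [WaveMapTorus.cosCoeff, h1, neg_neg]
  rfl

/-- The partial sums of the Fourier series, up to a constant factor. -/
def fourierSum (s : Finset (Fin 2 → ℤ)) (f : L2 b) : Plane → R3 := fun p =>
  ∑ m ∈ s, (Real.cos (phase b m p) • cosCoeff m f + Real.sin (phase b m p) • sinCoeff m f)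

lemma isSmooth_fourierTerm (m : Fin 2 → ℤ) (u v : R3) :
    IsSmooth b fun p => Real.cos (phase b m p) • u + Real.sin (phase b m p) • v :=
  ((isSmooth_cos_phase m).smul (.const b u)).add ((isSmooth_sin_phase m).smul (.const b v))

lemma isSmooth_fourierSum (s : Finset (Fin 2 → ℤ)) (f : L2 b) : IsSmooth b (fourierSum s f) :=
  .sum fun m _ => isSmooth_fourierTerm m _ _

/-- Differentiating a partial sum classically gives the partial sum of the weak derivative. This is
why `L²` convergence of Fourier series improves to convergence in every `H b k`. -/
lemma IsWeakPartial.pd_fourierSum {i : Fin 2} {f g : L2 b} (h : IsWeakPartial b i f g)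
    (s : Finset (Fin 2 → ℤ)) : pd i (fourierSum s f) = fourierSum s g := by
  funext p
  unfold pd fourierSum
  rw [fderiv_fun_sum fun m _ => (isSmooth_fourierTerm m _ _).differentiable p,
    sum_apply]
  refine Finset.sum_congr rfl fun m _ => ?_
  have h1 := congrFun (((isSmooth_cos_phase m).smul (.const b (WaveMapTorus.cosCoeff m f))).pd_add
    ((isSmooth_sin_phase m).smul (.const b (WaveMapTorus.sinCoeff m f))) i) p
  refine h1.trans ?_
  rw [Pi.add_apply, (isSmooth_cos_phase m).pd_smul (.const b _),
    (isSmooth_sin_phase m).pd_smul (.const b _), pd_cos_phase, pd_sin_phase, h.cosCoeff, h.sinCoeff]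
  simp only [pd, fderiv_fun_const, Pi.zero_apply, zero_apply, smul_zero,
    add_zero]
  module

lemma mFourier_eq (m : Fin 2 → ℤ) (θ : UnitAddTorus (Fin 2)) :
    UnitAddTorus.mFourier m θ = Real.cos (phase b m (torusSection b θ))
      + Real.sin (phase b m (torusSection b θ)) * Complex.I := by
  set x := (UnitAddTorus.measurableEquivPiIoc 0 θ).1 with hx
  have h1 (j : Fin 2) : θ j = ((x j : ℝ) : UnitAddCircle) :=
    (congrFun ((UnitAddTorus.measurableEquivPiIoc 0).symm_apply_apply θ) j).symm
  have h2 : phase b m (torusSection b θ) = ∑ j, 2 * Real.pi * m j * x j := by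
    simp only [phase, torusSection, ← hx, sum_apply,
      smul_apply, ContinuousLinearMap.comp_apply, smul_eq_mul]
    simp
  rw [Complex.ofReal_cos, Complex.ofReal_sin, ← Complex.exp_mul_I, h2]
  simp only [UnitAddTorus.mFourier, ContinuousMap.coe_mk, h1, fourier_coe_apply,
    ← Complex.exp_sum]
  push_cast
  rw [Finset.sum_mul]
  congr 1
  refine Finset.sum_congr rfl fun j _ => ?_
  ring

/-- Each component of `f` is pulled back to the standard torus, expanded in the complex Fourier
series there, and recovered by taking real parts. The constant `c` is the factor between the two
measures. -/
lemma exists_tendsto_fourierSum (b : Module.Basis (Fin 2) ℝ Plane) : ∃ c : ℝ, ∀ f : L2 b,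
    Tendsto (fun s => c • emb b (fourierSum s f)) atTop (𝓝 f) := by
  obtain ⟨c, hc, hσ⟩ := exists_measurePreserving_torusSection b
  refine ⟨c, fun f => ?_⟩
  have hc0 : (c : ℝ≥0∞) ≠ 0 := by simpa using hc.ne'
  have hac : torusMeasure b ≪ c • torusMeasure b := Measure.absolutelyContinuous_smul (by simpa using hc.ne')
  have hf : MemLp (fun p => f p) 2 (c • torusMeasure b) :=
    (Lp.memLp f).smul_measure (c := (c : ℝ≥0∞)) ENNReal.coe_ne_top
  have hg (j : Fin 3) : MemLp (fun θ => ((f (torusSection b θ) j : ℝ) : ℂ)) 2 volume := by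
    have h1 := hf.comp_measurePreserving hσ
    exact (Complex.ofRealCLM.comp (EuclideanSpace.proj (𝕜 := ℝ) j)).comp_memLp' h1
  -- The conjugate character is cos - i sin, and the change of variables contributes `c`.
  have hcoeff (j : Fin 3) (m : Fin 2 → ℤ) : UnitAddTorus.mFourierCoeff ((hg j).toLp) m
      = c * ((cosCoeff m f j : ℝ) - (sinCoeff m f j : ℝ) * Complex.I) := by
    have h1 : UnitAddTorus.mFourierCoeff ((hg j).toLp) m
        = ∫ θ, UnitAddTorus.mFourier (-m) θ • ((f (torusSection b θ) j : ℝ) : ℂ) := by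
      refine integral_congr_ae ?_
      filter_upwards [(hg j).coeFn_toLp] with θ hθ
      rw [hθ]
    have h2 : ∫ θ, UnitAddTorus.mFourier (-m) θ • ((f (torusSection b θ) j : ℝ) : ℂ)
        = ∫ θ, (fun p => ((Real.cos (phase b m p) • f p) j : ℂ)
            - ((Real.sin (phase b m p) • f p) j : ℂ) * Complex.I) (torusSection b θ) := by
      refine integral_congr_ae (Eventually.of_forall fun θ => ?_)
      beta_reduce
      rw [UnitAddTorus.mFourier_neg, mFourier_eq (b := b)]
      simp only [map_add, map_mul,
        Complex.conj_ofReal, Complex.conj_I, PiLp.smul_apply, smul_eq_mul]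
      push_cast
      ring
    have hi (χ : Plane → ℝ) (hχ : Continuous χ) :
        Integrable (fun p => ((χ p • f p) j : ℂ)) (torusMeasure b) :=
      (Complex.ofRealCLM.comp (EuclideanSpace.proj (𝕜 := ℝ) j)).integrable_comp
        (integrable_smul_L2 hχ f)
    have hv (χ : Plane → ℝ) (hχ : Continuous χ) :
        ∫ p, ((χ p • f p) j : ℂ) ∂(torusMeasure b)
          = ((∫ p, χ p • f p ∂(torusMeasure b)) j : ℝ) :=
      (Complex.ofRealCLM.comp (EuclideanSpace.proj (𝕜 := ℝ) j)).integral_comp_comm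
        (integrable_smul_L2 hχ f)
    have hcos := (isSmooth_cos_phase (b := b) m).continuous
    have hsin := (isSmooth_sin_phase (b := b) m).continuous
    have hI := (hi _ hcos).sub ((hi _ hsin).mul_const Complex.I)
    have h3 := integral_map (φ := torusSection b) (μ := volume) hσ.measurable.aemeasurable
      (by rw [hσ.map_eq]; exact (hI.smul_measure (c := (c : ℝ≥0∞)) ENNReal.coe_ne_top).aestronglyMeasurable)
    rw [h1, h2]
    refine h3.symm.trans ?_
    simp only [Pi.sub_apply]
    rw [hσ.map_eq, integral_smul_nnreal_measure,
      integral_sub (hi _ hcos) ((hi _ hsin).mul_const _), integral_mul_const, hv _ hcos,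
      hv _ hsin]
    rfl
  have hsum (j : Fin 3) := UnitAddTorus.hasSum_mFourier_series_L2 ((hg j).toLp)
  set S : Fin 3 → Finset (Fin 2 → ℤ) → Lp ℂ 2 (volume : Measure (UnitAddTorus (Fin 2))) :=
    fun j s => ∑ m ∈ s, UnitAddTorus.mFourierCoeff ((hg j).toLp) m • UnitAddTorus.mFourierLp 2 m
    with hS
  -- The real part of (A - iB)(cos + i sin) is A cos + B sin, so the complex partial sum has `c`
  -- times the real one as its real part, without pairing m with -m.
  have hSval (j : Fin 3) (s : Finset (Fin 2 → ℤ)) :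
      ∀ᵐ θ, ((S j s) θ).re = ((c : ℝ) • fourierSum s f (torusSection b θ)) j := by
    have h1 : ∀ᵐ θ, (S j s) θ = ∑ m ∈ s, UnitAddTorus.mFourierCoeff ((hg j).toLp) m
        * UnitAddTorus.mFourier m θ := by
      have h2 : ∀ᵐ θ, ∀ m ∈ s, (UnitAddTorus.mFourierCoeff ((hg j).toLp) m •
          UnitAddTorus.mFourierLp 2 m : Lp ℂ 2 (volume : Measure (UnitAddTorus (Fin 2)))) θ
          = UnitAddTorus.mFourierCoeff ((hg j).toLp) m * UnitAddTorus.mFourier m θ := by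
        refine (ae_ball_iff s.countable_toSet).2 fun m _ => ?_
        filter_upwards [Lp.coeFn_smul (UnitAddTorus.mFourierCoeff ((hg j).toLp) m)
          (UnitAddTorus.mFourierLp 2 m), UnitAddTorus.coeFn_mFourierLp 2 m] with θ h3 h4
        rw [h3, Pi.smul_apply, h4, smul_eq_mul]
      filter_upwards [h2, Lp.coeFn_fun_finsetSum s fun m =>
        UnitAddTorus.mFourierCoeff ((hg j).toLp) m • UnitAddTorus.mFourierLp 2 m] with θ h3 h4
      rw [hS, h4]
      exact Finset.sum_congr rfl fun m hm => h3 m hm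
    filter_upwards [h1] with θ h2
    rw [h2, Complex.re_sum, PiLp.smul_apply, fourierSum, WithLp.ofLp_sum, Finset.sum_apply,
      smul_eq_mul, Finset.mul_sum]
    refine Finset.sum_congr rfl fun m _ => ?_
    rw [hcoeff, mFourier_eq (b := b)]
    simp [-Complex.ofReal_cos, -Complex.ofReal_sin]
    ring
  have hL2 (G : Lp ℂ 2 (volume : Measure (UnitAddTorus (Fin 2)))) :
      Integrable (fun θ => ‖G θ‖ ^ 2) ∧ ‖G‖ ^ 2 = ∫ θ, ‖G θ‖ ^ 2 := by
    refine ⟨(Lp.memLp G).integrable_norm_pow two_ne_zero, ?_⟩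
    have h1 := congrArg Complex.re (L2.inner_def (𝕜 := ℂ) G G)
    have h2 : (∫ θ, inner ℂ (G θ) (G θ)) = ((∫ θ, ‖G θ‖ ^ 2 : ℝ) : ℂ) := by
      rw [← integral_complex_ofReal]
      refine integral_congr_ae (Eventually.of_forall fun θ => ?_)
      simp [inner_self_eq_norm_sq_to_K]
    rw [h2, inner_self_eq_norm_sq_to_K] at h1
    exact_mod_cast h1
  -- The change of variables multiplies the squared norm by `c`, which explains the inverse;
  -- componentwise |Re z| ≤ |z|.
  have hbound (s : Finset (Fin 2 → ℤ)) :
      ‖(c : ℝ) • emb b (fourierSum s f) - f‖ ^ 2 ≤ (c : ℝ)⁻¹ * ∑ j, ‖S j s - (hg j).toLp‖ ^ 2 := by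
    have hcp : (0 : ℝ) < c := hc
    rw [le_inv_mul_iff₀ hcp]
    have hM : MemLp (fun p => (c : ℝ) • fourierSum s f p - f p) 2 (c • torusMeasure b) := by
      refine MemLp.sub ?_ hf
      have := (Lp.memLp (emb b (fourierSum s f))).ae_eq (isSmooth_fourierSum s f).coeFn_emb
      exact (this.smul_measure (c := (c : ℝ≥0∞)) ENNReal.coe_ne_top).const_smul (c : ℝ)
    have hint : Integrable (fun p => ‖(c : ℝ) • fourierSum s f p - f p‖ ^ 2)
        (c • torusMeasure b) := hM.integrable_norm_pow two_ne_zero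
    have h1 : ‖(c : ℝ) • emb b (fourierSum s f) - f‖ ^ 2
        = ∫ p, ‖(c : ℝ) • fourierSum s f p - f p‖ ^ 2 ∂(torusMeasure b) := by
      rw [← real_inner_self_eq_norm_sq, L2.inner_def]
      refine integral_congr_ae ?_
      filter_upwards [Lp.coeFn_sub ((c : ℝ) • emb b (fourierSum s f)) f,
        Lp.coeFn_smul (c : ℝ) (emb b (fourierSum s f)),
        (isSmooth_fourierSum s f).coeFn_emb] with p h2 h3 h4
      rw [h2, Pi.sub_apply, h3, Pi.smul_apply, h4, real_inner_self_eq_norm_sq]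
    have h2 : (c : ℝ) * ‖(c : ℝ) • emb b (fourierSum s f) - f‖ ^ 2
        = ∫ θ, ‖(c : ℝ) • fourierSum s f (torusSection b θ) - f (torusSection b θ)‖ ^ 2 := by
      have h3 := integral_map (φ := torusSection b) (μ := volume) hσ.measurable.aemeasurable
        (by rw [hσ.map_eq]; exact hint.aestronglyMeasurable)
      refine Eq.trans ?_ h3
      rw [hσ.map_eq, integral_smul_nnreal_measure, h1]
      rfl
    have h5 : ∑ j, ‖S j s - (hg j).toLp‖ ^ 2 = ∫ θ, ∑ j, ‖(S j s - (hg j).toLp) θ‖ ^ 2 := by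
      rw [integral_finsetSum _ fun j _ => (hL2 _).1]
      exact Finset.sum_congr rfl fun j _ => (hL2 _).2
    rw [h2, h5]
    refine integral_mono_ae (hσ.integrable_comp_of_integrable hint)
      (integrable_finsetSum _ fun j _ => (hL2 _).1) ?_
    have h6 : ∀ᵐ θ, ∀ j, ((c : ℝ) • fourierSum s f (torusSection b θ) - f (torusSection b θ)) j
        = ((S j s - (hg j).toLp) θ).re := by
      refine ae_all_iff.2 fun j => ?_
      filter_upwards [hSval j s, (hg j).coeFn_toLp, Lp.coeFn_sub (S j s) (hg j).toLp]
        with θ h7 h8 h9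
      rw [h9, Pi.sub_apply, h8, Complex.sub_re, h7, Complex.ofReal_re, PiLp.sub_apply]
    filter_upwards [h6] with θ h7
    beta_reduce
    rw [EuclideanSpace.norm_sq_eq]
    refine Finset.sum_le_sum fun j _ => ?_
    rw [h7, Real.norm_eq_abs]
    exact pow_le_pow_left₀ (abs_nonneg _) (Complex.abs_re_le_norm _) 2
  have hlim : Tendsto (fun s => (c : ℝ)⁻¹ * ∑ j, ‖S j s - (hg j).toLp‖ ^ 2) atTop (𝓝 0) := by
    have h1 (j : Fin 3) : Tendsto (fun s => ‖S j s - (hg j).toLp‖ ^ 2) atTop (𝓝 0) := by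
      have h2 := (tendsto_iff_norm_sub_tendsto_zero.1 (hsum j)).pow 2
      simpa using h2
    simpa using (tendsto_finsetSum Finset.univ fun j _ => h1 j).const_mul ((c : ℝ)⁻¹)
  have h0 := squeeze_zero (fun s => sq_nonneg _) hbound hlim
  rw [tendsto_iff_norm_sub_tendsto_zero]
  have h1 := h0.sqrt
  simpa using h1

lemma pdl_fourierSum {k : ℕ} (u : H b k) (s : Finset (Fin 2 → ℤ)) :
    ∀ (α : List (Fin 2)) (h : α.length ≤ k),
      pdl α (fourierSum s (der [] (Nat.zero_le k) u)) = fourierSum s (der α h u)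
  | [], _ => rfl
  | i :: α, h => by
    rw [pdl, pdl_fourierSum u s α ((Nat.le_succ _).trans h)]
    exact (isWeakPartial_der h u).pd_fourierSum s

/-- Smooth fields are dense in `Hᵏ`. -/
lemma exists_seq_smoothH_tendsto {k : ℕ} (u : H b k) : ∃ (f : ℕ → Plane → R3)
    (hf : ∀ n, IsSmooth b (f n)), Tendsto (fun n => smoothH k (hf n)) atTop (𝓝 u) := by
  obtain ⟨c, hc⟩ := exists_tendsto_fourierSum b
  obtain ⟨s, hs⟩ := (atTop : Filter (Finset (Fin 2 → ℤ))).exists_seq_tendsto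
  set P := fun n => fourierSum (s n) (der [] (Nat.zero_le k) u)
  have hP (n : ℕ) : IsSmooth b (P n) := isSmooth_fourierSum _ _
  have hlim : Tendsto (fun n => c • smoothH k (hP n)) atTop (𝓝 u) := by
    rw [tendsto_iff_norm_sub_tendsto_zero]
    refine squeeze_zero (fun _ => norm_nonneg _) (fun n => norm_H_le _) ?_
    have h0 : ∑ _α : MultiIndex k, (0 : ℝ) = 0 := Finset.sum_const_zero
    refine h0 ▸ tendsto_finsetSum _ fun α _ => ?_
    have h1 := (tendsto_iff_norm_sub_tendsto_zero.1 (hc (der α.1 α.2 u))).comp hs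
    refine h1.congr fun n => ?_
    rw [map_sub, map_smul, der_smoothH, pdl_fourierSum u (s n) α.1 α.2]
    rfl
  have hcP (n : ℕ) : IsSmooth b (fun p => c • P n p) := (IsSmooth.const b c).smul (hP n)
  refine ⟨fun n p => c • P n p, hcP, hlim.congr fun n => ?_⟩
  refine Subtype.ext (PiLp.ext fun α => ?_)
  have h2 : ∀ β, pdl β (fun p => c • P n p) = fun p => c • pdl β (P n) p := by
    intro β
    induction β with
    | nil => rfl
    | cons i β ih =>
      funext p
      rw [pdl, ih, (IsSmooth.const b c).smul ((hP n).pdl β) |> fun _ =>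
        (IsSmooth.const b c).pd_smul ((hP n).pdl β) i p]
      simp [pd, pdl]
  change c • emb b (pdl α.1 (P n)) = emb b (pdl α.1 (fun p => c • P n p))
  refine Lp.ext ?_
  filter_upwards [((hcP n).pdl α.1).coeFn_emb, ((hP n).pdl α.1).coeFn_emb,
    Lp.coeFn_smul c (emb b (pdl α.1 (P n)))] with p h3 h4 h5
  rw [h3, h5, Pi.smul_apply, h4, h2]

end Fourier

end

end WaveMapTorus

namespace WaveMapTorus

noncomputable section

/-! ### Calculus with weak derivatives and the improved Jacobi operator -/

section WeakCalculus

open Filter Topology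

variable {b : Module.Basis (Fin 2) ℝ Plane}

/-- `f` is itself a limit of smooth fields, whence ⟨f, f⟩ = 0. -/
lemma eq_zero_of_inner_emb {f : L2 b} (h : ∀ ξ : Plane → R3, IsSmooth b ξ → ⟪emb b ξ, f⟫ = 0) :
    f = 0 := by
  obtain ⟨ξ, hξ, hlim⟩ := exists_seq_smoothH_tendsto (ofL2 b f)
  have h1 : Tendsto (fun n => ⟪emb b (ξ n), f⟫) atTop (𝓝 ⟪f, f⟫) :=
    (((der [] le_rfl).continuous.tendsto (ofL2 b f)).comp hlim).inner tendsto_const_nhds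
  simp only [h _ (hξ _)] at h1
  exact inner_self_eq_zero.1 (tendsto_nhds_unique tendsto_const_nhds h1).symm

lemma IsWeakPartial.unique {i : Fin 2} {f g g' : L2 b} (h : IsWeakPartial b i f g)
    (h' : IsWeakPartial b i f g') : g = g' := by
  refine sub_eq_zero.1 (eq_zero_of_inner_emb fun ξ hξ => ?_)
  rw [inner_sub_right, ← neg_inj.1 ((isWeakPartial_iff.1 h ξ hξ).symm.trans
    (isWeakPartial_iff.1 h' ξ hξ)), sub_self]

/-- An element of `Hᵏ` is determined by the function that it represents. -/
lemma H_ext {k : ℕ} {u v : H b k} (h : der [] (Nat.zero_le k) u = der [] (Nat.zero_le k) v) :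
    u = v := by
  have key : ∀ (α : List (Fin 2)) (hα : α.length ≤ k), der α hα u = der α hα v := by
    intro α
    induction α with
    | nil => exact fun _ => h
    | cons i α ih =>
      intro hα
      have h1 := isWeakPartial_der hα u
      rw [ih] at h1
      exact h1.unique (isWeakPartial_der hα v)
  exact Subtype.ext (PiLp.ext fun α => key α.1 α.2)

lemma H_ext_ae {k : ℕ} {u v : H b k} (h : D u [] =ᵐ[torusMeasure b] D v []) : u = v := by
  rw [D_eq_der (Nat.zero_le k), D_eq_der (Nat.zero_le k)] at h
  exact H_ext (Lp.ext h)

/-- Uniqueness of weak derivatives makes the choice in `toH` harmless: any element representing `f`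
is the chosen one. -/
lemma toH_eq {k : ℕ} {f : Plane → R3} {u : H b k} (h : D u [] =ᵐ[torusMeasure b] f) :
    toH b k f = u := by
  have hex : ∃ u : H b k, D u [] =ᵐ[torusMeasure b] f := ⟨u, h⟩
  rw [toH, dif_pos hex]
  exact H_ext_ae (hex.choose_spec.trans h.symm)

/-- Only `u` needs approximating: against a smooth first factor the identity is the definition of
the weak derivative of `v`. -/
lemma integral_by_parts (u v : H b 1) (i : Fin 2) :
    ⟪der [i] le_rfl u, der [] (Nat.zero_le 1) v⟫ = -⟪der [] (Nat.zero_le 1) u, der [i] le_rfl v⟫ := by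
  obtain ⟨ξ, hξ, hlim⟩ := exists_seq_smoothH_tendsto u
  have h1 := (((der [i] le_rfl).continuous.tendsto u).comp hlim).inner (𝕜 := ℝ)
    (tendsto_const_nhds (x := der [] (Nat.zero_le 1) v))
  have h2 := ((((der [] (Nat.zero_le 1)).continuous.tendsto u).comp hlim).inner (𝕜 := ℝ)
    (tendsto_const_nhds (x := der [i] le_rfl v))).neg
  refine tendsto_nhds_unique h1 (h2.congr fun n => ?_)
  exact (isWeakPartial_iff.1 (isWeakPartial_der (α := []) le_rfl v) (ξ n) (hξ n)).symm

lemma IsSmooth.mulL_emb {A : Plane → R3 →L[ℝ] R3} (hA : IsSmooth b A) {f : Plane → R3}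
    (hf : IsSmooth b f) : mulL b (bcf A) (emb b f) = emb b fun p => A p (f p) := by
  refine Lp.ext ?_
  filter_upwards [hA.coeFn_mulL (emb b f), hf.coeFn_emb,
    (IsSmooth.bilin (ContinuousLinearMap.id ℝ _) hA hf).coeFn_emb] with p h1 h2 h3
  rw [h1, h2]
  exact h3.symm

/-- The Leibniz rule for the product of a smooth endomorphism field and an element of `H¹`. -/
lemma IsSmooth.isWeakPartial_mulL {A : Plane → R3 →L[ℝ] R3} (hA : IsSmooth b A) (u : H b 1)
    (i : Fin 2) : IsWeakPartial b i (mulL b (bcf A) (der [] (Nat.zero_le 1) u))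
      (mulL b (bcf (WaveMapTorus.pd i A)) (der [] (Nat.zero_le 1) u)
        + mulL b (bcf A) (der [i] le_rfl u)) := by
  obtain ⟨ξ, hξ, hlim⟩ := exists_seq_smoothH_tendsto u
  have h0 := ((der [] (Nat.zero_le 1)).continuous.tendsto u).comp hlim
  have h1 := ((der [i] le_rfl).continuous.tendsto u).comp hlim
  have h2 := (((mulL b (bcf A)).continuous.tendsto _).comp h0).prodMk_nhds
    ((((mulL b (bcf (WaveMapTorus.pd i A))).continuous.tendsto _).comp h0).add
      (((mulL b (bcf A)).continuous.tendsto _).comp h1))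
  -- The relation is closed, so the classical product rule for smooth approximations survives in the
  -- limit.
  refine (isClosed_isWeakPartial i).mem_of_tendsto h2 (Eventually.of_forall fun n => ?_)
  have hs : IsSmooth b fun p => A p (ξ n p) :=
    IsSmooth.bilin (ContinuousLinearMap.id ℝ _) hA (hξ n)
  have hs1 : IsSmooth b fun p => WaveMapTorus.pd i A p (ξ n p) :=
    IsSmooth.bilin (ContinuousLinearMap.id ℝ _) (hA.pd i) (hξ n)
  have hs2 : IsSmooth b fun p => A p (WaveMapTorus.pd i (ξ n) p) :=
    IsSmooth.bilin (ContinuousLinearMap.id ℝ _) hA ((hξ n).pd i)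
  have h3 : WaveMapTorus.pd i (fun p => A p (ξ n p))
      = (fun p => WaveMapTorus.pd i A p (ξ n p)) + fun p => A p (WaveMapTorus.pd i (ξ n) p) :=
    funext fun p => IsSmooth.pd_bilin (ContinuousLinearMap.id ℝ _) hA (hξ n) i p
  change IsWeakPartial b i (mulL b (bcf A) (emb b (ξ n)))
    (mulL b (bcf (WaveMapTorus.pd i A)) (emb b (ξ n))
      + mulL b (bcf A) (emb b (WaveMapTorus.pd i (ξ n))))
  rw [hA.mulL_emb (hξ n), (hA.pd i).mulL_emb (hξ n), hA.mulL_emb ((hξ n).pd i),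
    ← hs1.emb_add hs2, ← h3]
  exact hs.isWeakPartial i

/-- An element of `H¹` from a function and its first weak derivatives. -/
def mkH1 (f : L2 b) (g : Fin 2 → L2 b) (h : ∀ i, IsWeakPartial b i f (g i)) : H b 1 :=
  ⟨WithLp.toLp 2 fun α => match α.1 with | [] => f | i :: _ => g i, fun i α hα => by
    match α, hα with
    | [], _ => exact h i
    | _ :: _, hα => simp at hα⟩

lemma norm_H1_le {u : H b 1} {M : ℝ} (h0 : ‖der [] (Nat.zero_le 1) u‖ ≤ M)
    (h1 : ∀ i, ‖der [i] le_rfl u‖ ≤ M) : ‖u‖ ≤ Fintype.card (MultiIndex 1) * M := by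
  refine (norm_H_le u).trans ?_
  rw [← nsmul_eq_mul, ← Finset.card_univ]
  refine Finset.sum_le_card_nsmul _ _ _ fun α _ => ?_
  match α with
  | ⟨[], _⟩ => exact h0
  | ⟨[i], _⟩ => exact h1 i
  | ⟨_ :: _ :: _, hα⟩ => simp at hα

/-- The product of a smooth endomorphism field and an element of `H¹`. -/
def mulH1 {A : Plane → R3 →L[ℝ] R3} (hA : IsSmooth b A) (u : H b 1) : H b 1 :=
  mkH1 _ _ (hA.isWeakPartial_mulL u)

/-- The operator `u ↦ A D_α u`, linear in the bounded continuous coefficient `A`. -/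
def mulDer {k : ℕ} (α : List (Fin 2)) (h : α.length ≤ k) :
    BoundedContinuousFunction Plane (R3 →L[ℝ] R3) →L[ℝ] H b k →L[ℝ] L2 b :=
  (ContinuousLinearMap.precomp (L2 b) (der α h)).comp (mulL b)

lemma mulDer_apply {k : ℕ} (α : List (Fin 2)) (h : α.length ≤ k)
    (A : BoundedContinuousFunction Plane (R3 →L[ℝ] R3)) (u : H b k) :
    mulDer α h A u = mulL b A (der α h u) := rfl

/-- The operator `-Δ + N` from `H²` to `L²`. -/
def secondOrder (N : H b 1 →L[ℝ] L2 b) : H b 2 →L[ℝ] L2 b :=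
  -(∑ i, der [i, i] le_rfl) + N.comp (inclL one_le_two)

lemma secondOrder_apply (N : H b 1 →L[ℝ] L2 b) (u : H b 2) :
    secondOrder N u = -(∑ i, der [i, i] le_rfl u) + N (incl one_le_two u) := by
  simp [secondOrder, inclL_apply]

/-- The Dirichlet form `∑ᵢ ⟨uᵢ, vᵢ⟩`. -/
def dirichlet (b : Module.Basis (Fin 2) ℝ Plane) : H b 1 →L[ℝ] H b 1 →L[ℝ] ℝ :=
  ∑ i, (innerSL ℝ).bilinearComp (der [i] le_rfl) (der [i] le_rfl)

lemma dirichlet_apply (u v : H b 1) :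
    dirichlet b u v = ∑ i, ⟪der [i] le_rfl u, der [i] le_rfl v⟫ := by
  simp [dirichlet]

/-- One integration by parts moves a derivative from ∂ᵢ∂ᵢu to `v`. The right hand side makes sense
for u in `H b 1`, which is what the weak formulation in time relies on. -/
lemma inner_secondOrder (N : H b 1 →L[ℝ] L2 b) (u : H b 2) (v : H b 1) :
    ⟪secondOrder N u, der [] (Nat.zero_le 1) v⟫
      = dirichlet b (incl one_le_two u) v + ⟪N (incl one_le_two u), der [] (Nat.zero_le 1) v⟫ := by
  rw [secondOrder_apply, inner_add_left, inner_neg_left, sum_inner, dirichlet_apply,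
    ← Finset.sum_neg_distrib]
  congr 1
  refine Finset.sum_congr rfl fun i _ => ?_
  have := integral_by_parts (shift i u) v i
  rw [neg_eq_iff_eq_neg]
  exact this

/-- The rank one endomorphism `V ↦ (u · V) v`, bilinear in `(u, v)`. -/
def rankOneL : R3 →L[ℝ] R3 →L[ℝ] R3 →L[ℝ] R3 :=
  (ContinuousLinearMap.smulRightL ℝ R3 R3).comp (innerSL ℝ)

lemma rankOneL_apply (u v w : R3) : rankOneL u v w = ⟪u, w⟫ • v := rfl

/-- The coefficient field `V ↦ (φ · V) φᵢ`. -/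
def tangentProj (φ : Plane → R3) (i : Fin 2) : Plane → R3 →L[ℝ] R3 :=
  fun p => rankOneL (φ p) (pd i φ p)

/-- The zeroth order coefficient of the improved Jacobi operator. -/
def coeffZero (φ : Plane → R3) : Plane → R3 →L[ℝ] R3 :=
  fun p => ∑ i, ((2 : ℝ) • pd i (tangentProj φ i) p
    - ⟪pd i φ p, pd i φ p⟫ • ContinuousLinearMap.id ℝ R3)

/-- The first order coefficients of the improved Jacobi operator. -/
def coeffOne (φ : Plane → R3) (i : Fin 2) : Plane → R3 →L[ℝ] R3 :=
  fun p => (2 : ℝ) • tangentProj φ i p - (2 : ℝ) • rankOneL (pd i φ p) (φ p)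

variable {φ : Plane → R3}

lemma IsSmooth.tangentProj (hφ : IsSmooth b φ) (i : Fin 2) : IsSmooth b (tangentProj φ i) :=
  .bilin rankOneL hφ (hφ.pd i)

/-- The adjoint part of L is a divergence, A_φ†V = 2 ∑ ∂ᵢ((φ · V) φᵢ). Its zeroth order coefficient
is therefore twice the derivative of `tangentProj`, and the two summands here are the ones that
appear when A_φ† is written out. -/
lemma IsSmooth.pd_tangentProj (hφ : IsSmooth b φ) (i : Fin 2) (p : Plane) :
    WaveMapTorus.pd i (WaveMapTorus.tangentProj φ i) p
      = rankOneL (WaveMapTorus.pd i φ p) (WaveMapTorus.pd i φ p)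
        + rankOneL (φ p) (WaveMapTorus.pd i (WaveMapTorus.pd i φ) p) :=
  IsSmooth.pd_bilin rankOneL hφ (hφ.pd i) i p

lemma IsSmooth.coeffZero (hφ : IsSmooth b φ) : IsSmooth b (coeffZero φ) :=
  .sum fun i _ => ((IsSmooth.const b (2 : ℝ)).smul ((hφ.tangentProj i).pd i)).sub
    (((hφ.pd i).inner (hφ.pd i)).smul (.const b _))

lemma IsSmooth.coeffOne (hφ : IsSmooth b φ) (i : Fin 2) : IsSmooth b (coeffOne φ i) :=
  ((IsSmooth.const b (2 : ℝ)).smul (hφ.tangentProj i)).sub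
    ((IsSmooth.const b (2 : ℝ)).smul (.bilin rankOneL (hφ.pd i) hφ))

/-- The lower order part of the improved Jacobi operator. -/
def lowerOrder (b : Module.Basis (Fin 2) ℝ Plane) (φ : Plane → R3) : H b 1 →L[ℝ] L2 b :=
  mulDer [] (Nat.zero_le 1) (bcf (coeffZero φ)) + ∑ i, mulDer [i] le_rfl (bcf (coeffOne φ i))

lemma lowerOrder_apply (φ : Plane → R3) (u : H b 1) :
    lowerOrder b φ u = mulL b (bcf (coeffZero φ)) (der [] (Nat.zero_le 1) u)
      + ∑ i, mulL b (bcf (coeffOne φ i)) (der [i] le_rfl u) := by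
  simp [lowerOrder, mulDer_apply]

lemma IsSmooth.coeFn_lowerOrder (hφ : IsSmooth b φ) (u : H b 1) :
    lowerOrder b φ u =ᵐ[torusMeasure b] fun p => WaveMapTorus.coeffZero φ p (D u [] p)
      + ∑ i, WaveMapTorus.coeffOne φ i p (D u [i] p) := by
  rw [lowerOrder_apply, Fin.sum_univ_two]
  simp only [Fin.sum_univ_two, D_eq_der (α := []) (Nat.zero_le 1), D_eq_der (α := [_]) (le_refl 1)]
  filter_upwards [Lp.coeFn_add (mulL b (bcf (WaveMapTorus.coeffZero φ)) (der [] (Nat.zero_le 1) u))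
      (mulL b (bcf (WaveMapTorus.coeffOne φ 0)) (der [0] le_rfl u)
        + mulL b (bcf (WaveMapTorus.coeffOne φ 1)) (der [1] le_rfl u)),
    Lp.coeFn_add (mulL b (bcf (WaveMapTorus.coeffOne φ 0)) (der [0] le_rfl u))
      (mulL b (bcf (WaveMapTorus.coeffOne φ 1)) (der [1] le_rfl u)),
    hφ.coeffZero.coeFn_mulL (der [] (Nat.zero_le 1) u),
    (hφ.coeffOne 0).coeFn_mulL (der [0] le_rfl u),
    (hφ.coeffOne 1).coeFn_mulL (der [1] le_rfl u)] with p h1 h2 h3 h4 h5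
  rw [h1, Pi.add_apply, h2, Pi.add_apply, h3, h4, h5]

/-- Identifies -Δ + `lowerOrder`, an operator built from bounded continuous coefficients, with the
pointwise expression that defines L_φ. -/
lemma IsSmooth.coeFn_secondOrder (hφ : IsSmooth b φ) {k : ℕ} (u : H b (k + 2)) :
    secondOrder (lowerOrder b φ) (incl (Nat.le_add_left 2 k) u)
      =ᵐ[torusMeasure b] fun p => jacobiSob φ u p + adjointA φ u p := by
  set v : H b 2 := incl (Nat.le_add_left 2 k) u with hv
  have hD (α : List (Fin 2)) (hα : α.length ≤ 2) : D u α = D v α := by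
    rw [D_eq_der (hα.trans (Nat.le_add_left 2 k)), D_eq_der hα]
    rfl
  have hD1 (α : List (Fin 2)) (hα : α.length ≤ 1) : D (incl one_le_two v) α = D v α := by
    rw [D_eq_der (hα.trans one_le_two), D_eq_der hα]
    rfl
  rw [secondOrder_apply, Fin.sum_univ_two]
  filter_upwards [Lp.coeFn_add (-(der [0, 0] le_rfl v + der [1, 1] le_rfl v))
      (lowerOrder b φ (incl one_le_two v)), Lp.coeFn_neg (der [0, 0] le_rfl v + der [1, 1] le_rfl v),
    Lp.coeFn_add (der [0, 0] le_rfl v) (der [1, 1] le_rfl v),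
    hφ.coeFn_lowerOrder (incl one_le_two v)] with p h1 h2 h3 h4
  rw [h1, Pi.add_apply, h2, Pi.neg_apply, h3, Pi.add_apply, h4,
    ← D_eq_der (α := [0, 0]) le_rfl,
    ← D_eq_der (α := [1, 1]) le_rfl]
  simp only [jacobiSob, adjointA, hD [] (Nat.zero_le 2), hD [_] one_le_two,
    hD [_, _] le_rfl, hD1 [] (Nat.zero_le 1),
    hD1 [_] le_rfl, Fin.sum_univ_two, WaveMapTorus.coeffZero,
    WaveMapTorus.coeffOne, hφ.pd_tangentProj, lap, add_apply, sub_apply, smul_apply,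
    rankOneL_apply, WaveMapTorus.tangentProj, ContinuousLinearMap.id_apply,
    real_inner_self_eq_norm_sq]
  module

lemma IsSmooth.improvedJacobi_zero (hφ : IsSmooth b φ) (u : H b 2) :
    improvedJacobi (k := 0) φ u = ofL2 b (secondOrder (lowerOrder b φ) u) := by
  refine toH_eq ?_
  rw [D_eq_der (α := []) le_rfl, der_ofL2]
  exact hφ.coeFn_secondOrder (k := 0) u

/-- The improved Jacobi operator maps `H³` to `H¹`. -/
lemma IsSmooth.improvedJacobi_one (hφ : IsSmooth b φ) (u : H b 3) :
    der [] (Nat.zero_le 1) (improvedJacobi (k := 1) φ u)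
        = secondOrder (lowerOrder b φ) (incl (by norm_num) u) ∧
      ∀ j, der [j] le_rfl (improvedJacobi (k := 1) φ u)
        = -(∑ i, der [j, i, i] le_rfl u)
          + ((mulL b (bcf (WaveMapTorus.pd j (WaveMapTorus.coeffZero φ))) (der [] (Nat.zero_le 3) u)
              + mulL b (bcf (WaveMapTorus.coeffZero φ)) (der [j] (by simp) u))
            + ∑ i, (mulL b (bcf (WaveMapTorus.pd j (WaveMapTorus.coeffOne φ i)))
                (der [i] (by simp) u)
              + mulL b (bcf (WaveMapTorus.coeffOne φ i)) (der [j, i] (by simp) u))) := by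
  set u1 : H b 1 := incl (by norm_num) u
  set v : H b 2 := incl (by norm_num) u
  -- The candidate is assembled inside `H b 1`, with the product rule built into `mulH1`; `toH_eq`
  -- then identifies it with L_φ u, and its derivatives can be read off.
  set w : H b 1 := -(∑ i, shift i (shift i u)) + (mulH1 hφ.coeffZero u1
    + ∑ i, mulH1 (hφ.coeffOne i) (shift i v)) with hw
  have hw0 : der [] (Nat.zero_le 1) w = secondOrder (lowerOrder b φ) v := by
    rw [secondOrder_apply, lowerOrder_apply, hw]
    simp only [map_add, map_neg, map_sum]
    rfl
  have h : improvedJacobi (k := 1) φ u = w := by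
    refine toH_eq ?_
    rw [D_eq_der (α := []) (Nat.zero_le 1), hw0]
    exact hφ.coeFn_secondOrder (k := 1) u
  rw [h]
  refine ⟨hw0, fun j => ?_⟩
  rw [hw]
  simp only [map_add, map_neg, map_sum]
  rfl

/-- The scalar coefficient field `|φᵢ|²`. -/
def densityCoeff (φ : Plane → R3) (i : Fin 2) : Plane → R3 →L[ℝ] R3 :=
  fun p => ⟪pd i φ p, pd i φ p⟫ • ContinuousLinearMap.id ℝ R3

lemma IsSmooth.densityCoeff (hφ : IsSmooth b φ) (i : Fin 2) : IsSmooth b (densityCoeff φ i) :=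
  ((hφ.pd i).inner (hφ.pd i)).smul (.const b _)

lemma IsSmooth.bcf_coeffZero (hφ : IsSmooth b φ) : bcf (WaveMapTorus.coeffZero φ)
    = ∑ i, ((2 : ℝ) • bcf (WaveMapTorus.pd i (WaveMapTorus.tangentProj φ i))
      - bcf (WaveMapTorus.densityCoeff φ i)) := by
  ext1 p
  rw [hφ.coeffZero.bcf_apply, Fin.sum_univ_two]
  simp only [BoundedContinuousFunction.coe_add, BoundedContinuousFunction.coe_sub,
    BoundedContinuousFunction.coe_smul, Pi.add_apply, Pi.sub_apply, (hφ.densityCoeff _).bcf_apply,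
    ((hφ.tangentProj _).pd _).bcf_apply]
  rw [WaveMapTorus.coeffZero, Fin.sum_univ_two]
  rfl

lemma IsSmooth.bcf_coeffOne (hφ : IsSmooth b φ) (i : Fin 2) : bcf (WaveMapTorus.coeffOne φ i)
    = (2 : ℝ) • bcf (WaveMapTorus.tangentProj φ i)
      - (2 : ℝ) • bcf (fun p => rankOneL (WaveMapTorus.pd i φ p) (φ p)) := by
  ext1 p
  rw [(hφ.coeffOne i).bcf_apply]
  simp only [BoundedContinuousFunction.coe_sub, BoundedContinuousFunction.coe_smul, Pi.sub_apply,
    (hφ.tangentProj _).bcf_apply, (IsSmooth.bilin rankOneL (hφ.pd i) hφ).bcf_apply]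
  rfl

/-- The lower order part of the improved Jacobi operator is symmetric. -/
lemma IsSmooth.inner_lowerOrder (hφ : IsSmooth b φ) (u v : H b 1) :
    ⟪lowerOrder b φ u, der [] (Nat.zero_le 1) v⟫
      = ∑ i, (-2 * (⟪mulL b (bcf (WaveMapTorus.tangentProj φ i)) (der [] (Nat.zero_le 1) v),
            der [i] le_rfl u⟫
          + ⟪mulL b (bcf (WaveMapTorus.tangentProj φ i)) (der [] (Nat.zero_le 1) u),
            der [i] le_rfl v⟫)
        - ⟪mulL b (bcf (WaveMapTorus.densityCoeff φ i)) (der [] (Nat.zero_le 1) u),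
          der [] (Nat.zero_le 1) v⟫) := by
  -- Integrating the divergence ∂ᵢ((φ · u) φᵢ) by parts against `v` leaves -⟨(φ · u) φᵢ, vᵢ⟩.
  have hpar (i : Fin 2) := WaveMapTorus.integral_by_parts (mulH1 (hφ.tangentProj i) u) v i
  -- V ↦ (φᵢ · V) φ, the coefficient in the first order part of J_φ, is the pointwise transpose of
  -- `tangentProj`.
  have hT (i : Fin 2) (f g : L2 b) :
      ⟪mulL b (bcf fun p => rankOneL (WaveMapTorus.pd i φ p) (φ p)) f, g⟫
        = ⟪mulL b (bcf (WaveMapTorus.tangentProj φ i)) g, f⟫ := by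
    rw [L2.inner_def, L2.inner_def]
    refine integral_congr_ae ?_
    filter_upwards [(IsSmooth.bilin rankOneL (hφ.pd i) hφ).coeFn_mulL f,
      (hφ.tangentProj i).coeFn_mulL g] with p h1 h2
    rw [h1, h2, WaveMapTorus.tangentProj, rankOneL_apply, rankOneL_apply, real_inner_smul_left,
      real_inner_smul_left, mul_comm]
  rw [lowerOrder_apply, hφ.bcf_coeffZero]
  have hlin (A A' : BoundedContinuousFunction Plane (R3 →L[ℝ] R3)) (c : ℝ) (f : L2 b) :
      mulL b (c • A - A') f = c • mulL b A f - mulL b A' f := by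
    have h1 : mulL b (c • A - A') + mulL b A' = c • mulL b A := by
      have h2 : c • A - A' + A' = c • A :=
        BoundedContinuousFunction.ext fun p => sub_add_cancel (c • A p) (A' p)
      rw [← (mulL b).map_add, h2, (mulL b).map_smul]
    rw [eq_sub_of_add_eq h1]
    rfl
  simp only [hφ.bcf_coeffOne, map_sum, sum_apply, hlin, (mulL b).map_smul, smul_apply]
  rw [← Finset.sum_add_distrib, sum_inner]
  refine Finset.sum_congr rfl fun i _ => ?_
  simp only [inner_add_left, inner_sub_left, real_inner_smul_left, hT]
  have h1 : ⟪mulL b (bcf (WaveMapTorus.pd i (WaveMapTorus.tangentProj φ i)))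
      (der [] (Nat.zero_le 1) u) + mulL b (bcf (WaveMapTorus.tangentProj φ i)) (der [i] le_rfl u),
      der [] (Nat.zero_le 1) v⟫ = -⟪mulL b (bcf (WaveMapTorus.tangentProj φ i))
        (der [] (Nat.zero_le 1) u), der [i] le_rfl v⟫ := hpar i
  rw [inner_add_left] at h1
  linear_combination 2 * h1

/-- In the formula of `inner_lowerOrder` the two `tangentProj` terms are exchanged by swapping u and
v, and the remaining term is multiplication by a scalar. -/
lemma IsSmooth.inner_lowerOrder_comm (hφ : IsSmooth b φ) (u v : H b 1) :
    ⟪lowerOrder b φ u, der [] (Nat.zero_le 1) v⟫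
      = ⟪lowerOrder b φ v, der [] (Nat.zero_le 1) u⟫ := by
  rw [hφ.inner_lowerOrder, hφ.inner_lowerOrder]
  refine Finset.sum_congr rfl fun i _ => ?_
  have h : ⟪mulL b (bcf (WaveMapTorus.densityCoeff φ i)) (der [] (Nat.zero_le 1) u),
        der [] (Nat.zero_le 1) v⟫
      = ⟪mulL b (bcf (WaveMapTorus.densityCoeff φ i)) (der [] (Nat.zero_le 1) v),
        der [] (Nat.zero_le 1) u⟫ := by
    rw [L2.inner_def, L2.inner_def]
    refine integral_congr_ae ?_
    filter_upwards [(hφ.densityCoeff i).coeFn_mulL (der [] (Nat.zero_le 1) u),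
      (hφ.densityCoeff i).coeFn_mulL (der [] (Nat.zero_le 1) v)] with p h1 h2
    rw [h1, h2]
    simp only [WaveMapTorus.densityCoeff, smul_apply, ContinuousLinearMap.id_apply,
      real_inner_smul_left]
    rw [real_inner_comm (der [] (Nat.zero_le 1) v p)]
  rw [h]
  ring

/-- On the diagonal the two `tangentProj` terms coincide and produce the factor 4 in Q₁. Thus Q₁ is
the quadratic form of L_φ, and Q₂ is its value at LY. -/
lemma IsSmooth.Q1_eq (hφ : IsSmooth b φ) (u : H b 1) :
    Q1 φ u = dirichlet b u u + ⟪lowerOrder b φ u, der [] (Nat.zero_le 1) u⟫ := by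
  rw [hφ.inner_lowerOrder, dirichlet_apply, ← Finset.sum_add_distrib]
  have hI (f g : L2 b) : Integrable (fun p => ⟪f p, g p⟫) (torusMeasure b) :=
    L2.integrable_inner f g
  have hI4 (f g h : L2 b) : Integrable (fun p => ⟪f p, f p⟫ - 4 * ⟪g p, h p⟫) (torusMeasure b) :=
    (hI f f).sub ((hI g h).const_mul 4)
  let J : Fin 2 → Plane → ℝ := fun i p => ⟪der [i] le_rfl u p, der [i] le_rfl u p⟫
        - 4 * ⟪mulL b (bcf (WaveMapTorus.tangentProj φ i)) (der [] (Nat.zero_le 1) u) p,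
            der [i] le_rfl u p⟫
        - ⟪mulL b (bcf (WaveMapTorus.densityCoeff φ i)) (der [] (Nat.zero_le 1) u) p,
          der [] (Nat.zero_le 1) u p⟫
  have hJ (i : Fin 2) : Integrable (J i) (torusMeasure b) := (hI4 _ _ _).sub (hI _ _)
  have habs (f g h h' k : L2 b) : ⟪f, f⟫ + (-2 * (⟪g, h⟫ + ⟪g, h⟫) - ⟪h', k⟫)
      = ∫ p, (⟪f p, f p⟫ - 4 * ⟪g p, h p⟫ - ⟪h' p, k p⟫) ∂(torusMeasure b) := by
    rw [integral_sub (hI4 f g h) (hI h' k), integral_sub (hI f f) ((hI g h).const_mul 4),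
      integral_const_mul, ← L2.inner_def, ← L2.inner_def, ← L2.inner_def]
    ring
  have h1 (i : Fin 2) : ⟪der [i] le_rfl u, der [i] le_rfl u⟫
      + (-2 * (⟪mulL b (bcf (WaveMapTorus.tangentProj φ i)) (der [] (Nat.zero_le 1) u),
            der [i] le_rfl u⟫
          + ⟪mulL b (bcf (WaveMapTorus.tangentProj φ i)) (der [] (Nat.zero_le 1) u),
            der [i] le_rfl u⟫)
        - ⟪mulL b (bcf (WaveMapTorus.densityCoeff φ i)) (der [] (Nat.zero_le 1) u),
          der [] (Nat.zero_le 1) u⟫)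
      = ∫ p, J i p ∂(torusMeasure b) := habs _ _ _ _ _
  rw [Finset.sum_congr rfl fun i _ => h1 i, ← integral_finsetSum _ fun i _ => hJ i, Q1]
  refine integral_congr_ae ?_
  filter_upwards [(hφ.densityCoeff 0).coeFn_mulL (der [] (Nat.zero_le 1) u),
    (hφ.densityCoeff 1).coeFn_mulL (der [] (Nat.zero_le 1) u),
    (hφ.tangentProj 0).coeFn_mulL (der [] (Nat.zero_le 1) u),
    (hφ.tangentProj 1).coeFn_mulL (der [] (Nat.zero_le 1) u)] with p h1 h2 h3 h4
  simp only [J, Fin.sum_univ_two, h1, h2, h3, h4, D_eq_der (α := []) (Nat.zero_le 1),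
    D_eq_der (α := [_]) (le_refl 1), WaveMapTorus.densityCoeff, WaveMapTorus.tangentProj,
    rankOneL_apply, smul_apply, ContinuousLinearMap.id_apply, real_inner_smul_left,
    real_inner_self_eq_norm_sq]
  ring

end WeakCalculus

end

end WaveMapTorus

namespace WaveMapTorus

noncomputable section

/-! ### Sobolev inequalities and products -/

section Sobolev

open Filter Topology

variable {b : Module.Basis (Fin 2) ℝ Plane}

/-- The directional derivative. -/
def dirDeriv (v : Plane) (f : Plane → R3) : Plane → R3 := fun p => fderiv ℝ f p v

lemma dirDeriv_eq (v : Plane) (f : Plane → R3) (p : Plane) :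
    dirDeriv v f p = v 0 • pd 0 f p + v 1 • pd 1 f p := by
  have h : v = v 0 • EuclideanSpace.single 0 1 + v 1 • EuclideanSpace.single 1 1 := by
    ext i; fin_cases i <;> simp
  rw [dirDeriv]
  conv_lhs => rw [h]
  simp [pd]

lemma norm_dirDeriv_le (v : Plane) (f : Plane → R3) (p : Plane) :
    ‖dirDeriv v f p‖ ≤ ‖v‖ * (‖pd 0 f p‖ + ‖pd 1 f p‖) := by
  rw [dirDeriv_eq, mul_add]
  refine (norm_add_le _ _).trans ?_
  rw [norm_smul, norm_smul]
  gcongr <;> exact PiLp.norm_apply_le v _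

lemma IsSmooth.dirDeriv {f : Plane → R3} (hf : IsSmooth b f) (v : Plane) :
    IsSmooth b (dirDeriv v f) := by
  have h : WaveMapTorus.dirDeriv v f
      = (fun p => v 0 • WaveMapTorus.pd 0 f p) + fun p => v 1 • WaveMapTorus.pd 1 f p :=
    funext (dirDeriv_eq v f)
  rw [h]
  exact ((IsSmooth.const b (v 0)).smul (hf.pd 0)).add ((IsSmooth.const b (v 1)).smul (hf.pd 1))

/-- By the fundamental theorem of calculus f(p) differs from f(p + sv) by at most the integral of
the directional derivative along the segment; average this over s. -/
lemma IsSmooth.norm_le_integral_line {f : Plane → R3} (hf : IsSmooth b f) (v p : Plane) :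
    ‖f p‖ ≤ ∫ s in (0 : ℝ)..1, (‖f (p + s • v)‖ + ‖WaveMapTorus.dirDeriv v f (p + s • v)‖) := by
  have hl : Continuous fun s : ℝ => p + s • v := by fun_prop
  have hc := hf.continuous.comp hl
  have hc' := (hf.dirDeriv v).continuous.comp hl
  have hd (s : ℝ) : HasDerivAt (fun s : ℝ => f (p + s • v))
      (WaveMapTorus.dirDeriv v f (p + s • v)) s := by
    have h1 : HasDerivAt (fun s : ℝ => p + s • v) v s := by
      simpa using ((hasDerivAt_id s).smul_const v).const_add p
    exact (hf.differentiable _).hasFDerivAt.comp_hasDerivAt s h1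
  set I := ∫ s in (0 : ℝ)..1, ‖WaveMapTorus.dirDeriv v f (p + s • v)‖
  have h1 (s : ℝ) (hs : s ∈ Icc (0 : ℝ) 1) : ‖f p‖ ≤ ‖f (p + s • v)‖ + I := by
    have h2 := intervalIntegral.integral_eq_sub_of_hasDerivAt (a := 0) (b := s)
      (fun x _ => hd x) (hc'.intervalIntegrable _ _)
    have h3 : f p = f (p + s • v) - ∫ x in (0 : ℝ)..s, WaveMapTorus.dirDeriv v f (p + x • v) := by
      rw [h2]; simp
    rw [h3]
    refine (norm_sub_le _ _).trans ?_
    gcongr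
    refine (intervalIntegral.norm_integral_le_integral_norm hs.1).trans ?_
    exact intervalIntegral.integral_mono_interval le_rfl hs.1 hs.2
      (Eventually.of_forall fun _ => norm_nonneg _) (hc'.norm.intervalIntegrable _ _)
  have hcI : Continuous fun s : ℝ => ‖f (p + s • v)‖ + I := hc.norm.add continuous_const
  have h4 := intervalIntegral.integral_mono_on (μ := volume) zero_le_one
    (intervalIntegrable_const (c := ‖f p‖)) (hcI.intervalIntegrable 0 1) h1
  rw [intervalIntegral.integral_const, sub_zero, one_smul,
    intervalIntegral.integral_add (f := fun s : ℝ => ‖f (p + s • v)‖)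
      (hc.norm.intervalIntegrable _ _) intervalIntegrable_const,
    intervalIntegral.integral_const, sub_zero, one_smul] at h4
  refine h4.trans_eq (Eq.symm ?_)
  exact intervalIntegral.integral_add (hc.norm.intervalIntegrable _ _)
    (hc'.norm.intervalIntegrable _ _)

/-- Integration in lattice coordinates. -/
lemma exists_integral_lattice (b : Module.Basis (Fin 2) ℝ Plane) : ∃ c : ℝ, 0 ≤ c ∧
    ∀ (w : Plane → ℝ), Periodic b w → Continuous w → ∀ p,
      ∫ s in (0 : ℝ)..1, ∫ t in (0 : ℝ)..1, w (p + s • b 0 + t • b 1)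
        = c * ∫ p, w p ∂(torusMeasure b) := by
  obtain ⟨c, -, hc⟩ := exists_map_unitSquare b
  refine ⟨c, c.2, fun w hw hwc p => ?_⟩
  rw [← integral_add_right_eq hw p]
  have hwc' : Continuous fun x => w (x + p) := by fun_prop
  have h1 := integral_map (μ := volume.restrict (univ.pi fun _ => Ico (0 : ℝ) 1))
    (f := fun x => w (x + p)) b.equivFunL.symm.continuous.measurable.aemeasurable
    hwc'.aestronglyMeasurable
  rw [hc, integral_smul_nnreal_measure] at h1
  refine Eq.trans ?_ h1.symm
  have hcoord (x : Fin 2 → ℝ) : b.equivFunL.symm x = x 0 • b 0 + x 1 • b 1 := by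
    change b.equivFun.symm x = _
    rw [b.equivFun_symm_apply, Fin.sum_univ_two]
  have h2 : ∫ x in univ.pi fun _ => Ico (0 : ℝ) 1, w (b.equivFunL.symm x + p)
      = ∫ x in univ.pi fun _ : Fin 2 => Ioc (0 : ℝ) 1, w (b.equivFunL.symm x + p) := by
    refine setIntegral_congr_set ?_
    exact (Measure.univ_pi_Ico_ae_eq_Icc (f := fun _ => (0 : ℝ)) (g := fun _ => 1)).trans
      (Measure.univ_pi_Ioc_ae_eq_Icc (f := fun _ => (0 : ℝ)) (g := fun _ => 1)).symm
  rw [h2]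
  have h3 : (univ.pi fun _ : Fin 2 => Ioc (0 : ℝ) 1)
      = MeasurableEquiv.finTwoArrow ⁻¹' (Ioc (0 : ℝ) 1 ×ˢ Ioc (0 : ℝ) 1) := by
    ext x; simp [Fin.forall_fin_two]
  have hG : Continuous fun z : ℝ × ℝ => w (p + z.1 • b 0 + z.2 • b 1) := by fun_prop
  have h4 := (volume_preserving_finTwoArrow ℝ).setIntegral_preimage_emb
    MeasurableEquiv.finTwoArrow.measurableEmbedding
    (fun z : ℝ × ℝ => w (p + z.1 • b 0 + z.2 • b 1)) (Ioc (0 : ℝ) 1 ×ˢ Ioc (0 : ℝ) 1)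
  have h5 : ∀ x : Fin 2 → ℝ, w (b.equivFunL.symm x + p)
      = w (p + (MeasurableEquiv.finTwoArrow x).1 • b 0 + (MeasurableEquiv.finTwoArrow x).2 • b 1) := by
    intro x
    rw [hcoord, add_comm, add_assoc]
    rfl
  simp only [h5]
  rw [h3, h4, Measure.volume_eq_prod, setIntegral_prod, intervalIntegral.integral_of_le zero_le_one]
  · simp only [intervalIntegral.integral_of_le zero_le_one]
  · refine (hG.continuousOn.integrableOn_compact ((isCompact_Icc (a := (0 : ℝ)) (b := 1)).prod
      (isCompact_Icc (a := (0 : ℝ)) (b := 1)))).mono_set ?_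
    exact prod_mono Ioc_subset_Icc_self Ioc_subset_Icc_self

/-- Cauchy-Schwarz against a constant: with V the area and A = ∫‖f‖, expanding 0 ≤ ∫(V‖f‖ - A)²
gives VA² ≤ V²∫‖f‖². -/
lemma IsSmooth.integral_norm_le {f : Plane → R3} (hf : IsSmooth b f) :
    ∫ p, ‖f p‖ ∂(torusMeasure b) ≤ √((torusMeasure b).real univ) * ‖emb b f‖ := by
  have h1 : (∫ p, ‖f p‖ ∂(torusMeasure b)) ^ 2
      ≤ (torusMeasure b).real univ * ∫ p, ‖f p‖ ^ 2 ∂(torusMeasure b) := by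
    have hi : Integrable (fun p => ‖f p‖) (torusMeasure b) :=
      integrable_of_periodic (hf.periodic.comp _) hf.continuous.norm
    have hi2 : Integrable (fun p => ‖f p‖ ^ 2) (torusMeasure b) :=
      integrable_of_periodic (hf.periodic.comp (‖·‖ ^ 2)) (hf.continuous.norm.pow 2)
    set A := ∫ p, ‖f p‖ ∂(torusMeasure b)
    set V := (torusMeasure b).real univ with hV
    have h2 : 0 ≤ ∫ p, (V * ‖f p‖ - A) ^ 2 ∂(torusMeasure b) :=
      integral_nonneg fun _ => sq_nonneg _
    have h3 : ∀ p, (V * ‖f p‖ - A) ^ 2 = V ^ 2 * ‖f p‖ ^ 2 - 2 * V * A * ‖f p‖ + A ^ 2 := by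
      intro p; ring
    simp only [h3] at h2
    have hi' : Integrable (fun p => V ^ 2 * ‖f p‖ ^ 2 - 2 * V * A * ‖f p‖) (torusMeasure b) :=
      (hi2.const_mul _).sub (hi.const_mul _)
    rw [integral_add hi' (integrable_const _),
      integral_sub (hi2.const_mul _) (hi.const_mul _), integral_const_mul, integral_const_mul,
      integral_const, ← hV, smul_eq_mul] at h2
    have hV0 : 0 ≤ V := measureReal_nonneg
    rcases hV0.eq_or_lt with h0 | h0
    · have : (torusMeasure b) univ = 0 := by
        rwa [hV, eq_comm, measureReal_eq_zero_iff] at h0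
      have h4 : A = 0 := by
        simp only [A, Measure.measure_univ_eq_zero.1 this, integral_zero_measure]
      rw [h4, ← h0]; simp
    · have : V * A ^ 2 ≤ V * (V * ∫ p, ‖f p‖ ^ 2 ∂(torusMeasure b)) := by
        nlinarith
      exact le_of_mul_le_mul_left this h0
  rw [← hf.norm_emb_sq] at h1
  have h2 := Real.abs_le_sqrt h1
  rw [Real.sqrt_mul measureReal_nonneg, Real.sqrt_sq (norm_nonneg _)] at h2
  exact (le_abs_self _).trans h2

/-- The Sobolev embedding of `H²` into the bounded functions, for smooth functions. -/
lemma exists_norm_le_smoothH (b : Module.Basis (Fin 2) ℝ Plane) : ∃ C : ℝ, 0 ≤ C ∧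
    ∀ (f : Plane → R3) (hf : IsSmooth b f) (p : Plane), ‖f p‖ ≤ C * ‖smoothH 2 hf‖ := by
  obtain ⟨c, hc, hint⟩ := exists_integral_lattice b
  set V := √((torusMeasure b).real univ)
  set B := ‖b 0‖
  set B' := ‖b 1‖
  refine ⟨c * (V * (1 + 2 * B' + 2 * B + 4 * B * B')), by positivity, fun f hf p => ?_⟩
  set d0 := dirDeriv (b 0) f
  -- The one-dimensional inequality will be used in the direction `b 0` and then in the direction `b
  -- 1`. This produces f, its two directional derivatives and the mixed one, and no derivative of
  -- order above two.
  set w : Plane → ℝ := fun p => (‖f p‖ + ‖dirDeriv (b 1) f p‖) + (‖d0 p‖ + ‖dirDeriv (b 1) d0 p‖)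
    with hw
  have h0 := hf.dirDeriv (b 0)
  have h1 := hf.dirDeriv (b 1)
  have h01 := h0.dirDeriv (b 1)
  have hwc : Continuous w := ((hf.continuous.norm).add h1.continuous.norm).add
    (h0.continuous.norm.add h01.continuous.norm)
  have hwp : Periodic b w := fun i q => by
    simp only [hw, d0, hf.periodic i q, h1.periodic i q, h0.periodic i q, h01.periodic i q]
  have hN (α : List (Fin 2)) (hα : α.length ≤ 2) :
      ∫ p, ‖pdl α f p‖ ∂(torusMeasure b) ≤ V * ‖smoothH 2 hf‖ := by
    refine (hf.pdl α).integral_norm_le.trans ?_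
    gcongr
    rw [← der_smoothH 2 hf α hα]
    exact norm_der_le _ _ _
  have hi (α : List (Fin 2)) : Integrable (fun p => ‖pdl α f p‖) (torusMeasure b) :=
    integrable_of_periodic ((hf.pdl α).periodic.comp _) (hf.pdl α).continuous.norm
  have hd0 (i : Fin 2) (q : Plane) :
      ‖pd i d0 q‖ ≤ B * (‖pdl [i, 0] f q‖ + ‖pdl [i, 1] f q‖) := by
    have h2 : d0 = (fun p => b 0 0 • pd 0 f p) + fun p => b 0 1 • pd 1 f p :=
      funext (dirDeriv_eq _ f)
    have h3 (j : Fin 2) : pd i (fun p => b 0 j • pd j f p) q = b 0 j • pdl [i, j] f q := by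
      rw [(IsSmooth.const b (b 0 j)).pd_smul (hf.pd j)]
      simp [pd, pdl]
    rw [h2, ((IsSmooth.const b (b 0 0)).smul (hf.pd 0)).pd_add
      ((IsSmooth.const b (b 0 1)).smul (hf.pd 1)), Pi.add_apply, h3, h3, mul_add]
    refine (norm_add_le _ _).trans ?_
    rw [norm_smul, norm_smul]
    gcongr <;> exact PiLp.norm_apply_le (b 0) _
  have hpt (q : Plane) : w q ≤ ‖pdl [] f q‖ + B' * (‖pdl [0] f q‖ + ‖pdl [1] f q‖)
      + (B * (‖pdl [0] f q‖ + ‖pdl [1] f q‖) + B' * (B * (‖pdl [0, 0] f q‖ + ‖pdl [0, 1] f q‖)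
        + B * (‖pdl [1, 0] f q‖ + ‖pdl [1, 1] f q‖))) := by
    refine add_le_add (add_le_add le_rfl (norm_dirDeriv_le _ _ _))
      (add_le_add (norm_dirDeriv_le _ _ _) ((norm_dirDeriv_le _ _ _).trans ?_))
    gcongr <;> exact hd0 _ q
  have hfin : ∫ q, w q ∂(torusMeasure b)
      ≤ V * ‖smoothH 2 hf‖ * (1 + 2 * B' + 2 * B + 4 * B * B') := by
    have hB : 0 ≤ B := norm_nonneg _
    have hB' : 0 ≤ B' := norm_nonneg _
    set X := V * ‖smoothH 2 hf‖
    have add {g h : Plane → ℝ} {M M' : ℝ}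
        (hg : Integrable g (torusMeasure b) ∧ ∫ q, g q ∂(torusMeasure b) ≤ M)
        (hh : Integrable h (torusMeasure b) ∧ ∫ q, h q ∂(torusMeasure b) ≤ M') :
        Integrable (fun q => g q + h q) (torusMeasure b) ∧
          ∫ q, (g q + h q) ∂(torusMeasure b) ≤ M + M' :=
      ⟨hg.1.add hh.1, (integral_add hg.1 hh.1).trans_le (add_le_add hg.2 hh.2)⟩
    have mul {g : Plane → ℝ} {M t : ℝ} (ht : 0 ≤ t)
        (hg : Integrable g (torusMeasure b) ∧ ∫ q, g q ∂(torusMeasure b) ≤ M) :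
        Integrable (fun q => t * g q) (torusMeasure b) ∧
          ∫ q, t * g q ∂(torusMeasure b) ≤ t * M :=
      ⟨hg.1.const_mul t, (integral_const_mul t g).trans_le (mul_le_mul_of_nonneg_left hg.2 ht)⟩
    have e (α : List (Fin 2)) (hα : α.length ≤ 2) := And.intro (hi α) (hN α hα)
    have e1 := add (e [0] (by simp)) (e [1] (by simp))
    have e2 := mul hB (add (e [0, 0] (by simp)) (e [0, 1] (by simp)))
    have e3 := mul hB (add (e [1, 0] (by simp)) (e [1, 1] (by simp)))
    have e4 := add (add (e [] (by simp)) (mul hB' e1)) (add (mul hB e1) (mul hB' (add e2 e3)))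
    refine (integral_mono (integrable_of_periodic hwp hwc) e4.1 hpt).trans (e4.2.trans_eq ?_)
    ring
  -- The inequality along `b 0` bounds `f p` by f and `d0` on a segment; each of these is then
  -- bounded along `b 1`. The double integral is an integral over the torus by `hint`.
  have hline : ‖f p‖ ≤ ∫ s in (0 : ℝ)..1, ∫ t in (0 : ℝ)..1, w (p + s • b 0 + t • b 1) := by
    refine (hf.norm_le_integral_line (b 0) p).trans ?_
    have hc1 : Continuous fun s : ℝ => ∫ t in (0 : ℝ)..1, w (p + s • b 0 + t • b 1) := by
      refine intervalIntegral.continuous_parametric_intervalIntegral_of_continuous' ?_ _ _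
      exact hwc.comp (by fun_prop)
    refine intervalIntegral.integral_mono_on zero_le_one (Continuous.intervalIntegrable ?_ _ _)
      (hc1.intervalIntegrable _ _) fun s _ => ?_
    · have hl : Continuous fun s : ℝ => p + s • b 0 := by fun_prop
      exact (hf.continuous.comp hl).norm.add (h0.continuous.comp hl).norm
    · have hl : Continuous fun t : ℝ => p + s • b 0 + t • b 1 := by fun_prop
      refine (add_le_add (hf.norm_le_integral_line (b 1) _)
        (h0.norm_le_integral_line (b 1) _)).trans_eq ?_
      rw [← intervalIntegral.integral_add]
      · exact ((hf.continuous.comp hl).norm.add (h1.continuous.comp hl).norm).intervalIntegrable _ _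
      · exact ((h0.continuous.comp hl).norm.add
          (h01.continuous.comp hl).norm).intervalIntegrable _ _
  rw [hint w hwp hwc] at hline
  refine hline.trans ((mul_le_mul_of_nonneg_left hfin hc).trans_eq ?_)
  ring

end Sobolev

end

end WaveMapTorus

namespace WaveMapTorus

noncomputable section

/-! ### Triple products of smooth fields in H². -/

section Products

open Filter Topology

variable {b : Module.Basis (Fin 2) ℝ Plane}

/-- A Gagliardo-Nirenberg inequality. -/
lemma IsSmooth.integral_norm_pd_pow_four_le {f : Plane → R3} (hf : IsSmooth b f) {M : ℝ}
    (hM : ∀ p, ‖f p‖ ≤ M) (i : Fin 2) :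
    ∫ p, ‖WaveMapTorus.pd i f p‖ ^ 4 ∂(torusMeasure b)
      ≤ 9 * M ^ 2 * ‖emb b (WaveMapTorus.pd i (WaveMapTorus.pd i f))‖ ^ 2 := by
  have h1 := hf.pd i
  have h2 := h1.pd i
  set g := WaveMapTorus.pd i f
  set k := WaveMapTorus.pd i g
  have hN := h1.inner h1
  have hS := hN.smul h1
  have hI := hf.inner hS
  -- The derivative of f · |g|²g, with g = ∂ᵢf, integrates to zero. It contains |g|⁴, so ∫|g|⁴
  -- equals an integral bounded by 3M∫|g|²|k|.
  have h0 := integral_pd_eq_zero hI i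
  have hpd (p : Plane) : WaveMapTorus.pd i (fun p => ⟪f p, ⟪g p, g p⟫ • g p⟫) p
      = ‖g p‖ ^ 4 + ⟪f p, (2 * ⟪g p, k p⟫) • g p + ‖g p‖ ^ 2 • k p⟫ := by
    rw [hf.pd_inner hS, hN.pd_smul h1, h1.pd_inner h1, inner_smul_right,
      real_inner_self_eq_norm_sq, real_inner_comm (g p) (k p)]
    rw [two_mul, show ‖g p‖ ^ 4 = ‖g p‖ ^ 2 * ‖g p‖ ^ 2 by ring]
  have hpt (p : Plane) : ‖g p‖ ^ 4 ≤ 2 * WaveMapTorus.pd i (fun p => ⟪f p, ⟪g p, g p⟫ • g p⟫) p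
      + 9 * M ^ 2 * ‖k p‖ ^ 2 := by
    rw [hpd]
    have e1 : |⟪f p, (2 * ⟪g p, k p⟫) • g p + ‖g p‖ ^ 2 • k p⟫|
        ≤ M * (3 * ‖g p‖ ^ 2 * ‖k p‖) := by
      refine (abs_real_inner_le_norm _ _).trans (mul_le_mul (hM p) ?_ (norm_nonneg _)
        ((norm_nonneg _).trans (hM p)))
      refine (norm_add_le _ _).trans ?_
      rw [norm_smul, norm_smul, Real.norm_eq_abs, abs_mul, abs_two, norm_pow, norm_norm]
      have := mul_le_mul_of_nonneg_right (abs_real_inner_le_norm (g p) (k p)) (norm_nonneg (g p))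
      nlinarith
    have e2 := (abs_le.1 e1).1
    -- The cross term is absorbed pointwise by |g|⁴ - 6M|g|²|k| + 9M²|k|² ≥ 0; the factor 2 in front
    -- of the divergence leaves room for it.
    nlinarith [sq_nonneg (‖g p‖ ^ 2 - 3 * M * ‖k p‖)]
  have i1 : Integrable (fun p => 2 * WaveMapTorus.pd i (fun p => ⟪f p, ⟪g p, g p⟫ • g p⟫) p)
      (torusMeasure b) :=
    (integrable_of_periodic (hI.pd i).periodic (hI.pd i).continuous).const_mul 2
  have i2 : Integrable (fun p => 9 * M ^ 2 * ‖k p‖ ^ 2) (torusMeasure b) :=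
    (integrable_of_periodic (h2.periodic.comp (‖·‖ ^ 2)) (h2.continuous.norm.pow 2)).const_mul _
  have i3 : Integrable (fun p => ‖g p‖ ^ 4) (torusMeasure b) :=
    integrable_of_periodic (h1.periodic.comp (‖·‖ ^ 4)) (h1.continuous.norm.pow 4)
  refine (integral_mono i3 (i1.add i2) hpt).trans_eq ?_
  rw [integral_add' i1 i2, integral_const_mul, h0, integral_const_mul, ← h2.norm_emb_sq]
  ring

lemma IsSmooth.norm_emb_le {f g : Plane → R3} (hf : IsSmooth b f) (hg : IsSmooth b g) {C : ℝ}
    (hC : 0 ≤ C) (h : ∀ p, ‖f p‖ ≤ C * ‖g p‖) : ‖emb b f‖ ≤ C * ‖emb b g‖ := by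
  refine abs_le_of_sq_le_sq' ?_ (by positivity) |>.2
  rw [mul_pow, hf.norm_emb_sq, hg.norm_emb_sq, ← integral_const_mul]
  refine integral_mono (integrable_of_periodic (hf.periodic.comp (‖·‖ ^ 2))
    (hf.continuous.norm.pow 2)) ((integrable_of_periodic (hg.periodic.comp (‖·‖ ^ 2))
    (hg.continuous.norm.pow 2)).const_mul _) fun p => ?_
  change ‖f p‖ ^ 2 ≤ C ^ 2 * ‖g p‖ ^ 2
  rw [← mul_pow]
  exact pow_le_pow_left₀ (norm_nonneg _) (h p) 2

/-- Cauchy-Schwarz for |f|²|g|²; `x` and `y` stand for bounds on the `L⁴` norms. -/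
lemma IsSmooth.norm_emb_le_of_integral_pow_four {F f g : Plane → R3} (hF : IsSmooth b F)
    (hf : IsSmooth b f) (hg : IsSmooth b g) {C x y : ℝ} (hC : 0 ≤ C) (hx : 0 ≤ x) (hy : 0 ≤ y)
    (h : ∀ p, ‖F p‖ ≤ C * (‖f p‖ * ‖g p‖))
    (hfx : ∫ p, ‖f p‖ ^ 4 ∂(torusMeasure b) ≤ (x ^ 2) ^ 2)
    (hgy : ∫ p, ‖g p‖ ^ 4 ∂(torusMeasure b) ≤ (y ^ 2) ^ 2) : ‖emb b F‖ ≤ C * (x * y) := by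
  have hm {f : Plane → R3} (hf : IsSmooth b f) :
      MemLp (fun p => ‖f p‖ ^ 2) (ENNReal.ofReal 2) (torusMeasure b) := by
    obtain ⟨B, hB⟩ := hf.periodic.exists_norm_le hf.continuous
    refine MemLp.of_bound (hf.continuous.norm.pow 2).aestronglyMeasurable (B ^ 2)
      (Eventually.of_forall fun p => ?_)
    rw [norm_pow, norm_norm]
    exact pow_le_pow_left₀ (norm_nonneg _) (hB p) 2
  have hi := integral_mul_le_Lp_mul_Lq_of_nonneg (μ := torusMeasure b)
    (Real.HolderConjugate.two_two) (Eventually.of_forall fun p => sq_nonneg ‖f p‖)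
    (Eventually.of_forall fun p => sq_nonneg ‖g p‖) (hm hf) (hm hg)
  have hsq {f : Plane → R3} {x : ℝ} (hx : 0 ≤ x)
      (hfx : ∫ p, ‖f p‖ ^ 4 ∂(torusMeasure b) ≤ (x ^ 2) ^ 2) :
      (∫ p, (‖f p‖ ^ 2) ^ (2 : ℝ) ∂(torusMeasure b)) ^ (1 / (2 : ℝ)) ≤ x ^ 2 := by
    rw [← Real.sqrt_eq_rpow]
    refine Real.sqrt_le_iff.2 ⟨by positivity, ?_⟩
    simpa only [Real.rpow_two, ← pow_mul] using hfx
  have hfg : ∫ p, ‖f p‖ ^ 2 * ‖g p‖ ^ 2 ∂(torusMeasure b) ≤ x ^ 2 * y ^ 2 := by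
    refine hi.trans (mul_le_mul (hsq hx hfx) (hsq hy hgy) ?_ (by positivity))
    exact Real.rpow_nonneg (integral_nonneg fun _ => Real.rpow_nonneg (sq_nonneg _) _) _
  refine abs_le_of_sq_le_sq' ?_ (by positivity) |>.2
  rw [hF.norm_emb_sq]
  have e : (C * (x * y)) ^ 2 = C ^ 2 * (x ^ 2 * y ^ 2) := by ring
  rw [e]
  refine le_trans ?_ (mul_le_mul_of_nonneg_left hfg (sq_nonneg C))
  rw [← integral_const_mul]
  refine integral_mono (integrable_of_periodic (hF.periodic.comp (‖·‖ ^ 2))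
    (hF.continuous.norm.pow 2)) ((integrable_of_periodic
      (hf.periodic.comp₂ hg.periodic fun a c => ‖a‖ ^ 2 * ‖c‖ ^ 2)
      ((hf.continuous.norm.pow 2).mul (hg.continuous.norm.pow 2))).const_mul _) fun p => ?_
  change ‖F p‖ ^ 2 ≤ C ^ 2 * (‖f p‖ ^ 2 * ‖g p‖ ^ 2)
  rw [← mul_pow, ← mul_pow]
  exact pow_le_pow_left₀ (norm_nonneg _) (h p) 2

/-- The triple product `(f · g) h`. -/
def tri (f g h : Plane → R3) : Plane → R3 := fun p => ⟪f p, g p⟫ • h p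

lemma norm_tri_le (f g h : Plane → R3) (p : Plane) : ‖tri f g h p‖ ≤ ‖f p‖ * ‖g p‖ * ‖h p‖ := by
  rw [tri, norm_smul]
  gcongr
  exact abs_real_inner_le_norm _ _

lemma IsSmooth.tri {f g h : Plane → R3} (hf : IsSmooth b f) (hg : IsSmooth b g)
    (hh : IsSmooth b h) : IsSmooth b (tri f g h) :=
  (hf.inner hg).smul hh

lemma IsSmooth.pd_tri {f g h : Plane → R3} (hf : IsSmooth b f) (hg : IsSmooth b g)
    (hh : IsSmooth b h) (i : Fin 2) : WaveMapTorus.pd i (WaveMapTorus.tri f g h)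
      = WaveMapTorus.tri (WaveMapTorus.pd i f) g h + WaveMapTorus.tri f (WaveMapTorus.pd i g) h
        + WaveMapTorus.tri f g (WaveMapTorus.pd i h) := by
  funext p
  refine ((hf.inner hg).pd_smul hh i p).trans ?_
  rw [hf.pd_inner hg, add_smul]
  rfl

/-- At most two derivatives fall on three factors. If they all fall on one factor, it is taken in
`L²` and the others in the supremum norm (`K1`); if they fall on two factors, these are taken in
`L⁴` and the third in the supremum norm (`K2`). -/
lemma exists_norm_emb_tri_pdl_le (b : Module.Basis (Fin 2) ℝ Plane) : ∃ C : ℝ, 0 ≤ C ∧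
    ∀ (f g h : Plane → R3) (hf : IsSmooth b f) (hg : IsSmooth b g) (hh : IsSmooth b h)
      (α β γ : List (Fin 2)), α.length + β.length + γ.length ≤ 2 →
      ‖emb b (tri (pdl α f) (pdl β g) (pdl γ h))‖
        ≤ C * (‖smoothH 2 hf‖ * ‖smoothH 2 hg‖ * ‖smoothH 2 hh‖) := by
  obtain ⟨C, hC, hS⟩ := exists_norm_le_smoothH b
  have L2le {f : Plane → R3} (hf : IsSmooth b f) (α : List (Fin 2)) (hα : α.length ≤ 2) :
      ‖emb b (pdl α f)‖ ≤ ‖smoothH 2 hf‖ := by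
    rw [← der_smoothH 2 hf α hα]
    exact norm_der_le _ _ _
  -- In the Gagliardo-Nirenberg inequality the supremum is at most C‖f‖₂, giving 9C²‖f‖₂⁴, the
  -- fourth power of √(3C)‖f‖₂.
  have L4le {f : Plane → R3} (hf : IsSmooth b f) (i : Fin 2) :
      ∫ p, ‖pdl [i] f p‖ ^ 4 ∂(torusMeasure b) ≤ ((√(3 * C) * ‖smoothH 2 hf‖) ^ 2) ^ 2 := by
    refine (hf.integral_norm_pd_pow_four_le (hS f hf) i).trans ?_
    have h1 := L2le hf [i, i] (by simp)
    have h2 : ((√(3 * C) * ‖smoothH 2 hf‖) ^ 2) ^ 2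
        = 9 * (C * ‖smoothH 2 hf‖) ^ 2 * ‖smoothH 2 hf‖ ^ 2 := by
      rw [mul_pow, Real.sq_sqrt (by positivity)]; ring
    rw [h2]
    gcongr
    exact h1
  have K1 {F f g h : Plane → R3} (hF : IsSmooth b F) (hf : IsSmooth b f) (hg : IsSmooth b g)
      (hh : IsSmooth b h) (γ : List (Fin 2)) (hγ : γ.length ≤ 2)
      (hp : ∀ p, ‖F p‖ ≤ ‖f p‖ * ‖g p‖ * ‖pdl γ h p‖) :
      ‖emb b F‖ ≤ 3 * C ^ 2 * (‖smoothH 2 hf‖ * ‖smoothH 2 hg‖ * ‖smoothH 2 hh‖) := by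
    refine (hF.norm_emb_le (hh.pdl γ) (C := (C * ‖smoothH 2 hf‖) * (C * ‖smoothH 2 hg‖))
      (by positivity) fun p => (hp p).trans ?_).trans ?_
    · gcongr
      exacts [hS f hf p, hS g hg p]
    · calc _ ≤ (C * ‖smoothH 2 hf‖) * (C * ‖smoothH 2 hg‖) * ‖smoothH 2 hh‖ := by
            gcongr; exact L2le hh γ hγ
        _ = 1 * (C ^ 2 * (‖smoothH 2 hf‖ * ‖smoothH 2 hg‖ * ‖smoothH 2 hh‖)) := by ring
        _ ≤ 3 * (C ^ 2 * (‖smoothH 2 hf‖ * ‖smoothH 2 hg‖ * ‖smoothH 2 hh‖)) := by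
            gcongr; norm_num
        _ = _ := by ring
  have K2 {F f g h : Plane → R3} (hF : IsSmooth b F) (hf : IsSmooth b f) (hg : IsSmooth b g)
      (hh : IsSmooth b h) (i j : Fin 2) (hp : ∀ p, ‖F p‖ ≤ ‖f p‖ * (‖pdl [i] g p‖ * ‖pdl [j] h p‖)) :
      ‖emb b F‖ ≤ 3 * C ^ 2 * (‖smoothH 2 hf‖ * ‖smoothH 2 hg‖ * ‖smoothH 2 hh‖) := by
    refine (hF.norm_emb_le_of_integral_pow_four (hg.pdl [i]) (hh.pdl [j])
      (C := C * ‖smoothH 2 hf‖) (x := √(3 * C) * ‖smoothH 2 hg‖)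
      (y := √(3 * C) * ‖smoothH 2 hh‖) (by positivity) (by positivity) (by positivity)
      (fun p => (hp p).trans ?_) (L4le hg i) (L4le hh j)).trans_eq ?_
    · gcongr
      exact hS f hf p
    · have := Real.mul_self_sqrt (show 0 ≤ 3 * C by positivity)
      linear_combination (C * ‖smoothH 2 hf‖ * ‖smoothH 2 hg‖ * ‖smoothH 2 hh‖) * this
  refine ⟨3 * C ^ 2, by positivity, fun f g h hf hg hh α β γ hl => ?_⟩
  have hF := (hf.pdl α).tri (hg.pdl β) (hh.pdl γ)
  have hp := norm_tri_le (pdl α f) (pdl β g) (pdl γ h)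
  match α, β, γ with
  | [], [], γ => exact K1 hF hf hg hh γ (by simpa using hl) hp
  | [], β, [] =>
    refine (K1 hF hf hh hg β (by simpa using hl) fun p => (hp p).trans_eq ?_).trans_eq ?_
    · simp only [pdl]; ring
    · ring
  | α, [], [] =>
    refine (K1 hF hh hg hf α (by simpa using hl) fun p => (hp p).trans_eq ?_).trans_eq ?_
    · simp only [pdl]; ring
    · ring
  | [], [i], [j] =>
    refine (K2 hF hf hg hh i j fun p => (hp p).trans_eq ?_)
    simp only [pdl]; ring
  | [i], [], [j] =>
    refine (K2 hF hg hf hh i j fun p => (hp p).trans_eq ?_).trans_eq ?_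
    · simp only [pdl]; ring
    · ring
  | [i], [j], [] =>
    refine (K2 hF hh hf hg i j fun p => (hp p).trans_eq ?_).trans_eq ?_
    · simp only [pdl]; ring
    · ring
  | _ :: _, _ :: _, _ :: _ => simp at hl; omega
  | [], _ :: _ :: _, _ :: _ => simp at hl; omega
  | [], _ :: _, _ :: _ :: _ => simp at hl; omega
  | _ :: _ :: _, _ :: _, [] => simp at hl; omega
  | _ :: _, _ :: _ :: _, [] => simp at hl; omega
  | _ :: _ :: _, [], _ :: _ => simp at hl; omega
  | _ :: _, [], _ :: _ :: _ => simp at hl; omega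

/-- A second derivative of a triple product has nine terms, each controlled by
`exists_norm_emb_tri_pdl_le`; the factor 9 also covers the lower orders. -/
lemma exists_norm_smoothH_tri_le (b : Module.Basis (Fin 2) ℝ Plane) : ∃ C : ℝ, 0 ≤ C ∧
    ∀ (f g h : Plane → R3) (hf : IsSmooth b f) (hg : IsSmooth b g) (hh : IsSmooth b h),
      ‖smoothH 2 (hf.tri hg hh)‖ ≤ C * (‖smoothH 2 hf‖ * ‖smoothH 2 hg‖ * ‖smoothH 2 hh‖) := by
  obtain ⟨C, hC, hT⟩ := exists_norm_emb_tri_pdl_le b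
  refine ⟨Fintype.card (MultiIndex 2) * (9 * C), by positivity, fun f g h hf hg hh => ?_⟩
  set X := ‖smoothH 2 hf‖ * ‖smoothH 2 hg‖ * ‖smoothH 2 hh‖
  have hX : 0 ≤ C * X := by positivity
  have key (α : MultiIndex 2) : ‖der α.1 α.2 (smoothH 2 (hf.tri hg hh))‖ ≤ 9 * (C * X) := by
    rw [der_smoothH]
    have T (α β γ : List (Fin 2)) (hl : α.length + β.length + γ.length ≤ 2) :=
      hT f g h hf hg hh α β γ hl
    have S (α β γ : List (Fin 2)) := (hf.pdl α).tri (hg.pdl β) (hh.pdl γ)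
    have add {u v : Plane → R3} (hu : IsSmooth b u) (hv : IsSmooth b v) :
        ‖emb b (u + v)‖ ≤ ‖emb b u‖ + ‖emb b v‖ := by
      rw [hu.emb_add hv]; exact norm_add_le _ _
    have add3 {u v w : Plane → R3} (hu : IsSmooth b u) (hv : IsSmooth b v) (hw : IsSmooth b w) :
        ‖emb b (u + v + w)‖ ≤ ‖emb b u‖ + ‖emb b v‖ + ‖emb b w‖ :=
      (add (hu.add hv) hw).trans (by gcongr; exact add hu hv)
    have P (α β γ : List (Fin 2)) (i : Fin 2) : pd i (tri (pdl α f) (pdl β g) (pdl γ h))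
        = tri (pdl (i :: α) f) (pdl β g) (pdl γ h) + tri (pdl α f) (pdl (i :: β) g) (pdl γ h)
          + tri (pdl α f) (pdl β g) (pdl (i :: γ) h) :=
      (hf.pdl α).pd_tri (hg.pdl β) (hh.pdl γ) i
    have B (α β γ : List (Fin 2)) (i : Fin 2) (hl : α.length + β.length + γ.length ≤ 1) :
        ‖emb b (pd i (tri (pdl α f) (pdl β g) (pdl γ h)))‖ ≤ 3 * (C * X) := by
      rw [P]
      refine (add3 (S _ _ _) (S _ _ _) (S _ _ _)).trans ?_
      have h1 := T (i :: α) β γ (by simp only [List.length_cons]; omega)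
      have h2 := T α (i :: β) γ (by simp only [List.length_cons]; omega)
      have h3 := T α β (i :: γ) (by simp only [List.length_cons]; omega)
      linarith
    match α with
    | ⟨[], _⟩ =>
      have := T [] [] [] (by simp)
      change ‖emb b (tri (pdl [] f) (pdl [] g) (pdl [] h))‖ ≤ _
      linarith
    | ⟨[i], _⟩ =>
      have := B [] [] [] i (by simp)
      change ‖emb b (pd i (tri (pdl [] f) (pdl [] g) (pdl [] h)))‖ ≤ _
      linarith
    | ⟨[i, j], _⟩ =>
      have h1 := B [j] [] [] i (by simp)
      have h2 := B [] [j] [] i (by simp)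
      have h3 := B [] [] [j] i (by simp)
      change ‖emb b (pd i (pd j (tri (pdl [] f) (pdl [] g) (pdl [] h))))‖ ≤ _
      rw [P, ((S _ _ _).add (S _ _ _)).pd_add (S _ _ _), (S _ _ _).pd_add (S _ _ _)]
      refine (add3 ((S _ _ _).pd i) ((S _ _ _).pd i) ((S _ _ _).pd i)).trans ?_
      linarith
    | ⟨_ :: _ :: _ :: _, h⟩ => simp at h
  refine (norm_H_le _).trans ((Finset.sum_le_sum fun α _ => key α).trans_eq ?_)
  rw [Finset.sum_const, Finset.card_univ, nsmul_eq_mul]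
  ring

end Products

end

end WaveMapTorus

namespace WaveMapTorus

noncomputable section

/-! ### Extension of the triple product from smooth fields to H². -/

section Products

open Filter Topology

variable {b : Module.Basis (Fin 2) ℝ Plane}

namespace SobolevInstances

scoped instance (k : ℕ) : NormedAddCommGroup (H b k) := inferInstance

scoped instance (k : ℕ) : NormedSpace ℝ (H b k) := inferInstance

scoped instance (k : ℕ) : SeminormedAddCommGroup (H b k) := inferInstance

scoped instance (k : ℕ) : TopologicalSpace (H b k) := inferInstance

scoped instance (k : ℕ) : AddCommGroup (H b k) := inferInstance

scoped instance (k : ℕ) : AddCommMonoid (H b k) := inferInstance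

scoped instance (k : ℕ) : Module ℝ (H b k) := inferInstance

scoped instance (k : ℕ) : IsTopologicalAddGroup (H b k) := inferInstance

scoped instance (k : ℕ) : ContinuousAdd (H b k) := inferInstance

scoped instance (k : ℕ) : ContinuousConstSMul ℝ (H b k) := inferInstance

end SobolevInstances

open SobolevInstances

lemma exists_subseq_tendsto_ae {u : ℕ → L2 b} {v : L2 b} (h : Tendsto u atTop (𝓝 v)) :
    ∃ ns : ℕ → ℕ, StrictMono ns ∧
      ∀ᵐ p ∂(torusMeasure b), Tendsto (fun n => u (ns n) p) atTop (𝓝 (v p)) :=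
  (tendstoInMeasure_of_tendsto_Lp h).exists_seq_tendsto_ae

lemma exists_seq_smoothH_tendsto_ae {k : ℕ} (u : H b k) :
    ∃ (f : ℕ → Plane → R3) (hf : ∀ n, IsSmooth b (f n)),
      Tendsto (fun n => smoothH k (hf n)) atTop (𝓝 u) ∧
      ∀ᵐ p ∂(torusMeasure b), Tendsto (fun n => f n p) atTop (𝓝 (D u [] p)) := by
  obtain ⟨f, hf, h⟩ := exists_seq_smoothH_tendsto u
  obtain ⟨ns, hns, hae⟩ := exists_subseq_tendsto_ae
    (((der [] (Nat.zero_le k)).continuous.tendsto u).comp h)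
  refine ⟨fun n => f (ns n), fun n => hf (ns n), h.comp hns.tendsto_atTop, ?_⟩
  filter_upwards [hae, ae_all_iff.2 fun n => (hf n).coeFn_emb] with p hp hq
  rw [D_eq_der (α := []) (Nat.zero_le k)]
  refine hp.congr fun n => ?_
  exact hq (ns n)

lemma tri_sub_left (f f' g h : Plane → R3) : tri (f - f') g h = tri f g h - tri f' g h := by
  funext p; simp [tri, inner_sub_left, sub_smul]

lemma tri_sub_middle (f g g' h : Plane → R3) : tri f (g - g') h = tri f g h - tri f g' h := by
  funext p; simp [tri, inner_sub_right, sub_smul]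

lemma tri_sub_right (f g h h' : Plane → R3) : tri f g (h - h') = tri f g h - tri f g h' := by
  funext p; simp [tri, smul_sub]

/-- The trilinear estimate makes the products of smooth approximations a Cauchy sequence in `H b 2`.
Its limit is the pointwise product, since all sequences involved converge almost everywhere along a
subsequence. -/
lemma exists_tri (b : Module.Basis (Fin 2) ℝ Plane) : ∃ C : ℝ, 0 ≤ C ∧
    ∀ u v w : H b 2, ∃ z : H b 2, D z [] =ᵐ[torusMeasure b] tri (D u []) (D v []) (D w []) ∧
      ‖z‖ ≤ C * (‖u‖ * ‖v‖ * ‖w‖) := by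
  obtain ⟨C, hC, hT⟩ := exists_norm_smoothH_tri_le b
  refine ⟨C, hC, fun u v w => ?_⟩
  obtain ⟨f, hf, fu, fa⟩ := exists_seq_smoothH_tendsto_ae u
  obtain ⟨g, hg, gv, ga⟩ := exists_seq_smoothH_tendsto_ae v
  obtain ⟨h, hh, hw, ha⟩ := exists_seq_smoothH_tendsto_ae w
  set F := fun n => smoothH 2 (hf n)
  set G := fun n => smoothH 2 (hg n)
  set W := fun n => smoothH 2 (hh n)
  set Z := fun n => smoothH 2 ((hf n).tri (hg n) (hh n)) with hZ
  -- Telescoping: the factors are exchanged one at a time.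
  have hdiff (m n : ℕ) : dist (Z m) (Z n) ≤ C * (‖F m - F n‖ * ‖G m‖ * ‖W m‖)
      + C * (‖F n‖ * ‖G m - G n‖ * ‖W m‖) + C * (‖F n‖ * ‖G n‖ * ‖W m - W n‖) := by
    have e1 := hT _ _ _ ((hf m).sub (hf n)) (hg m) (hh m)
    have e2 := hT _ _ _ (hf n) ((hg m).sub (hg n)) (hh m)
    have e3 := hT _ _ _ (hf n) (hg n) ((hh m).sub (hh n))
    rw [smoothH_sub 2 (hf m) (hf n)] at e1
    rw [smoothH_sub 2 (hg m) (hg n)] at e2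
    rw [smoothH_sub 2 (hh m) (hh n)] at e3
    have key {f f' : Plane → R3} (hf : IsSmooth b f) (hf' : IsSmooth b f') {x y z : Plane → R3}
        (hx : IsSmooth b x) (hy : IsSmooth b y) (hz : IsSmooth b z) (h : f - f' = x + y + z) :
        dist (smoothH 2 hf) (smoothH 2 hf') ≤ ‖smoothH 2 hx‖ + ‖smoothH 2 hy‖ + ‖smoothH 2 hz‖ := by
      have h0 : smoothH 2 hf - smoothH 2 hf' = smoothH 2 hx + smoothH 2 hy + smoothH 2 hz := by
        rw [← smoothH_sub]
        refine H_ext ?_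
        change emb b (f - f') = emb b x + emb b y + emb b z
        rw [h, (hx.add hy).emb_add hz, hx.emb_add hy]
      rw [dist_eq_norm, h0]
      exact norm_add₃_le
    refine (key _ _ (((hf m).sub (hf n)).tri (hg m) (hh m))
      ((hf n).tri ((hg m).sub (hg n)) (hh m)) ((hf n).tri (hg n) ((hh m).sub (hh n))) ?_).trans
      (add_le_add (add_le_add e1 e2) e3)
    rw [tri_sub_left, tri_sub_middle, tri_sub_right]
    abel
  have hcau : CauchySeq Z := by
    have two {V : ℕ → H b 2} {v : H b 2} (hV : Tendsto V atTop (𝓝 v)) :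
        Tendsto (fun x : ℕ × ℕ => V x.1) atTop (𝓝 v) ∧
        Tendsto (fun x : ℕ × ℕ => V x.2) atTop (𝓝 v) ∧
        Tendsto (fun x : ℕ × ℕ => ‖V x.1 - V x.2‖) atTop (𝓝 0) := by
      rw [← prod_atTop_atTop_eq]
      refine ⟨hV.comp tendsto_fst, hV.comp tendsto_snd, ?_⟩
      simpa using ((hV.comp tendsto_fst).sub (hV.comp tendsto_snd)).norm
    rw [cauchySeq_iff_tendsto_dist_atTop_0]
    have hlim := ((((two fu).2.2.mul (two gv).1.norm).mul (two hw).1.norm).const_mul C).add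
      ((((two fu).2.1.norm.mul (two gv).2.2).mul (two hw).1.norm).const_mul C) |>.add
      ((((two fu).2.1.norm.mul (two gv).2.1.norm).mul (two hw).2.2).const_mul C)
    simp only [zero_mul, mul_zero, add_zero] at hlim
    exact squeeze_zero (fun _ => dist_nonneg) (fun x => hdiff x.1 x.2) hlim
  obtain ⟨z, hz⟩ := cauchySeq_tendsto_of_complete hcau
  refine ⟨z, ?_, ?_⟩
  · obtain ⟨ns, hns, hae⟩ := exists_subseq_tendsto_ae
      (((der [] (Nat.zero_le 2)).continuous.tendsto z).comp hz)
    filter_upwards [hae, fa, ga, ha,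
      ae_all_iff.2 fun n => ((hf n).tri (hg n) (hh n)).coeFn_emb] with p hp h1 h2 h3 h4
    rw [D_eq_der (α := []) (Nat.zero_le 2)]
    refine tendsto_nhds_unique hp ?_
    have h5 := ((h1.inner (𝕜 := ℝ) h2).smul h3).comp hns.tendsto_atTop
    refine h5.congr fun n => (h4 (ns n)).symm
  · refine le_of_tendsto_of_tendsto' hz.norm (((fu.norm.mul gv.norm).mul hw.norm).const_mul C)
      fun n => hT _ _ _ (hf n) (hg n) (hh n)

/-- The product `(u · v) w` in `H²`. -/
def triH (u v w : H b 2) : H b 2 := ((exists_tri b).choose_spec.2 u v w).choose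

lemma D_triH (u v w : H b 2) :
    D (triH u v w) [] =ᵐ[torusMeasure b] tri (D u []) (D v []) (D w []) :=
  ((exists_tri b).choose_spec.2 u v w).choose_spec.1

lemma D_add {k : ℕ} (u v : H b k) : D (u + v) [] =ᵐ[torusMeasure b] D u [] + D v [] := by
  simp only [D_eq_der (α := []) (Nat.zero_le k)]
  exact Lp.coeFn_add _ _

lemma D_smul {k : ℕ} (c : ℝ) (u : H b k) : D (c • u) [] =ᵐ[torusMeasure b] c • D u [] := by
  simp only [D_eq_der (α := []) (Nat.zero_le k)]
  exact Lp.coeFn_smul _ _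

/-- A bounded trilinear operation as a continuous trilinear map. -/
def mkTrilinear {V : Type*} [NormedAddCommGroup V] [NormedSpace ℝ V] (T : V → V → V → V)
    (a₁ : ∀ u u' v w, T (u + u') v w = T u v w + T u' v w)
    (s₁ : ∀ (c : ℝ) u v w, T (c • u) v w = c • T u v w)
    (a₂ : ∀ u v v' w, T u (v + v') w = T u v w + T u v' w)
    (s₂ : ∀ (c : ℝ) u v w, T u (c • v) w = c • T u v w)
    (a₃ : ∀ u v w w', T u v (w + w') = T u v w + T u v w')
    (s₃ : ∀ (c : ℝ) u v w, T u v (c • w) = c • T u v w)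
    (C : ℝ) (hC : 0 ≤ C) (hT : ∀ u v w, ‖T u v w‖ ≤ C * (‖u‖ * ‖v‖ * ‖w‖)) :
    V →L[ℝ] V →L[ℝ] V →L[ℝ] V :=
  LinearMap.mkContinuous₂ (LinearMap.mk₂ ℝ
    (fun u v => LinearMap.mkContinuous
      { toFun := T u v, map_add' := a₃ u v, map_smul' := fun c w => s₃ c u v w }
      (C * (‖u‖ * ‖v‖)) fun w => (hT u v w).trans_eq (by ring))
    (fun u u' v => ContinuousLinearMap.ext fun w => a₁ u u' v w)
    (fun c u v => ContinuousLinearMap.ext fun w => s₁ c u v w)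
    (fun u v v' => ContinuousLinearMap.ext fun w => a₂ u v v' w)
    (fun c u v => ContinuousLinearMap.ext fun w => s₂ c u v w))
    C fun u v => ContinuousLinearMap.opNorm_le_bound _ (by positivity)
      fun w => (hT u v w).trans_eq (by ring)

/-- The product `(u · v) w` in `H²` as a continuous trilinear map. -/
def triL (b : Module.Basis (Fin 2) ℝ Plane) : H b 2 →L[ℝ] H b 2 →L[ℝ] H b 2 →L[ℝ] H b 2 :=
  mkTrilinear (V := H b 2) triH
    (fun u u' v w => H_ext_ae (by
      filter_upwards [D_triH (u + u') v w, D_add (triH u v w) (triH u' v w), D_triH u v w,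
        D_triH u' v w, D_add u u'] with p h1 h2 h3 h4 h5
      rw [h1, h2, Pi.add_apply, h3, h4]
      simp only [tri, h5, Pi.add_apply, inner_add_left, add_smul]))
    (fun c u v w => H_ext_ae (by
      filter_upwards [D_triH (c • u) v w, D_smul c (triH u v w), D_triH u v w,
        D_smul c u] with p h1 h2 h3 h4
      rw [h1, h2, Pi.smul_apply, h3]
      simp only [tri, h4, Pi.smul_apply, real_inner_smul_left, mul_smul]))
    (fun u v v' w => H_ext_ae (by
      filter_upwards [D_triH u (v + v') w, D_add (triH u v w) (triH u v' w), D_triH u v w,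
        D_triH u v' w, D_add v v'] with p h1 h2 h3 h4 h5
      rw [h1, h2, Pi.add_apply, h3, h4]
      simp only [tri, h5, Pi.add_apply, inner_add_right, add_smul]))
    (fun c u v w => H_ext_ae (by
      filter_upwards [D_triH u (c • v) w, D_smul c (triH u v w), D_triH u v w,
        D_smul c v] with p h1 h2 h3 h4
      rw [h1, h2, Pi.smul_apply, h3]
      simp only [tri, h4, Pi.smul_apply, real_inner_smul_right, mul_smul]))
    (fun u v w w' => H_ext_ae (by
      filter_upwards [D_triH u v (w + w'), D_add (triH u v w) (triH u v w'), D_triH u v w,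
        D_triH u v w', D_add w w'] with p h1 h2 h3 h4 h5
      rw [h1, h2, Pi.add_apply, h3, h4]
      simp only [tri, h5, Pi.add_apply, smul_add]))
    (fun c u v w => H_ext_ae (by
      filter_upwards [D_triH u v (c • w), D_smul c (triH u v w), D_triH u v w,
        D_smul c w] with p h1 h2 h3 h4
      rw [h1, h2, Pi.smul_apply, h3]
      simp only [tri, h4, Pi.smul_apply]
      exact smul_comm _ _ _))
    (exists_tri b).choose (exists_tri b).choose_spec.1
    fun u v w => ((exists_tri b).choose_spec.2 u v w).choose_spec.2

lemma D_triL (u v w : H b 2) :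
    D (triL b u v w) [] =ᵐ[torusMeasure b] tri (D u []) (D v []) (D w []) :=
  D_triH u v w

end Products

end

end WaveMapTorus

namespace WaveMapTorus

noncomputable section

open SobolevInstances

/-! ### Smooth families of functions on the torus -/

section Families

open Filter Topology

variable {b : Module.Basis (Fin 2) ℝ Plane} {P E F G : Type} [NormedAddCommGroup P]
  [NormedSpace ℝ P] [NormedAddCommGroup E] [NormedSpace ℝ E] [NormedAddCommGroup F]
  [NormedSpace ℝ F] [NormedAddCommGroup G] [NormedSpace ℝ G] {U : Set P}

/-- A family of functions on the torus depending smoothly on a parameter in `U`. -/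
structure IsSmoothFam (b : Module.Basis (Fin 2) ℝ Plane) (U : Set P) (f : P → Plane → E) :
    Prop where
  contDiffOn : ContDiffOn ℝ ∞ (fun x : P × Plane => f x.1 x.2) (U ×ˢ univ)
  periodic : ∀ q ∈ U, Periodic b (f q)

/-- The derivative of a family with respect to the parameter. -/
def dpar (f : P → Plane → E) : P → Plane → P →L[ℝ] E :=
  fun q p => fderiv ℝ (fun q' => f q' p) q

namespace IsSmoothFam

variable {f : P → Plane → E} {g : P → Plane → F}

lemma isSmooth (hf : IsSmoothFam b U f) {q : P} (hq : q ∈ U) : IsSmooth b (f q) := by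
  refine ⟨contDiffOn_univ.1 ?_, hf.periodic q hq⟩
  exact hf.contDiffOn.comp (contDiff_const.prodMk contDiff_id).contDiffOn fun p _ => ⟨hq, mem_univ p⟩

lemma const {φ : Plane → E} (hφ : IsSmooth b φ) : IsSmoothFam b U fun _ => φ :=
  ⟨(hφ.contDiff.comp contDiff_snd).contDiffOn, fun _ _ => hφ.periodic⟩

lemma clm (B : E →L[ℝ] F) (hf : IsSmoothFam b U f) : IsSmoothFam b U fun q p => B (f q p) :=
  ⟨B.contDiff.comp_contDiffOn hf.contDiffOn, fun q hq => (hf.periodic q hq).comp B⟩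

lemma bilin (B : E →L[ℝ] F →L[ℝ] G) (hf : IsSmoothFam b U f) (hg : IsSmoothFam b U g) :
    IsSmoothFam b U fun q p => B (f q p) (g q p) :=
  ⟨(B.contDiff.comp_contDiffOn hf.contDiffOn).clm_apply hg.contDiffOn,
    fun q hq => (hf.periodic q hq).comp₂ (hg.periodic q hq) (B · ·)⟩

lemma sub {f' : P → Plane → E} (hf : IsSmoothFam b U f) (hf' : IsSmoothFam b U f') :
    IsSmoothFam b U fun q p => f q p - f' q p :=
  ⟨hf.contDiffOn.sub hf'.contDiffOn, fun q hq => (hf.periodic q hq).comp₂ (hf'.periodic q hq) _⟩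

lemma smul {a : P → Plane → ℝ} (ha : IsSmoothFam b U a) (hf : IsSmoothFam b U f) :
    IsSmoothFam b U fun q p => a q p • f q p :=
  bilin (ContinuousLinearMap.lsmul ℝ ℝ) ha hf

lemma inner {f g : P → Plane → R3} (hf : IsSmoothFam b U f) (hg : IsSmoothFam b U g) :
    IsSmoothFam b U fun q p => ⟪f q p, g q p⟫ :=
  bilin (innerSL ℝ) hf hg

lemma tri {f g h : P → Plane → R3} (hf : IsSmoothFam b U f) (hg : IsSmoothFam b U g)
    (hh : IsSmoothFam b U h) : IsSmoothFam b U fun q => tri (f q) (g q) (h q) :=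
  (hf.inner hg).smul hh

lemma sum {ι : Type*} {s : Finset ι} {f : ι → P → Plane → E}
    (hf : ∀ i ∈ s, IsSmoothFam b U (f i)) : IsSmoothFam b U fun q p => ∑ i ∈ s, f i q p :=
  ⟨ContDiffOn.sum fun i hi => (hf i hi).contDiffOn,
    fun q hq j p => Finset.sum_congr rfl fun i hi => (hf i hi).periodic q hq j p⟩

lemma differentiableAt (hf : IsSmoothFam b U f) (hU : IsOpen U) {q : P} (hq : q ∈ U) (p : Plane) :
    DifferentiableAt ℝ (fun x : P × Plane => f x.1 x.2) (q, p) :=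
  (hf.contDiffOn.contDiffAt ((hU.prod isOpen_univ).mem_nhds ⟨hq, mem_univ p⟩)).differentiableAt
    (by simp)

lemma fderiv_contDiffOn (hf : IsSmoothFam b U f) (hU : IsOpen U) :
    ContDiffOn ℝ ∞ (fderiv ℝ fun x : P × Plane => f x.1 x.2) (U ×ˢ univ) :=
  hf.contDiffOn.fderiv_of_isOpen (hU.prod isOpen_univ) (by simp)

lemma hasFDerivAt_comp_inl (hf : IsSmoothFam b U f) (hU : IsOpen U) {q : P} (hq : q ∈ U)
    (p : Plane) : HasFDerivAt (fun q' => f q' p)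
      ((fderiv ℝ (fun x : P × Plane => f x.1 x.2) (q, p)).comp
        (ContinuousLinearMap.inl ℝ P Plane)) q :=
  HasFDerivAt.comp (f := fun q' => (q', p)) q (hf.differentiableAt hU hq p).hasFDerivAt
    (hasFDerivAt_prodMk_left q p)

lemma dpar_eq (hf : IsSmoothFam b U f) (hU : IsOpen U) {q : P} (hq : q ∈ U) (p : Plane) :
    WaveMapTorus.dpar f q p = (fderiv ℝ (fun x : P × Plane => f x.1 x.2) (q, p)).comp
      (ContinuousLinearMap.inl ℝ P Plane) :=
  (hf.hasFDerivAt_comp_inl hU hq p).fderiv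

lemma hasFDerivAt_dpar (hf : IsSmoothFam b U f) (hU : IsOpen U) {q : P} (hq : q ∈ U) (p : Plane) :
    HasFDerivAt (fun q' => f q' p) (WaveMapTorus.dpar f q p) q :=
  (hf.hasFDerivAt_comp_inl hU hq p).differentiableAt.hasFDerivAt

lemma pd_eq (hf : IsSmoothFam b U f) (hU : IsOpen U) {q : P} (hq : q ∈ U) (p : Plane) (i : Fin 2) :
    WaveMapTorus.pd i (f q) p = fderiv ℝ (fun x : P × Plane => f x.1 x.2) (q, p)
      (0, EuclideanSpace.single i 1) := by
  have h : HasFDerivAt (f q) ((fderiv ℝ (fun x : P × Plane => f x.1 x.2) (q, p)).comp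
      (ContinuousLinearMap.inr ℝ P Plane)) p :=
    HasFDerivAt.comp (f := fun p' => (q, p')) p (hf.differentiableAt hU hq p).hasFDerivAt
      (hasFDerivAt_prodMk_right q p)
  rw [WaveMapTorus.pd, h.fderiv]
  rfl

/-- The partial derivative is the total derivative restricted to parameter directions, hence smooth
in both variables. Periodicity holds for all parameters near q and can therefore be differentiated
in q. -/
lemma dpar (hf : IsSmoothFam b U f) (hU : IsOpen U) : IsSmoothFam b U (dpar f) := by
  refine ⟨?_, fun q hq i p => ?_⟩
  · refine ((((ContinuousLinearMap.precomp E
      (ContinuousLinearMap.inl ℝ P Plane)).contDiff).comp_contDiffOn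
        (hf.fderiv_contDiffOn hU))).congr fun x hx => ?_
    exact hf.dpar_eq hU hx.1 x.2
  · refine Filter.EventuallyEq.fderiv_eq ?_
    filter_upwards [hU.mem_nhds hq] with q' hq'
    exact hf.periodic q' hq' i p

lemma pd (hf : IsSmoothFam b U f) (hU : IsOpen U) (i : Fin 2) :
    IsSmoothFam b U fun q => pd i (f q) := by
  refine ⟨?_, fun q hq => (hf.periodic q hq).pd i⟩
  refine ((hf.fderiv_contDiffOn hU).clm_apply
    (contDiffOn_const (c := ((0 : P), EuclideanSpace.single i (1 : ℝ))))).congr fun x hx => ?_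
  exact hf.pd_eq hU hx.1 x.2 i

lemma pdl (hf : IsSmoothFam b U f) (hU : IsOpen U) :
    ∀ α, IsSmoothFam b U fun q => pdl α (f q)
  | [] => hf
  | i :: α => (hf.pdl hU α).pd hU i

/-- Continuity in the parameter is uniform over the compact cell, and periodicity extends the bound
to the plane. -/
lemma eventually_norm_sub_le (hf : IsSmoothFam b U f) (hU : IsOpen U) {q : P} (hq : q ∈ U) {ε : ℝ}
    (hε : 0 < ε) : ∀ᶠ q' in 𝓝 q, ∀ p, ‖f q' p - f q p‖ ≤ ε := by
  have h1 : ∀ᶠ q' in 𝓝 q, ∀ p ∈ cell b, ‖f q' p - f q p‖ ≤ ε := by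
    refine (isCompact_cell b).eventually_forall_of_forall_eventually fun p _ => ?_
    have hc : ContinuousAt (fun x : P × Plane => f x.1 x.2) (q, p) :=
      (hf.differentiableAt hU hq p).continuousAt
    have hc2 : ContinuousAt (fun x : P × Plane => f q x.2) (q, p) :=
      ((hf.isSmooth hq).continuous.comp continuous_snd).continuousAt
    have := (hc.sub hc2).norm
    have hlt : ‖f q p - f q p‖ < ε := by simpa using hε
    exact (this.eventually_lt continuousAt_const hlt).mono fun x hx => hx.le
  filter_upwards [h1, hU.mem_nhds hq] with q' h hq' p
  rw [← (hf.periodic q' hq').fract, ← (hf.periodic q hq).fract]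
  exact h _ (fract_mem_cell p)

lemma bcf_apply (hf : IsSmoothFam b U f) {q : P} (hq : q ∈ U) (p : Plane) :
    WaveMapTorus.bcf (f q) p = f q p :=
  (hf.isSmooth hq).bcf_apply p

lemma continuousOn_bcf (hf : IsSmoothFam b U f) (hU : IsOpen U) :
    ContinuousOn (fun q => bcf (f q)) U := by
  intro q hq
  refine ContinuousAt.continuousWithinAt (Metric.tendsto_nhds.2 fun ε hε => ?_)
  filter_upwards [hf.eventually_norm_sub_le hU hq (half_pos hε), hU.mem_nhds hq] with q' h hq'
  refine lt_of_le_of_lt ?_ (half_lt_self hε)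
  rw [dist_eq_norm]
  refine (BoundedContinuousFunction.norm_le (half_pos hε).le).2 fun p => ?_
  rw [BoundedContinuousFunction.sub_apply, hf.bcf_apply hq', hf.bcf_apply hq]
  exact h p

end IsSmoothFam

/-- Evaluation of an operator valued bounded continuous function. -/
def bcfFlip (P E : Type) [NormedAddCommGroup P] [NormedSpace ℝ P] [NormedAddCommGroup E]
    [NormedSpace ℝ E] : BoundedContinuousFunction Plane (P →L[ℝ] E) →L[ℝ] P →L[ℝ]
      BoundedContinuousFunction Plane E :=
  LinearMap.mkContinuous₂ (LinearMap.mk₂ ℝ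
    (fun A e => (ContinuousLinearMap.apply ℝ E e).compLeftContinuousBounded Plane A)
    (fun _ _ _ => BoundedContinuousFunction.ext fun _ => rfl)
    (fun _ _ _ => BoundedContinuousFunction.ext fun _ => rfl)
    (fun A _ _ => BoundedContinuousFunction.ext fun p => (A p).map_add _ _)
    (fun c A _ => BoundedContinuousFunction.ext fun p => (A p).map_smul c _)) 1 fun A e => by
      rw [one_mul]
      refine (BoundedContinuousFunction.norm_le (by positivity)).2 fun p => ?_
      exact ((A p).le_opNorm e).trans (by gcongr; exact A.norm_coe_le_norm p)

lemma bcfFlip_apply (A : BoundedContinuousFunction Plane (P →L[ℝ] E)) (e : P) (p : Plane) :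
    bcfFlip P E A e p = A p e := rfl

namespace IsSmoothFam

/-- The mean value inequality is applied at each point p on one ball of parameters; uniform
continuity of `dpar f` makes the remainder uniform in p, that is, small in the supremum norm. -/
lemma hasFDerivAt_bcf {f : P → Plane → E} (hf : IsSmoothFam b U f) (hU : IsOpen U) {q : P}
    (hq : q ∈ U) :
    HasFDerivAt (fun q => bcf (f q)) (bcfFlip P E (bcf (WaveMapTorus.dpar f q))) q := by
  refine .of_isLittleO (Asymptotics.isLittleO_iff.2 fun ε hε => ?_)
  obtain ⟨δ, hδ, hball⟩ := Metric.eventually_nhds_iff_ball.1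
    (((hf.dpar hU).eventually_norm_sub_le hU hq hε).and (hU.mem_nhds hq))
  filter_upwards [Metric.ball_mem_nhds q hδ] with q' hq'
  refine (BoundedContinuousFunction.norm_le (by positivity)).2 fun p => ?_
  rw [BoundedContinuousFunction.sub_apply, BoundedContinuousFunction.sub_apply, bcfFlip_apply,
    hf.bcf_apply (hball q' hq').2, hf.bcf_apply hq, (hf.dpar hU).bcf_apply hq]
  exact (convex_ball q δ).norm_image_sub_le_of_norm_hasFDerivWithin_le'
    (fun x hx => (hf.hasFDerivAt_dpar hU (hball x hx).2 p).hasFDerivWithinAt)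
    (fun x hx => (hball x hx).1 p) (Metric.mem_ball_self hδ) hq'

/-- Induction on the order: the derivative is again given by a smooth family, namely `dpar f`. The
target space changes from E to P →L[ℝ] E at every step, so it is quantified inside. -/
lemma contDiffOn_bcf_nat (hU : IsOpen U) (m : ℕ) : ∀ {E : Type} [NormedAddCommGroup E]
    [NormedSpace ℝ E] {f : P → Plane → E}, IsSmoothFam b U f →
    ContDiffOn ℝ m (fun q => bcf (f q)) U := by
  induction m with
  | zero => exact fun hf => contDiffOn_zero.2 (hf.continuousOn_bcf hU)
  | succ m ih =>
    intro E _ _ f hf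
    rw [Nat.cast_add, Nat.cast_one, contDiffOn_succ_iff_hasFDerivWithinAt_of_uniqueDiffOn hU.uniqueDiffOn]
    refine ⟨by simp, fun q => bcfFlip P E (bcf (WaveMapTorus.dpar f q)), ?_, fun q hq =>
      (hf.hasFDerivAt_bcf hU hq).hasFDerivWithinAt⟩
    exact (bcfFlip P E).contDiff.comp_contDiffOn (ih (hf.dpar hU))

lemma contDiffOn_bcf {f : P → Plane → E} (hf : IsSmoothFam b U f) (hU : IsOpen U) :
    ContDiffOn ℝ ∞ (fun q => bcf (f q)) U :=
  contDiffOn_infty.2 fun m => hf.contDiffOn_bcf_nat hU m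

/-- Operators whose coefficients form a smooth family depend smoothly on the parameter in operator
norm, because they depend linearly and continuously on the coefficients. -/
lemma contDiffOn_clm_bcf {X : Type*} [NormedAddCommGroup X] [NormedSpace ℝ X]
    (T : BoundedContinuousFunction Plane E →L[ℝ] X) {f : P → Plane → E} (hf : IsSmoothFam b U f)
    (hU : IsOpen U) : ContDiffOn ℝ ∞ (fun q => T (bcf (f q))) U :=
  T.contDiff.comp_contDiffOn (hf.contDiffOn_bcf hU)

lemma contDiffOn_emb {f : P → Plane → R3} (hf : IsSmoothFam b U f) (hU : IsOpen U) :
    ContDiffOn ℝ ∞ (fun q => emb b (f q)) U :=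
  contDiffOn_clm_bcf (BoundedContinuousFunction.toLp 2 (torusMeasure b) ℝ) hf hU

variable {φ : P → Plane → R3}

lemma tangentProj (hφ : IsSmoothFam b U φ) (hU : IsOpen U) (i : Fin 2) :
    IsSmoothFam b U fun q => tangentProj (φ q) i :=
  .bilin rankOneL hφ (hφ.pd hU i)

lemma coeffZero (hφ : IsSmoothFam b U φ) (hU : IsOpen U) :
    IsSmoothFam b U fun q => coeffZero (φ q) :=
  .sum fun i _ => ((const (IsSmooth.const b (2 : ℝ))).smul ((hφ.tangentProj hU i).pd hU i)).sub
    (((hφ.pd hU i).inner (hφ.pd hU i)).smul (const (.const b _)))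

lemma coeffOne (hφ : IsSmoothFam b U φ) (hU : IsOpen U) (i : Fin 2) :
    IsSmoothFam b U fun q => coeffOne (φ q) i :=
  ((const (IsSmooth.const b (2 : ℝ))).smul (hφ.tangentProj hU i)).sub
    ((const (IsSmooth.const b (2 : ℝ))).smul (.bilin rankOneL (hφ.pd hU i) hφ))

lemma contDiffOn_lowerOrder (hφ : IsSmoothFam b U φ) (hU : IsOpen U) :
    ContDiffOn ℝ ∞ (fun q => lowerOrder b (φ q)) U := by
  have h0 : ContDiffOn ℝ ∞ (fun q => mulDer (b := b) (k := 1) [] (Nat.zero_le 1)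
      (bcf (WaveMapTorus.coeffZero (φ q)))) U :=
    contDiffOn_clm_bcf (mulDer [] (Nat.zero_le 1)) (hφ.coeffZero hU) hU
  have h1 (i : Fin 2) : ContDiffOn ℝ ∞ (fun q => mulDer (b := b) (k := 1) [i] le_rfl
      (bcf (WaveMapTorus.coeffOne (φ q) i))) U :=
    contDiffOn_clm_bcf (mulDer [i] le_rfl) (hφ.coeffOne hU i) hU
  exact h0.add (ContDiffOn.sum fun i _ => h1 i)

end IsSmoothFam

end Families

end

end WaveMapTorus

namespace WaveMapTorus

noncomputable section

open SobolevInstances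

/-! ### The energy identity for weak solutions of abstract second order equations -/

section Energy

open Filter Topology

/-- The Steklov average of a curve. -/
def steklov {X : Type*} [NormedAddCommGroup X] [NormedSpace ℝ X] (h : ℝ) (G : ℝ → X) (s : ℝ) : X :=
  h⁻¹ • ∫ x in s..s + h, G x

/-! ### Averaging curves in time. -/

section Steklov

variable {X Y : Type*} [NormedAddCommGroup X] [NormedSpace ℝ X] [CompleteSpace X]
  [NormedAddCommGroup Y] [NormedSpace ℝ Y] [CompleteSpace Y]

/-- The derivative is a difference quotient of G. Thus the average of a merely continuous curve is
differentiable in the same space, and its derivative may serve as a test vector. -/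
lemma hasDerivAt_steklov (h : ℝ) {G : ℝ → X} (hG : Continuous G) (s : ℝ) :
    HasDerivAt (steklov h G) (h⁻¹ • (G (s + h) - G s)) s := by
  have h1 (r : ℝ) : HasDerivAt (fun r => ∫ x in (0 : ℝ)..r, G x) (G r) r :=
    hG.integral_hasStrictDerivAt 0 r |>.hasDerivAt
  have h2 : steklov h G = fun s => h⁻¹ • ((∫ x in (0 : ℝ)..s + h, G x) - ∫ x in (0 : ℝ)..s, G x) := by
    funext s
    rw [steklov, intervalIntegral.integral_interval_sub_left (hG.intervalIntegrable _ _)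
      (hG.intervalIntegrable _ _)]
  rw [h2]
  exact (((h1 (s + h)).comp_add_const s h).sub (h1 s)).const_smul h⁻¹

lemma continuous_steklov (h : ℝ) {G : ℝ → X} (hG : Continuous G) : Continuous (steklov h G) :=
  continuous_iff_continuousAt.2 fun s => (hasDerivAt_steklov h hG s).continuousAt

lemma tendsto_steklov {G : ℝ → X} (hG : Continuous G) (s : ℝ) :
    Tendsto (fun h => steklov h G s) (𝓝[>] 0) (𝓝 (G s)) := by
  have h1 := (hG.integral_hasStrictDerivAt s s).hasDerivAt.tendsto_slope_zero_right
  simpa [steklov] using h1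

lemma norm_steklov_le {X : Type*} [NormedAddCommGroup X] [NormedSpace ℝ X] {h T M : ℝ} {G : ℝ → X} (hG : ∀ x ∈ Icc 0 T, ‖G x‖ ≤ M) (hh : 0 < h) {s : ℝ}
    (hs : 0 ≤ s) (hsT : s + h ≤ T) : ‖steklov h G s‖ ≤ M := by
  have h1 := intervalIntegral.norm_integral_le_of_norm_le_const (a := s) (b := s + h) (C := M)
    (f := G) fun x hx => by
      rw [uIoc_of_le (by linarith)] at hx
      exact hG x ⟨hs.trans hx.1.le, hx.2.trans hsT⟩
  rw [add_sub_cancel_left, abs_of_pos hh] at h1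
  rw [steklov, norm_smul, norm_inv, Real.norm_of_nonneg hh.le, inv_mul_le_iff₀ hh, mul_comm]
  exact h1

lemma steklov_clm (L : X →L[ℝ] Y) (h : ℝ) {G : ℝ → X} (hG : Continuous G) (s : ℝ) :
    steklov h (fun x => L (G x)) s = L (steklov h G s) := by
  rw [steklov, steklov, map_smul, L.intervalIntegral_comp_comm (hG.intervalIntegrable _ _)]

lemma steklov_of_hasDerivAt {h T : ℝ} {G G' : ℝ → X} (hG : Continuous G) (hG' : Continuous G')
    (hd : ∀ x ∈ Ioo 0 T, HasDerivAt G (G' x) x) (hh : 0 < h) {s : ℝ} (hs : 0 ≤ s)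
    (hsT : s + h ≤ T) : steklov h G' s = h⁻¹ • (G (s + h) - G s) := by
  rw [steklov, intervalIntegral.integral_eq_sub_of_hasDerivAt_of_le (by linarith) hG.continuousOn
    (fun x hx => hd x ⟨hs.trans_lt hx.1, hx.2.trans_le hsT⟩) (hG'.intervalIntegrable _ _)]

end Steklov

variable {V X : Type} [NormedAddCommGroup V] [NormedSpace ℝ V] [CompleteSpace V]
  [NormedAddCommGroup X] [InnerProductSpace ℝ X] [CompleteSpace X]

/-- The energy of an abstract wave equation. -/
def waveEnergy (ι : V →L[ℝ] X) (a : V →L[ℝ] V →L[ℝ] ℝ) (N : ℝ → V →L[ℝ] X) (w : ℝ → V)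
    (z' : ℝ → X) (t : ℝ) : ℝ :=
  1 / 2 * ‖z' t‖ ^ 2 + 1 / 2 * (a (w t) (w t) + ⟪N t (w t), ι (w t)⟫)

lemma exists_norm_le_Icc {Z : Type*} [NormedAddCommGroup Z] {G : ℝ → Z} {T : ℝ}
    (hG : ContinuousOn G (Icc 0 T)) : ∃ M, 0 ≤ M ∧ ∀ x ∈ Icc 0 T, ‖G x‖ ≤ M := by
  obtain ⟨M, hM⟩ := isCompact_Icc.exists_bound_of_continuousOn hG
  exact ⟨max M 0, le_max_right _ _, fun x hx => (hM x hx).trans (le_max_left _ _)⟩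

/-- Weak solutions of `w_tt + A w + N w = F` in `(0, T)`, for curves defined on the whole line. Here
`a` is the form of `A`, the form of `A + N` is symmetric and `z'` is the time derivative of `w`. -/
structure IsWeakSolution (ι : V →L[ℝ] X) (a : V →L[ℝ] V →L[ℝ] ℝ) (N N' : ℝ → V →L[ℝ] X) (w : ℝ → V)
    (z' F : ℝ → X) (T : ℝ) : Prop where
  hw : Continuous w
  hz : Continuous z'
  hF : Continuous F
  hN : Continuous N
  hN' : Continuous N'
  symm : ∀ t ∈ Icc 0 T, ∀ u v, a u v + ⟪N t u, ι v⟫ = a v u + ⟪N t v, ι u⟫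
  deriv_w : ∀ t ∈ Ioo 0 T, HasDerivAt (fun s => ι (w s)) (z' t) t
  deriv_N : ∀ t ∈ Ioo 0 T, HasDerivAt N (N' t) t
  weak_eq : ∀ v, ∀ t ∈ Ioo 0 T, HasDerivAt (fun s => ⟪z' s, ι v⟫)
    (⟪F t, ι v⟫ - a (w t) v - ⟪N t (w t), ι v⟫) t

namespace IsWeakSolution

variable {ι : V →L[ℝ] X} {a : V →L[ℝ] V →L[ℝ] ℝ} {N N' : ℝ → V →L[ℝ] X} {w : ℝ → V}
  {z' F : ℝ → X} {T : ℝ}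

/-- Integrate the weak equation over [s, s + h]. Averaging commutes with continuous linear
functionals, so the averaged curve satisfies an equation which can be tested with any vector of V.
-/
lemma inner_steklov_deriv_eq (S : IsWeakSolution ι a N N' w z' F T) {h : ℝ} (hh : 0 < h) {s : ℝ}
    (hs : 0 ≤ s) (hsT : s + h ≤ T) (v : V) :
    ⟪h⁻¹ • (z' (s + h) - z' s), ι v⟫ = ⟪steklov h F s, ι v⟫ - a (steklov h w s) v
      - ⟪steklov h (fun x => N x (w x)) s, ι v⟫ := by
  obtain ⟨hw, hz, hF, hN, -, -, -, -, heq⟩ := S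
  have hNw : Continuous fun x => N x (w x) := hN.clm_apply hw
  have h1 := steklov_of_hasDerivAt (G := fun s => ⟪z' s, ι v⟫)
    (G' := fun t => ⟪F t, ι v⟫ - a (w t) v - ⟪N t (w t), ι v⟫) (by fun_prop) (by fun_prop) (heq v)
    hh hs hsT
  rw [real_inner_smul_left, inner_sub_left, ← smul_eq_mul, ← h1]
  have e1 := steklov_clm (innerSL ℝ (ι v)) h hF s
  have e2 := steklov_clm (a.flip v) h hw s
  have e3 := steklov_clm (innerSL ℝ (ι v)) h hNw s
  simp only [innerSL_apply_apply, ContinuousLinearMap.flip_apply] at e1 e2 e3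
  rw [real_inner_comm (ι v), ← e1, ← e2, real_inner_comm (ι v), ← e3]
  simp only [steklov, ← smul_sub, real_inner_comm (ι v)]
  rw [← intervalIntegral.integral_sub, ← intervalIntegral.integral_sub]
  all_goals exact Continuous.intervalIntegrable (by fun_prop) _ _

/-- The averaged curve may be tested with its own derivative. Averaging does not commute with the
time-dependent operator N; the difference of N applied to the average and the average of N w stays
as an error term. -/
lemma waveEnergy_steklov_sub (S : IsWeakSolution ι a N N' w z' F T) {h t : ℝ} (hh : 0 < h) (ht : 0 ≤ t) (htT : t + h ≤ T) :
    waveEnergy ι a N (steklov h w) (steklov h z') t - waveEnergy ι a N (steklov h w) (steklov h z') 0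
      = ∫ s in (0 : ℝ)..t, (⟪steklov h F s - steklov h (fun x => N x (w x)) s
          + N s (steklov h w s), steklov h z' s⟫
        + 1 / 2 * ⟪N' s (steklov h w s), ι (steklov h w s)⟫) := by
  obtain ⟨hw, hz, hF, hN, hN', hsymm, hwd, hNd, -⟩ := id S
  have hNw : Continuous fun x => N x (w x) := hN.clm_apply hw
  have cw := continuous_steklov h hw
  have cz := continuous_steklov h hz
  have cF := continuous_steklov h hF
  have cNw := continuous_steklov h hNw
  have cN := hN.clm_apply cw
  have cN' := hN'.clm_apply cw
  refine (intervalIntegral.integral_eq_sub_of_hasDerivAt_of_le ht ?_ (fun s hs => ?_)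
    (Continuous.intervalIntegrable ?_ _ _)).symm
  · refine Continuous.continuousOn ?_
    unfold waveEnergy
    fun_prop
  · have hs0 := hs.1.le
    have hsT : s + h ≤ T := by linarith [hs.2]
    set W := steklov h w s
    set δ := h⁻¹ • (w (s + h) - w s)
    have dW : HasDerivAt (steklov h w) δ s := hasDerivAt_steklov h hw s
    have dz := (hasDerivAt_steklov h hz s).norm_sq.const_mul (1 / 2)
    have da := (a.hasFDerivAt.comp_hasDerivAt s dW).clm_apply dW
    have dN := ((hNd s ⟨hs.1, by linarith [hs.2]⟩).clm_apply dW).inner ℝ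
      (ι.hasFDerivAt.comp_hasDerivAt s dW)
    have hδ : ι δ = steklov h z' s := by
      rw [steklov_of_hasDerivAt (ι.continuous.comp hw) hz hwd hh hs0 hsT, map_smul, map_sub]
      rfl
    refine (dz.add ((da.add dN).const_mul (1 / 2))).congr_deriv ?_
    -- The test vector is δ, the V-valued derivative of the averaged curve, and ι δ is the average
    -- of z'. Symmetry (`e2`) then combines the two derivatives of the quadratic form.
    have e1 := S.inner_steklov_deriv_eq hh hs0 hsT δ
    have e2 := hsymm s ⟨hs0, by linarith [hs.2]⟩ W δ
    rw [hδ] at e1 e2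
    rw [real_inner_comm] at e1
    simp only [Function.comp_apply, hδ, e1, inner_add_left, inner_sub_left]
    change _ = ⟪steklov h F s, steklov h z' s⟫ - ⟪steklov h (fun x => N x (w x)) s, steklov h z' s⟫
      + ⟪N s (steklov h w s), steklov h z' s⟫
      + 1 / 2 * ⟪N' s (steklov h w s), ι (steklov h w s)⟫
    linear_combination (-1 / 2) * e2
  · fun_prop

lemma tendsto_waveEnergy (S : IsWeakSolution ι a N N' w z' F T) (s : ℝ) :
    Tendsto (fun h => waveEnergy ι a N (steklov h w) (steklov h z') s)
      (𝓝[>] 0) (𝓝 (waveEnergy ι a N w z' s)) := by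
  have l1 := tendsto_steklov S.hw s
  have l2 := ((N s).continuous.tendsto _).comp l1
  have l3 := (ι.continuous.tendsto _).comp l1
  have l4 : Tendsto (fun h => a (steklov h w s) (steklov h w s)) (𝓝[>] 0) (𝓝 (a (w s) (w s))) :=
    ((a.continuous.clm_apply continuous_id).tendsto (w s)).comp l1
  exact (((tendsto_steklov S.hz s).norm.pow 2).const_mul _).add
    ((l4.add (l2.inner l3)).const_mul _)

/-- Dominated convergence as h → 0+. The strict inequality t < T keeps the windows [s, s + h] inside
[0, T] for small h. -/
lemma waveEnergy_sub_of_lt (S : IsWeakSolution ι a N N' w z' F T) {t : ℝ} (ht : t ∈ Ico 0 T) :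
    waveEnergy ι a N w z' t - waveEnergy ι a N w z' 0
      = ∫ s in (0 : ℝ)..t, (⟪F s, z' s⟫ + 1 / 2 * ⟪N' s (w s), ι (w s)⟫) := by
  obtain ⟨hw, hz, hF, hN, hN', -, -, -, -⟩ := id S
  have hNw : Continuous fun x => N x (w x) := hN.clm_apply hw
  obtain ⟨Mw, hMw0, hMw⟩ := exists_norm_le_Icc (T := T) hw.continuousOn
  obtain ⟨Mz, hMz0, hMz⟩ := exists_norm_le_Icc (T := T) hz.continuousOn
  obtain ⟨MF, hMF0, hMF⟩ := exists_norm_le_Icc (T := T) hF.continuousOn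
  obtain ⟨MN, hMN0, hMN⟩ := exists_norm_le_Icc (T := T) hN.continuousOn
  obtain ⟨MN', hMN'0, hMN'⟩ := exists_norm_le_Icc (T := T) hN'.continuousOn
  obtain ⟨MNw, hMNw0, hMNw⟩ := exists_norm_le_Icc (T := T) hNw.continuousOn
  have hev : ∀ᶠ h in 𝓝[>] (0 : ℝ), 0 < h ∧ t + h ≤ T := by
    have h1 : Iio (T - t) ∈ 𝓝 (0 : ℝ) := Iio_mem_nhds (by linarith [ht.2])
    filter_upwards [self_mem_nhdsWithin, mem_nhdsWithin_of_mem_nhds h1] with h hh hh'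
    exact ⟨hh, by linarith [mem_Iio.1 hh']⟩
  have hR := intervalIntegral.tendsto_integral_filter_of_dominated_convergence
    (μ := volume) (a := 0) (b := t) (l := 𝓝[>] (0 : ℝ))
    (F := fun h s => ⟪steklov h F s - steklov h (fun x => N x (w x)) s
        + N s (steklov h w s), steklov h z' s⟫
      + 1 / 2 * ⟪N' s (steklov h w s), ι (steklov h w s)⟫)
    -- The two N terms are limits of different expressions, the average of N w and N of the average;
    -- they cancel only in the limit.
    (f := fun s => ⟪F s - N s (w s) + N s (w s), z' s⟫ + 1 / 2 * ⟪N' s (w s), ι (w s)⟫)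
    (fun _ => (MF + MNw + MN * Mw) * Mz + 1 / 2 * ((MN' * Mw) * (‖ι‖ * Mw))) ?_ ?_
    intervalIntegrable_const ?_
  · have hL := (S.tendsto_waveEnergy t).sub (S.tendsto_waveEnergy 0)
    have := tendsto_nhds_unique hL (hR.congr' ?_)
    · simpa only [sub_add_cancel] using this
    · filter_upwards [hev] with h hh
      exact (S.waveEnergy_steklov_sub hh.1 ht.1 hh.2).symm
  · refine Eventually.of_forall fun h => Continuous.aestronglyMeasurable ?_
    have cw := continuous_steklov h hw
    have cz := continuous_steklov h hz
    have cF := continuous_steklov h hF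
    have cNw := continuous_steklov h hNw
    have cN := hN.clm_apply cw
    have cN' := hN'.clm_apply cw
    fun_prop
  · filter_upwards [hev] with h hh
    refine Eventually.of_forall fun s hs => ?_
    rw [uIoc_of_le ht.1] at hs
    have hs0 := hs.1.le
    have hsT : s + h ≤ T := by linarith [hs.2, hh.2]
    have hsm : s ∈ Icc 0 T := ⟨hs0, by linarith [hh.1]⟩
    have b1 := norm_steklov_le hMw hh.1 hs0 hsT
    have b2 := norm_steklov_le hMz hh.1 hs0 hsT
    have b3 := norm_steklov_le hMF hh.1 hs0 hsT
    have b4 := norm_steklov_le hMNw hh.1 hs0 hsT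
    have b5 : ‖N s (steklov h w s)‖ ≤ MN * Mw := (N s).le_of_opNorm_le_of_le (hMN s hsm) b1
    have b6 : ‖N' s (steklov h w s)‖ ≤ MN' * Mw := (N' s).le_of_opNorm_le_of_le (hMN' s hsm) b1
    have b7 : ‖ι (steklov h w s)‖ ≤ ‖ι‖ * Mw := ι.le_opNorm_of_le b1
    refine (norm_add_le _ _).trans (add_le_add ?_ ?_)
    · refine (norm_inner_le_norm _ _).trans (mul_le_mul ?_ b2 (norm_nonneg _) (by positivity))
      exact (norm_add_le _ _).trans (add_le_add ((norm_sub_le _ _).trans (add_le_add b3 b4)) b5)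
    · rw [norm_mul]
      refine mul_le_mul (by norm_num) ((norm_inner_le_norm _ _).trans
        (mul_le_mul b6 b7 (norm_nonneg _) (by positivity))) (norm_nonneg _) (by norm_num)
  · refine Eventually.of_forall fun s _ => ?_
    have l1 := tendsto_steklov hw s
    have l2 := ((N s).continuous.tendsto _).comp l1
    have l3 := ((N' s).continuous.tendsto _).comp l1
    have l4 := (ι.continuous.tendsto _).comp l1
    exact ((((tendsto_steklov hF s).sub (tendsto_steklov hNw s)).add l2).inner
      (tendsto_steklov hz s)).add ((l3.inner l4).const_mul _)

/-- Both sides are continuous in t, so the identity on [0, T) extends to t = T. -/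
lemma waveEnergy_sub (S : IsWeakSolution ι a N N' w z' F T) {t : ℝ} (ht : 0 ≤ t) (htT : t ≤ T) :
    waveEnergy ι a N w z' t - waveEnergy ι a N w z' 0
      = ∫ s in (0 : ℝ)..t, (⟪F s, z' s⟫ + 1 / 2 * ⟪N' s (w s), ι (w s)⟫) := by
  obtain ⟨hw, hz, hF, hN, hN', -, -, -, -⟩ := id S
  have hNw : Continuous fun x => N x (w x) := hN.clm_apply hw
  have hN'w : Continuous fun x => N' x (w x) := hN'.clm_apply hw
  have cE : Continuous (waveEnergy ι a N w z') := by unfold waveEnergy; fun_prop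
  have cI : Continuous fun t => ∫ s in (0 : ℝ)..t, (⟪F s, z' s⟫ + 1 / 2 * ⟪N' s (w s), ι (w s)⟫) :=
    intervalIntegral.continuous_primitive
      (fun _ _ => Continuous.intervalIntegrable (by fun_prop) _ _) 0
  rcases htT.lt_or_eq with h | h
  · exact S.waveEnergy_sub_of_lt ⟨ht, h⟩
  · subst h
    rcases ht.eq_or_lt with h0 | h0
    · rw [← h0]; simp
    · have c : IsClosed {s | waveEnergy ι a N w z' s - waveEnergy ι a N w z' 0
          = ∫ s in (0 : ℝ)..s, (⟪F s, z' s⟫ + 1 / 2 * ⟪N' s (w s), ι (w s)⟫)} :=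
        isClosed_eq (cE.sub continuous_const) cI
      have := c.closure_subset_iff.2 (fun s hs => S.waveEnergy_sub_of_lt hs : Ico 0 t ⊆ _)
      rw [closure_Ico h0.ne] at this
      exact this (right_mem_Icc.2 h0.le)

end IsWeakSolution

/-- The energy identity for weak solutions `w` of `w_tt + A w + N w = F`, where `a` is the form of
`A`, the form of `A + N` is symmetric and `z'` is the time derivative of `w`. -/
theorem waveEnergy_sub {ι : V →L[ℝ] X} {a : V →L[ℝ] V →L[ℝ] ℝ} {N N' : ℝ → V →L[ℝ] X} {w : ℝ → V}
    {z' F : ℝ → X} {T : ℝ} (hw : ContinuousOn w (Icc 0 T)) (hz : ContinuousOn z' (Icc 0 T))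
    (hF : ContinuousOn F (Icc 0 T)) (hN' : ContinuousOn N' (Icc 0 T))
    (hsymm : ∀ t ∈ Icc 0 T, ∀ u v, a u v + ⟪N t u, ι v⟫ = a v u + ⟪N t v, ι u⟫)
    (hwd : ∀ t ∈ Icc 0 T, HasDerivWithinAt (fun s => ι (w s)) (z' t) (Icc 0 T) t)
    (hNd : ∀ t ∈ Icc 0 T, HasDerivWithinAt N (N' t) (Icc 0 T) t)
    (heq : ∀ v, ∀ t ∈ Icc 0 T, HasDerivWithinAt (fun s => ⟪z' s, ι v⟫)
      (⟪F t, ι v⟫ - a (w t) v - ⟪N t (w t), ι v⟫) (Icc 0 T) t) {t : ℝ} (ht : t ∈ Icc 0 T) :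
    waveEnergy ι a N w z' t - waveEnergy ι a N w z' 0
      = ∫ s in (0 : ℝ)..t, (⟪F s, z' s⟫ + 1 / 2 * ⟪N' s (w s), ι (w s)⟫) := by
  have hT : 0 ≤ T := ht.1.trans ht.2
  have hN : ContinuousOn N (Icc 0 T) := fun s hs => (hNd s hs).continuousWithinAt
  have ext {Z : Type} (G : ℝ → Z) {s : ℝ} (hs : s ∈ Icc 0 T) :
      IccExtend hT (domRestrict (Icc 0 T) G) s = G s := IccExtend_of_mem hT _ hs
  have hev {s : ℝ} (hs : s ∈ Ioo 0 T) : ∀ᶠ x in 𝓝 s, x ∈ Icc 0 T := Icc_mem_nhds hs.1 hs.2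
  -- Constant extension beyond the end points makes all curves continuous on the line, so that
  -- averages are defined everywhere; the equations are used only in the open interval.
  have S : IsWeakSolution ι a (IccExtend hT (domRestrict (Icc 0 T) N))
      (IccExtend hT (domRestrict (Icc 0 T) N')) (IccExtend hT (domRestrict (Icc 0 T) w))
      (IccExtend hT (domRestrict (Icc 0 T) z')) (IccExtend hT (domRestrict (Icc 0 T) F)) T := by
    refine ⟨hw.domRestrict.Icc_extend', hz.domRestrict.Icc_extend', hF.domRestrict.Icc_extend',
      hN.domRestrict.Icc_extend', hN'.domRestrict.Icc_extend',
      fun s hs u v => by rw [ext N hs]; exact hsymm s hs u v, fun s hs => ?_, fun s hs => ?_,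
      fun v s hs => ?_⟩
    · have hs' := Ioo_subset_Icc_self hs
      rw [ext z' hs']
      refine ((hwd s hs').hasDerivAt (Icc_mem_nhds hs.1 hs.2)).congr_of_eventuallyEq ?_
      filter_upwards [hev hs] with x hx
      rw [ext w hx]
    · have hs' := Ioo_subset_Icc_self hs
      rw [ext N' hs']
      refine ((hNd s hs').hasDerivAt (Icc_mem_nhds hs.1 hs.2)).congr_of_eventuallyEq ?_
      filter_upwards [hev hs] with x hx
      rw [ext N hx]
    · have hs' := Ioo_subset_Icc_self hs
      rw [ext F hs', ext w hs', ext N hs']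
      refine ((heq v s hs').hasDerivAt (Icc_mem_nhds hs.1 hs.2)).congr_of_eventuallyEq ?_
      filter_upwards [hev hs] with x hx
      rw [ext z' hx]
  have key := S.waveEnergy_sub ht.1 ht.2
  have h0 : (0 : ℝ) ∈ Icc 0 T := left_mem_Icc.2 hT
  simp only [waveEnergy, ext _ ht, ext _ h0] at key
  rw [waveEnergy, waveEnergy, key]
  refine intervalIntegral.integral_congr fun s hs => ?_
  rw [uIcc_of_le ht.1] at hs
  have hs' : s ∈ Icc 0 T := ⟨hs.1, hs.2.trans ht.2⟩
  simp only [ext _ hs']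

end Energy

end

end WaveMapTorus

namespace WaveMapTorus

noncomputable section

open SobolevInstances

/-! ### The energy identity for the improved Jacobi operator -/

section Evolution

open Filter Topology

variable {b : Module.Basis (Fin 2) ℝ Plane}

namespace SobolevInstances

scoped instance : NormedAddCommGroup (H b 1 →L[ℝ] L2 b) := inferInstance

scoped instance : NormedSpace ℝ (H b 1 →L[ℝ] L2 b) := inferInstance

scoped instance : NormedAddCommGroup (H b 2 →L[ℝ] L2 b) := inferInstance

scoped instance : NormedSpace ℝ (H b 2 →L[ℝ] L2 b) := inferInstance

end SobolevInstances


/-- Separates the fixed operator -Δ from the time-dependent part, so that time derivatives follow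
from the product rule. -/
lemma secondOrder_eq (N : H b 1 →L[ℝ] L2 b) (u : H b 2) :
    secondOrder N u = secondOrder 0 u + N (inclL one_le_two u) := by
  rw [secondOrder_apply, secondOrder_apply, inclL_apply]
  simp

lemma dirichlet_comm (u v : H b 1) : dirichlet b u v = dirichlet b v u := by
  rw [dirichlet_apply, dirichlet_apply]
  exact Finset.sum_congr rfl fun i _ => real_inner_comm _ _

/-! ### Time derivatives of L y along curves. -/

section Curves

variable {N N' N'' : ℝ → H b 1 →L[ℝ] L2 b} {y y' : ℝ → H b 2} {y'' : ℝ → H b 1} {S : Set ℝ} {t : ℝ}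

lemma hasDerivWithinAt_secondOrder {Nt' : H b 1 →L[ℝ] L2 b} {yt' : H b 2}
    (hN : HasDerivWithinAt N Nt' S t) (hy : HasDerivWithinAt y yt' S t) :
    HasDerivWithinAt (fun s => secondOrder (N s) (y s))
      (secondOrder (N t) yt' + Nt' (inclL one_le_two (y t))) S t := by
  have h1 := ((secondOrder (0 : H b 1 →L[ℝ] L2 b)).hasFDerivAt.comp_hasDerivWithinAt t hy).add
    (hN.clm_apply ((inclL one_le_two).hasFDerivAt.comp_hasDerivWithinAt t hy))
  have h2 : (fun s => secondOrder (N s) (y s))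
      = fun s => secondOrder 0 (y s) + N s (inclL one_le_two (y s)) :=
    funext fun s => secondOrder_eq _ _
  rw [h2, secondOrder_eq (N t)]
  refine h1.congr_deriv ?_
  rw [Function.comp_apply]
  abel

lemma continuousOn_secondOrder (hN : ContinuousOn N S) (hy : ContinuousOn y S) :
    ContinuousOn (fun s => secondOrder (N s) (y s)) S := by
  have h2 : (fun s => secondOrder (N s) (y s))
      = fun s => secondOrder 0 (y s) + N s (inclL one_le_two (y s)) :=
    funext fun s => secondOrder_eq _ _
  rw [h2]
  exact ((secondOrder 0).continuous.comp_continuousOn hy).add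
    (hN.clm_apply ((inclL one_le_two).continuous.comp_continuousOn hy))

/-- The weak form of the second time derivative of `L y`. -/
lemma hasDerivWithinAt_inner_secondOrder {Nt'' : H b 1 →L[ℝ] L2 b} {yt' : H b 2} {yt'' : H b 1}
    (hN : HasDerivWithinAt N (N' t) S t) (hN' : HasDerivWithinAt N' Nt'' S t)
    (hy : HasDerivWithinAt y yt' S t) (hyt : yt' = y' t)
    (hy' : HasDerivWithinAt (fun s => inclL one_le_two (y' s)) yt'' S t) (v : H b 1) :
    HasDerivWithinAt (fun s => ⟪secondOrder (N s) (y' s) + N' s (inclL one_le_two (y s)),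
        der [] (Nat.zero_le 1) v⟫)
      (dirichlet b yt'' v + ⟪N t yt'' + (2 : ℝ) • N' t (inclL one_le_two (y' t))
        + Nt'' (inclL one_le_two (y t)), der [] (Nat.zero_le 1) v⟫) S t := by
  have hy1 := (inclL (b := b) one_le_two).hasFDerivAt.comp_hasDerivWithinAt t hy
  have h1 := ((dirichlet b).flip v).hasFDerivAt.comp_hasDerivWithinAt t hy'
  have h2 := (hN.clm_apply hy').inner ℝ (hasDerivWithinAt_const t S (der [] (Nat.zero_le 1) v))
  have h3 := (hN'.clm_apply hy1).inner ℝ (hasDerivWithinAt_const t S (der [] (Nat.zero_le 1) v))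
  -- Since y' is differentiable only in `H b 1`, the Laplacian is first moved to the test vector;
  -- all three summands are then differentiable.
  have h4 : (fun s => ⟪secondOrder (N s) (y' s) + N' s (inclL one_le_two (y s)),
        der [] (Nat.zero_le 1) v⟫)
      = fun s => dirichlet b (inclL one_le_two (y' s)) v
        + ⟪N s (inclL one_le_two (y' s)), der [] (Nat.zero_le 1) v⟫
        + ⟪N' s (inclL one_le_two (y s)), der [] (Nat.zero_le 1) v⟫ := by
    funext s
    rw [inner_add_left, inner_secondOrder]
    rfl
  rw [h4]
  refine ((h1.add h2).add h3).congr_deriv ?_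
  simp only [inner_zero_right, zero_add, Function.comp_apply, inner_add_left,
    ContinuousLinearMap.flip_apply, real_inner_smul_left, hyt]
  ring

end Curves

set_option maxHeartbeats 800000 in
/-- The energy identity for `y_tt + L y = g`, differentiated by `L`. -/
theorem waveEnergy_secondOrder_sub {N N' N'' : ℝ → H b 1 →L[ℝ] L2 b} {y y' g : ℝ → H b 2}
    {y'' w : ℝ → H b 1} {T : ℝ}
    (hN : ∀ t ∈ Icc 0 T, HasDerivWithinAt N (N' t) (Icc 0 T) t)
    (hN' : ∀ t ∈ Icc 0 T, HasDerivWithinAt N' (N'' t) (Icc 0 T) t)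
    (hN'' : ContinuousOn N'' (Icc 0 T))
    (hsymm : ∀ t ∈ Icc 0 T, ∀ u v, ⟪N t u, der [] (Nat.zero_le 1) v⟫
      = ⟪N t v, der [] (Nat.zero_le 1) u⟫)
    (hy : ∀ t ∈ Icc 0 T, HasDerivWithinAt y (y' t) (Icc 0 T) t)
    (hy'c : ContinuousOn y' (Icc 0 T))
    (hy' : ∀ t ∈ Icc 0 T, HasDerivWithinAt (fun s => inclL one_le_two (y' s)) (y'' t) (Icc 0 T) t)
    (hy'' : ContinuousOn y'' (Icc 0 T)) (hg : ContinuousOn g (Icc 0 T))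
    (heq : ∀ t ∈ Icc 0 T, y'' t + w t = inclL one_le_two (g t))
    (hw : ∀ t ∈ Icc 0 T, der [] (Nat.zero_le 1) (w t) = secondOrder (N t) (y t))
    {t : ℝ} (ht : t ∈ Icc 0 T) :
    waveEnergy (der [] (Nat.zero_le 1)) (dirichlet b) N w
        (fun t => secondOrder (N t) (y' t) + N' t (inclL one_le_two (y t))) t
      - waveEnergy (der [] (Nat.zero_le 1)) (dirichlet b) N w
        (fun t => secondOrder (N t) (y' t) + N' t (inclL one_le_two (y t))) 0
      = ∫ s in (0 : ℝ)..t, (⟪secondOrder (N s) (g s) + (2 : ℝ) • N' s (inclL one_le_two (y' s))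
          + N'' s (inclL one_le_two (y s)),
          secondOrder (N s) (y' s) + N' s (inclL one_le_two (y s))⟫
        + 1 / 2 * ⟪N' s (w s), der [] (Nat.zero_le 1) (w s)⟫) := by
  have cN : ContinuousOn N (Icc 0 T) := fun s hs => (hN s hs).continuousWithinAt
  have cN' : ContinuousOn N' (Icc 0 T) := fun s hs => (hN' s hs).continuousWithinAt
  have cy : ContinuousOn y (Icc 0 T) := fun s hs => (hy s hs).continuousWithinAt
  have ci {u : ℝ → H b 2} (hu : ContinuousOn u (Icc 0 T)) :
      ContinuousOn (fun s => inclL one_le_two (u s)) (Icc 0 T) :=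
    (inclL one_le_two).continuous.comp_continuousOn hu
  -- Continuity in `H b 1` comes from the equation, w = g - y''.
  have cw : ContinuousOn w (Icc 0 T) :=
    ((ci hg).sub hy'').congr fun s hs => eq_sub_of_add_eq' (heq s hs)
  have cz : ContinuousOn (fun t => secondOrder (N t) (y' t) + N' t (inclL one_le_two (y t)))
      (Icc 0 T) := (continuousOn_secondOrder cN hy'c).add (cN'.clm_apply (ci cy))
  have cF : ContinuousOn (fun s => secondOrder (N s) (g s)
      + (2 : ℝ) • N' s (inclL one_le_two (y' s)) + N'' s (inclL one_le_two (y s))) (Icc 0 T) :=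
    ((continuousOn_secondOrder cN hg).add ((cN'.clm_apply (ci hy'c)).const_smul (2 : ℝ))).add
      (hN''.clm_apply (ci cy))
  refine waveEnergy_sub (V := H b 1) (X := L2 b) cw cz cF cN' (fun s hs u v => ?_) (fun s hs => ?_)
    hN (fun v s hs => ?_) ht
  · rw [dirichlet_comm, hsymm s hs]
  · exact (hasDerivWithinAt_secondOrder (hN s hs) (hy s hs)).congr (fun x hx => hw x hx) (hw s hs)
  · refine (hasDerivWithinAt_inner_secondOrder (hN s hs) (hN' s hs) (hy s hs) rfl (hy' s hs)
      v).congr_deriv ?_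
    -- Substituting y'' = g - w splits the form of L at y'' into L g, which belongs to the force,
    -- and the form of L at w.
    have e1 : dirichlet b (y'' s) v = dirichlet b (inclL one_le_two (g s)) v - dirichlet b (w s) v := by
      rw [← heq s hs, (dirichlet b).map_add, add_apply, add_sub_cancel_right]
    have e2 : ⟪N s (y'' s), der [] (Nat.zero_le 1) v⟫
        = ⟪N s (inclL one_le_two (g s)), der [] (Nat.zero_le 1) v⟫
          - ⟪N s (w s), der [] (Nat.zero_le 1) v⟫ := by
      rw [← heq s hs, (N s).map_add, inner_add_left, add_sub_cancel_right]
    simp only [inner_add_left]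
    have e : ⟪secondOrder (N s) (g s), der [] (Nat.zero_le 1) v⟫
        = dirichlet b (inclL one_le_two (g s)) v
          + ⟪N s (inclL one_le_two (g s)), der [] (Nat.zero_le 1) v⟫ := inner_secondOrder _ _ _
    rw [e, e1, e2]
    ring

end Evolution

end

end WaveMapTorus

namespace WaveMapTorus

noncomputable section

open SobolevInstances

/-! ### Coordinate families -/

section Coordinates

open Filter Topology

variable {b : Module.Basis (Fin 2) ℝ Plane} {n : ℕ}

/-- The linear map `v ↦ v^μ G_μ`. -/
def lin1 {X : Type} [NormedAddCommGroup X] [NormedSpace ℝ X] (G : Fin (4 * n) → X) :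
    Coord n →L[ℝ] X :=
  ∑ μ, ContinuousLinearMap.smulRightL ℝ (Coord n) X (EuclideanSpace.proj μ) (G μ)

section Lin

variable {X : Type} [NormedAddCommGroup X] [NormedSpace ℝ X]

lemma lin1_apply (G : Fin (4 * n) → X) (v : Coord n) : lin1 G v = ∑ μ, v μ • G μ := by
  simp [lin1]

lemma map_lin1 {Y : Type} [NormedAddCommGroup Y] [NormedSpace ℝ Y] (L : X →L[ℝ] Y)
    (G : Fin (4 * n) → X) (v : Coord n) : L (lin1 G v) = lin1 (fun μ => L (G μ)) v := by
  simp [lin1_apply]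

lemma contDiffOn_lin1 {P : Type} [NormedAddCommGroup P] [NormedSpace ℝ P] {U : Set P}
    {G : Fin (4 * n) → P → X} {m : WithTop ℕ∞} (hG : ∀ μ, ContDiffOn ℝ m (G μ) U) :
    ContDiffOn ℝ m (fun q => lin1 fun μ => G μ q) U :=
  ContDiffOn.sum fun μ _ => (ContinuousLinearMap.contDiff _).comp_contDiffOn (hG μ)

lemma continuousOn_lin1 {P : Type} [TopologicalSpace P] {U : Set P}
    {G : Fin (4 * n) → P → X} (hG : ∀ μ, ContinuousOn (G μ) U) :
    ContinuousOn (fun q => lin1 fun μ => G μ q) U :=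
  continuousOn_finsetSum _ fun μ _ => (ContinuousLinearMap.continuous _).comp_continuousOn (hG μ)

/-- The bilinear map `(u, v) ↦ u^μ v^ν G_{μν}`. -/
def lin2 (G : Fin (4 * n) → Fin (4 * n) → X) : Coord n →L[ℝ] Coord n →L[ℝ] X :=
  lin1 fun μ => lin1 (G μ)

lemma lin2_apply (G : Fin (4 * n) → Fin (4 * n) → X) (u v : Coord n) :
    lin2 G u v = ∑ μ, ∑ ν, (u μ * v ν) • G μ ν := by
  rw [lin2, lin1_apply, sum_apply]
  refine Finset.sum_congr rfl fun μ _ => ?_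
  rw [smul_apply, lin1_apply, Finset.smul_sum]
  exact Finset.sum_congr rfl fun ν _ => smul_smul _ _ _

lemma map_lin2 {Y : Type} [NormedAddCommGroup Y] [NormedSpace ℝ Y] (L : X →L[ℝ] Y)
    (G : Fin (4 * n) → Fin (4 * n) → X) (u v : Coord n) :
    L (lin2 G u v) = lin2 (fun μ ν => L (G μ ν)) u v := by
  simp [lin2_apply]

end Lin

namespace IsSmoothFam

variable {U : Set (Coord n)} {f : Coord n → Plane → R3}

lemma dq (hf : IsSmoothFam b U f) (hU : IsOpen U) (μ : Fin (4 * n)) : IsSmoothFam b U (dq μ f) :=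
  (hf.dpar hU).clm (ContinuousLinearMap.apply ℝ R3 (EuclideanSpace.single μ (1 : ℝ)))

end IsSmoothFam

lemma IsParametrization.isSmoothFam {U : Set (Coord n)} {ψ : Coord n → Plane → R3}
    (hψ : IsParametrization b n U ψ) : IsSmoothFam b U ψ :=
  ⟨hψ.smooth, fun q hq => (hψ.mem q hq).periodic⟩

lemma IsSmooth.D_smoothH {f : Plane → R3} (hf : IsSmooth b f) (k : ℕ) :
    D (smoothH k hf) [] =ᵐ[torusMeasure b] f := by
  rw [D_eq_der (α := []) (Nat.zero_le k)]
  exact hf.coeFn_emb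

lemma IsSmooth.toH_eq {f : Plane → R3} (hf : IsSmooth b f) (k : ℕ) : toH b k f = smoothH k hf :=
  WaveMapTorus.toH_eq (hf.D_smoothH k)

lemma IsSmooth.D_toH {f : Plane → R3} (hf : IsSmooth b f) (k : ℕ) :
    D (toH b k f) [] =ᵐ[torusMeasure b] f := by
  rw [hf.toH_eq]; exact hf.D_smoothH k

lemma IsSmooth.der_toH {f : Plane → R3} (hf : IsSmooth b f) {k : ℕ} (α : List (Fin 2))
    (hα : α.length ≤ k) : der α hα (toH b k f) = emb b (WaveMapTorus.pdl α f) := by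
  rw [hf.toH_eq]; rfl

/-- A smooth field which vanishes almost everywhere vanishes. -/
lemma IsSmooth.eq_zero_of_emb_eq_zero {f : Plane → R3} (hf : IsSmooth b f) (h : emb b f = 0) :
    f = 0 := by
  obtain ⟨C, -, hC⟩ := exists_norm_le_smoothH b
  have h0 : smoothH 2 hf = 0 := H_ext (by rw [map_zero]; exact h)
  funext p
  have := hC f hf p
  rw [h0, norm_zero, mul_zero] at this
  exact norm_le_zero_iff.1 this

namespace IsSmoothFam

variable {P : Type} [NormedAddCommGroup P] [NormedSpace ℝ P] {U : Set P} {ψ f : P → Plane → R3}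

/-- Each spatial derivative of a smooth family is again a smooth family, so every component of the
Sobolev norm varies continuously. -/
lemma continuousOn_toH (hf : IsSmoothFam b U f) (hU : IsOpen U) (k : ℕ) :
    ContinuousOn (fun q => toH b k (f q)) U := by
  rw [continuousOn_iff_continuous_domRestrict]
  refine continuous_H fun α => ?_
  have h1 := continuousOn_iff_continuous_domRestrict.1
    ((hf.pdl hU α.1).contDiffOn_emb hU).continuousOn
  refine h1.congr fun q => ?_
  exact ((hf.isSmooth q.2).der_toH α.1 α.2).symm

/-- The improved Jacobi operator of a smooth family applied to a smooth family. -/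
lemma contDiffOn_jacobi (hψ : IsSmoothFam b U ψ) (hf : IsSmoothFam b U f) (hU : IsOpen U) :
    ContDiffOn ℝ ∞ (fun q => secondOrder (lowerOrder b (ψ q)) (toH b 2 (f q))) U := by
  have e (α : List (Fin 2)) : ContDiffOn ℝ ∞ (fun q => emb b (WaveMapTorus.pdl α (f q))) U :=
    (hf.pdl hU α).contDiffOn_emb hU
  have h0 : ContDiffOn ℝ ∞ (fun q => mulL b (bcf (WaveMapTorus.coeffZero (ψ q)))) U :=
    contDiffOn_clm_bcf (mulL b) (hψ.coeffZero hU) hU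
  have h1 (i : Fin 2) : ContDiffOn ℝ ∞ (fun q => mulL b (bcf (WaveMapTorus.coeffOne (ψ q) i))) U :=
    contDiffOn_clm_bcf (mulL b) (hψ.coeffOne hU i) hU
  refine ((ContDiffOn.sum (s := Finset.univ) fun i _ => e [i, i]).neg.add ((h0.clm_apply (e [])).add
    (ContDiffOn.sum (s := Finset.univ) fun i _ => (h1 i).clm_apply (e [i])))).congr fun q hq => ?_
  have hd (α : List (Fin 2)) (hα : α.length ≤ 2) := (hf.isSmooth hq).der_toH α hα
  rw [secondOrder_apply, lowerOrder_apply]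
  simp only [der_incl, hd]

end IsSmoothFam

lemma exists_norm_le_of_continuousOn {E P : Type} [NormedAddCommGroup E] [TopologicalSpace P]
    {U K : Set P} {G : P → E}
    (hG : ContinuousOn G U) (hK : IsCompact K) (hKU : K ⊆ U) :
    ∃ C, 0 ≤ C ∧ ∀ q ∈ K, ‖G q‖ ≤ C := by
  obtain ⟨C, hC⟩ := hK.exists_bound_of_continuousOn (hG.mono hKU)
  exact ⟨max C 0, le_max_right _ _, fun q hq => (hC q hq).trans (le_max_left _ _)⟩

/-! ### The metric -/

section Metric

variable {U K : Set (Coord n)} {ψ : Coord n → Plane → R3}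

lemma IsSmooth.ip_eq {f g : Plane → R3} (hg : IsSmooth b g) {F : L2 b}
    (hF : F =ᵐ[torusMeasure b] f) : ip b f g = ⟪emb b g, F⟫ := by
  rw [hg.inner_emb, ip]
  refine integral_congr_ae ?_
  filter_upwards [hF] with p hp
  rw [hp, real_inner_comm]

lemma IsParametrization.continuousOn_metric (hψ : IsParametrization b n U ψ) :
    ContinuousOn (metric b ψ) U := by
  refine continuousOn_pi.2 fun μ => continuousOn_pi.2 fun ν => ?_
  have h (μ : Fin (4 * n)) := ((hψ.isSmoothFam.dq hψ.isOpen μ).contDiffOn_emb hψ.isOpen).continuousOn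
  refine ((h ν).inner (𝕜 := ℝ) (h μ)).congr fun q hq => ?_
  exact ((hψ.isSmoothFam.dq hψ.isOpen ν).isSmooth hq).ip_eq
    ((hψ.isSmoothFam.dq hψ.isOpen μ).isSmooth hq).coeFn_emb

/-- A null vector of the Gram matrix gives a combination of the ψ_μ with vanishing `L²` norm. Being
smooth, it vanishes everywhere, against linear independence. -/
lemma IsParametrization.det_metric_ne_zero (hψ : IsParametrization b n U ψ) {q : Coord n}
    (hq : q ∈ U) : (metric b ψ q).det ≠ 0 := by
  intro h
  obtain ⟨c, hc, hm⟩ := Matrix.exists_mulVec_eq_zero_iff.2 h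
  have hs (μ : Fin (4 * n)) := (hψ.isSmoothFam.dq hψ.isOpen μ).isSmooth hq
  have hsum : IsSmooth b fun p => ∑ μ, c μ • dq μ ψ q p :=
    .sum fun μ _ => (IsSmooth.const b (c μ)).smul (hs μ)
  have hemb : emb b (fun p => ∑ μ, c μ • dq μ ψ q p) = ∑ μ, c μ • emb b (dq μ ψ q) := by
    refine Lp.ext ?_
    have h1 := Lp.coeFn_finsetSum (μ := torusMeasure b) Finset.univ
      (fun μ => c μ • emb b (dq μ ψ q))
    filter_upwards [hsum.coeFn_emb, h1, ae_all_iff.2 fun μ => (hs μ).coeFn_emb,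
      ae_all_iff.2 fun μ => Lp.coeFn_smul (c μ) (emb b (dq μ ψ q))] with p h1 h2 h3 h4
    rw [h1, h2, Finset.sum_apply]
    refine Finset.sum_congr rfl fun μ _ => ?_
    rw [h4, Pi.smul_apply, h3]
  have hzero : emb b (fun p => ∑ μ, c μ • dq μ ψ q p) = 0 := by
    rw [← inner_self_eq_zero (𝕜 := ℝ), hemb, sum_inner]
    refine Finset.sum_eq_zero fun μ _ => ?_
    rw [real_inner_smul_left, inner_sum]
    have h1 := congrFun hm μ
    rw [Matrix.mulVec, dotProduct] at h1
    have h2 : ∑ ν, ⟪emb b (dq μ ψ q), c ν • emb b (dq ν ψ q)⟫ = ∑ ν, metric b ψ q μ ν * c ν := by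
      refine Finset.sum_congr rfl fun ν _ => ?_
      rw [real_inner_smul_right, (hs μ).inner_emb_emb (hs ν), mul_comm]
      rfl
    rw [h2, h1, Pi.zero_apply, mul_zero]
  have h0 := hsum.eq_zero_of_emb_eq_zero hzero
  refine hc (funext fun μ => Fintype.linearIndependent_iff.1 (hψ.linearIndependent q hq) c ?_ μ)
  funext p
  have := congrFun h0 p
  simpa [Finset.sum_apply] using this

/-- The entries of the inverse are cofactors over the determinant, hence continuous on U and bounded
on K. -/
lemma IsParametrization.exists_metric_inv_le (hψ : IsParametrization b n U ψ) (hK : IsCompact K)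
    (hKU : K ⊆ U) : ∃ C, 0 ≤ C ∧ ∀ q ∈ K, ∀ μ ν, |(metric b ψ q)⁻¹ μ ν| ≤ C := by
  have hc : ContinuousOn (fun q => fun μν : Fin (4 * n) × Fin (4 * n) =>
      (metric b ψ q)⁻¹ μν.1 μν.2) U := by
    refine continuousOn_pi.2 fun μν => ?_
    have h1 : Continuous fun A : Matrix (Fin (4 * n)) (Fin (4 * n)) ℝ => A.det :=
      continuous_id.matrix_det
    have h2 : Continuous fun A : Matrix (Fin (4 * n)) (Fin (4 * n)) ℝ => A.adjugate μν.1 μν.2 :=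
      continuous_id.matrix_adjugate.matrix_elem _ _
    refine (((h1.comp_continuousOn hψ.continuousOn_metric).inv₀
      fun q hq => hψ.det_metric_ne_zero hq).mul
        (h2.comp_continuousOn hψ.continuousOn_metric)).congr fun q _ => ?_
    rw [Matrix.inv_def, Matrix.smul_apply, Ring.inverse_eq_inv', smul_eq_mul]
    rfl
  obtain ⟨C, hC, h⟩ := exists_norm_le_of_continuousOn hc hK hKU
  exact ⟨C, hC, fun q hq μ ν => (norm_le_pi_norm _ (μ, ν)).trans (h q hq)⟩

end Metric

end Coordinates

end

end WaveMapTorus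

namespace WaveMapTorus

noncomputable section

open SobolevInstances

set_option maxSynthPendingDepth 3

/-! ### Quadratic expressions along curves -/

section QuadraticCurves

variable {P X : Type} [NormedAddCommGroup P] [NormedSpace ℝ P] [NormedAddCommGroup X]
  [NormedSpace ℝ X] {U K : Set P} {A : P → P →L[ℝ] X} {B : P → P →L[ℝ] P →L[ℝ] X}

/-- The expression `A(q) a + B(q)(v, v)`, linear in the acceleration `a` and quadratic in the
velocity `v`. -/
def accel (A : P → P →L[ℝ] X) (B : P → P →L[ℝ] P →L[ℝ] X) (q v a : P) : X := A q a + B q v v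

/-- The derivative of `A(q) a + B(q)(v, v)` along a curve with `q' = v`, `v' = a`, `a' = j`. -/
def accelDeriv (A : P → P →L[ℝ] X) (B : P → P →L[ℝ] P →L[ℝ] X) (q v a j : P) : X :=
  fderiv ℝ A q v a + A q j + (fderiv ℝ B q v v v + B q a v + B q v a)

lemma exists_norm_accel_le (hA : ContinuousOn A U) (hB : ContinuousOn B U) (hK : IsCompact K)
    (hKU : K ⊆ U) : ∃ C, 0 ≤ C ∧ ∀ q ∈ K, ∀ v a, ‖accel A B q v a‖ ≤ C * (‖a‖ + ‖v‖ ^ 2) := by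
  obtain ⟨C, hC, h⟩ := exists_norm_le_of_continuousOn hA hK hKU
  obtain ⟨C', hC', h'⟩ := exists_norm_le_of_continuousOn hB hK hKU
  refine ⟨C + C', by positivity, fun q hq v a => (norm_add_le _ _).trans ?_⟩
  have h1 := (A q).le_of_opNorm_le (h q hq) a
  have h2 := (B q v).le_of_opNorm_le ((B q).le_of_opNorm_le (h' q hq) v) v
  have h3 : 0 ≤ C' * ‖a‖ := by positivity
  have h4 : 0 ≤ C * ‖v‖ ^ 2 := by positivity
  linear_combination h1 + h2 + h3 + h4

/-- Each term has degree at most three in (v, a, j), and 1 ≤ r lifts all degrees to three. -/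
lemma exists_norm_accelDeriv_le (hU : IsOpen U) (hA : ContDiffOn ℝ ∞ A U) (hB : ContDiffOn ℝ ∞ B U)
    (hK : IsCompact K) (hKU : K ⊆ U) : ∃ C, 0 ≤ C ∧ ∀ q ∈ K, ∀ v a j r, 1 ≤ r → ‖v‖ ≤ r → ‖a‖ ≤ r →
      ‖j‖ ≤ r → ‖accelDeriv A B q v a j‖ ≤ C * r ^ 3 := by
  obtain ⟨C1, hC1, h1⟩ := exists_norm_le_of_continuousOn hA.continuousOn hK hKU
  obtain ⟨C2, hC2, h2⟩ := exists_norm_le_of_continuousOn hB.continuousOn hK hKU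
  obtain ⟨C3, hC3, h3⟩ := exists_norm_le_of_continuousOn
    (hA.continuousOn_fderiv_of_isOpen hU (by simp)) hK hKU
  obtain ⟨C4, hC4, h4⟩ := exists_norm_le_of_continuousOn
    (hB.continuousOn_fderiv_of_isOpen hU (by simp)) hK hKU
  refine ⟨C3 + C1 + (C4 + C2 + C2), by positivity, fun q hq v a j r hr hv ha hj => ?_⟩
  have hr0 : 0 ≤ r := zero_le_one.trans hr
  have r13 : r ≤ r ^ 3 := le_self_pow₀ hr (by norm_num)
  have r23 : r ^ 2 ≤ r ^ 3 := pow_le_pow_right₀ hr (by norm_num)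
  have e1 : ‖fderiv ℝ A q v a‖ ≤ C3 * r * r :=
    (fderiv ℝ A q v).le_of_opNorm_le_of_le ((fderiv ℝ A q).le_of_opNorm_le_of_le (h3 q hq) hv) ha
  have e2 : ‖A q j‖ ≤ C1 * r := (A q).le_of_opNorm_le_of_le (h1 q hq) hj
  have e3 : ‖fderiv ℝ B q v v v‖ ≤ C4 * r * r * r :=
    (fderiv ℝ B q v v).le_of_opNorm_le_of_le ((fderiv ℝ B q v).le_of_opNorm_le_of_le
      ((fderiv ℝ B q).le_of_opNorm_le_of_le (h4 q hq) hv) hv) hv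
  have e4 : ‖B q a v‖ ≤ C2 * r * r :=
    (B q a).le_of_opNorm_le_of_le ((B q).le_of_opNorm_le_of_le (h2 q hq) ha) hv
  have e5 : ‖B q v a‖ ≤ C2 * r * r :=
    (B q v).le_of_opNorm_le_of_le ((B q).le_of_opNorm_le_of_le (h2 q hq) hv) ha
  have t1 := (norm_add_le (fderiv ℝ A q v a) (A q j)).trans (add_le_add e1 e2)
  have t2 := (norm_add₃_le (a := fderiv ℝ B q v v v) (b := B q a v) (c := B q v a)).trans
    (add_le_add (add_le_add e3 e4) e5)
  refine (norm_add_le _ _).trans ((add_le_add t1 t2).trans ?_)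
  have m1 := mul_le_mul_of_nonneg_left r23 hC3
  have m2 := mul_le_mul_of_nonneg_left r13 hC1
  have m4 := mul_le_mul_of_nonneg_left r23 hC2
  linear_combination m1 + m2 + 2 * m4

variable {q v a j : ℝ → P} {S : Set ℝ} {t ε : ℝ}

lemma hasDerivWithinAt_accel (hU : IsOpen U) (hA : ContDiffOn ℝ ∞ A U) (hB : ContDiffOn ℝ ∞ B U)
    (hqU : q t ∈ U) (hq : HasDerivWithinAt q (ε • v t) S t)
    (hv : HasDerivWithinAt v (ε • a t) S t) (ha : HasDerivWithinAt a (ε • j t) S t) :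
    HasDerivWithinAt (fun s => accel A B (q s) (v s) (a s))
      (ε • accelDeriv A B (q t) (v t) (a t) (j t)) S t := by
  have h1 := ((hA.contDiffAt (hU.mem_nhds hqU)).differentiableAt
    (by simp)).hasFDerivAt.comp_hasDerivWithinAt t hq
  have h2 := ((hB.contDiffAt (hU.mem_nhds hqU)).differentiableAt
    (by simp)).hasFDerivAt.comp_hasDerivWithinAt t hq
  refine ((h1.clm_apply ha).add ((h2.clm_apply hv).clm_apply hv)).congr_deriv ?_
  simp only [accelDeriv, map_smul, smul_apply, smul_add, add_apply, Function.comp_apply]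

lemma continuousOn_accel (hA : ContinuousOn A U) (hB : ContinuousOn B U) (hqU : MapsTo q S U)
    (hq : ContinuousOn q S) (hv : ContinuousOn v S) (ha : ContinuousOn a S) :
    ContinuousOn (fun s => accel A B (q s) (v s) (a s)) S :=
  ((hA.comp hq hqU).clm_apply ha).add (((hB.comp hq hqU).clm_apply hv).clm_apply hv)

lemma continuousOn_accelDeriv (hU : IsOpen U) (hA : ContDiffOn ℝ ∞ A U) (hB : ContDiffOn ℝ ∞ B U)
    (hqU : MapsTo q S U) (hq : ContinuousOn q S) (hv : ContinuousOn v S) (ha : ContinuousOn a S)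
    (hj : ContinuousOn j S) :
    ContinuousOn (fun s => accelDeriv A B (q s) (v s) (a s) (j s)) S := by
  have cA := hA.continuousOn.comp hq hqU
  have cB := hB.continuousOn.comp hq hqU
  have dA := (hA.continuousOn_fderiv_of_isOpen hU (by simp)).comp hq hqU
  have dB := (hB.continuousOn_fderiv_of_isOpen hU (by simp)).comp hq hqU
  exact (((dA.clm_apply hv).clm_apply ha).add (cA.clm_apply hj)).add
    (((((dB.clm_apply hv).clm_apply hv).clm_apply hv).add ((cB.clm_apply ha).clm_apply hv)).add
      ((cB.clm_apply hv).clm_apply ha))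

/-- The first two derivatives of `G(q)` along a curve. -/
lemma hasDerivWithinAt_fderiv_curve {G : P → X} (hU : IsOpen U) (hG : ContDiffOn ℝ ∞ G U)
    (hqU : q t ∈ U) (hq : HasDerivWithinAt q (ε • v t) S t)
    (hv : HasDerivWithinAt v (ε • a t) S t) :
    HasDerivWithinAt (fun s => G (q s)) (ε • fderiv ℝ G (q t) (v t)) S t ∧
    HasDerivWithinAt (fun s => ε • fderiv ℝ G (q s) (v s))
      ((ε ^ 2) • accel (fderiv ℝ G) (fderiv ℝ (fderiv ℝ G)) (q t) (v t) (a t)) S t := by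
  have hG' : ContDiffOn ℝ ∞ (fderiv ℝ G) U := hG.fderiv_of_isOpen hU (by simp)
  have h1 := ((hG.contDiffAt (hU.mem_nhds hqU)).differentiableAt
    (by simp)).hasFDerivAt.comp_hasDerivWithinAt t hq
  have h2 := ((hG'.contDiffAt (hU.mem_nhds hqU)).differentiableAt
    (by simp)).hasFDerivAt.comp_hasDerivWithinAt t hq
  rw [map_smul] at h1
  refine ⟨h1, ((h2.clm_apply hv).const_smul ε).congr_deriv ?_⟩
  simp only [accel, map_smul, smul_apply, smul_add, Function.comp_apply, smul_smul, sq]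
  rw [add_comm]

end QuadraticCurves

/-! ### The right hand side of the equation for `Y` -/

section Forcing

variable {b : Module.Basis (Fin 2) ℝ Plane} {n : ℕ}

/-- The cubic nonlinearity `j'`, written in terms of a trilinear product. -/
def nonlin {V : Type} [NormedAddCommGroup V] [NormedSpace ℝ V] (T : V →L[ℝ] V →L[ℝ] V →L[ℝ] V)
    (ε : ℝ) (τ Z Y φ L : V) (y p : Fin 2 → V) : V :=
  -((2 : ℝ) • T τ Z φ
    + ε • ((T Z Z φ - ∑ i, T (y i) (y i) φ) + (T τ τ Y - (2 : ℝ) • ∑ i, T (p i) (y i) Y))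
    + ((2 * ε ^ 2) • T τ Z Y + ε ^ 3 • (T Z Z Y - ∑ i, T (y i) (y i) Y))
    + ε • (T Y Y L + ∑ i, (2 : ℝ) • T Y (y i) (p i)))

lemma norm_nonlin_le {V : Type} [NormedAddCommGroup V] [NormedSpace ℝ V]
    (T : V →L[ℝ] V →L[ℝ] V →L[ℝ] V) {ε R : ℝ} (hε : 0 ≤ ε) (hε1 : ε ≤ 1) {τ Z Y φ L : V}
    {y p : Fin 2 → V} (hτ : ‖τ‖ ≤ R) (hZ : ‖Z‖ ≤ R) (hY : ‖Y‖ ≤ R) (hφ : ‖φ‖ ≤ R) (hL : ‖L‖ ≤ R)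
    (hy : ∀ i, ‖y i‖ ≤ R) (hp : ∀ i, ‖p i‖ ≤ R) :
    ‖nonlin T ε τ Z Y φ L y p‖ ≤ 20 * (‖T‖ * R ^ 3) := by
  have hR : 0 ≤ R := (norm_nonneg _).trans hτ
  set M := ‖T‖ * R ^ 3 with hM
  have hM0 : 0 ≤ M := by positivity
  have tb {u v w : V} (hu : ‖u‖ ≤ R) (hv : ‖v‖ ≤ R) (hw : ‖w‖ ≤ R) : ‖T u v w‖ ≤ M := by
    refine ((T u v).le_of_opNorm_le_of_le ((T u).le_of_opNorm_le_of_le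
      (T.le_opNorm_of_le hu) hv) hw).trans_eq ?_
    rw [hM]; ring
  have sm {u : V} {c x : ℝ} (hx : 0 ≤ x) (hu : ‖u‖ ≤ x) (hc : 0 ≤ c) (hc1 : c ≤ 1) :
      ‖c • u‖ ≤ x := by
    rw [norm_smul, Real.norm_of_nonneg hc]
    nlinarith [norm_nonneg u]
  have tw {u : V} {x : ℝ} (hu : ‖u‖ ≤ x) : ‖(2 : ℝ) • u‖ ≤ 2 * x := by
    rw [norm_smul, Real.norm_of_nonneg zero_le_two]
    linarith
  have ad {u v : V} {x y : ℝ} (hu : ‖u‖ ≤ x) (hv : ‖v‖ ≤ y) : ‖u + v‖ ≤ x + y := norm_add_le_of_le hu hv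
  have sb {u v : V} {x y : ℝ} (hu : ‖u‖ ≤ x) (hv : ‖v‖ ≤ y) : ‖u - v‖ ≤ x + y := norm_sub_le_of_le hu hv
  have su {u : Fin 2 → V} {x : ℝ} (hu : ∀ i, ‖u i‖ ≤ x) : ‖∑ i, u i‖ ≤ x + x := by
    rw [Fin.sum_univ_two]; exact ad (hu 0) (hu 1)
  rw [nonlin, norm_neg]
  have e1 := tw (tb hτ hZ hφ)
  have e2 := sm (x := 8 * M) (by positivity) ((ad (sb (tb hZ hZ hφ) (su fun i => tb (hy i) (hy i) hφ))
    (sb (tb hτ hτ hY) (tw (su fun i => tb (hp i) (hy i) hY)))).trans (by linarith)) hε hε1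
  have e3 : ‖(2 * ε ^ 2) • T τ Z Y‖ ≤ 2 * M := by
    rw [mul_smul]
    exact tw (sm hM0 (tb hτ hZ hY) (by positivity) (pow_le_one₀ hε hε1))
  have e4 := sm (x := 3 * M) (by positivity) ((sb (tb hZ hZ hY) (su fun i => tb (hy i) (hy i) hY)).trans
    (by linarith)) (pow_nonneg hε 3) (pow_le_one₀ hε hε1)
  have e5 := sm (x := 5 * M) (by positivity) ((ad (tb hY hY hL)
    (su fun i => tw (tb hY (hy i) (hp i)))).trans (by linarith)) hε hε1
  -- The five groups contribute 2 + 8 + 2 + 3 + 5 = 20 copies of M.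
  exact (ad (ad (ad e1 e2) (ad e3 e4)) e5).trans (by linarith)

lemma continuousOn_nonlin {V : Type} [NormedAddCommGroup V] [NormedSpace ℝ V]
    (T : V →L[ℝ] V →L[ℝ] V →L[ℝ] V) (ε : ℝ) {S : Set ℝ} {τ Z Y φ L : ℝ → V} {y p : Fin 2 → ℝ → V}
    (hτ : ContinuousOn τ S) (hZ : ContinuousOn Z S) (hY : ContinuousOn Y S) (hφ : ContinuousOn φ S)
    (hL : ContinuousOn L S) (hy : ∀ i, ContinuousOn (y i) S) (hp : ∀ i, ContinuousOn (p i) S) :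
    ContinuousOn (fun s => nonlin T ε (τ s) (Z s) (Y s) (φ s) (L s) (fun i => y i s)
      fun i => p i s) S := by
  have c {u v w : ℝ → V} (hu : ContinuousOn u S) (hv : ContinuousOn v S) (hw : ContinuousOn w S) :
      ContinuousOn (fun s => T (u s) (v s) (w s)) S :=
    ((T.continuous.comp_continuousOn hu).clm_apply hv).clm_apply hw
  have cs {u : Fin 2 → ℝ → V} (hu : ∀ i, ContinuousOn (u i) S) :
      ContinuousOn (fun s => ∑ i, u i s) S := continuousOn_finsetSum _ fun i _ => hu i
  exact ((((c hτ hZ hφ).const_smul (2 : ℝ)).add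
    ((((c hZ hZ hφ).sub (cs fun i => c (hy i) (hy i) hφ)).add
      ((c hτ hτ hY).sub ((cs fun i => c (hp i) (hy i) hY).const_smul (2 : ℝ)))).const_smul ε)).add
    (((c hτ hZ hY).const_smul (2 * ε ^ 2)).add
      (((c hZ hZ hY).sub (cs fun i => c (hy i) (hy i) hY)).const_smul (ε ^ 3)))).add
    (((c hY hY hL).add (cs fun i => (c hY (hy i) (hp i)).const_smul (2 : ℝ))).const_smul ε) |>.neg

/-- The element `u` of a Sobolev space is represented by the function `f`. -/
def Rep {k : ℕ} (u : H b k) (f : Plane → R3) : Prop := D u [] =ᵐ[torusMeasure b] f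

namespace Rep

variable {k : ℕ} {u v w : H b k} {f g h : Plane → R3}

lemma add (hu : Rep u f) (hv : Rep v g) : Rep (u + v) fun p => f p + g p := by
  filter_upwards [D_add u v, hu, hv] with p h1 h2 h3
  rw [h1, Pi.add_apply, h2, h3]

lemma smul (c : ℝ) (hu : Rep u f) : Rep (c • u) fun p => c • f p := by
  filter_upwards [D_smul c u, hu] with p h1 h2
  rw [h1, Pi.smul_apply, h2]

lemma neg (hu : Rep u f) : Rep (-u) fun p => -f p := by
  have := hu.smul (-1)
  simpa only [neg_smul, one_smul] using this

lemma sub (hu : Rep u f) (hv : Rep v g) : Rep (u - v) fun p => f p - g p := by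
  have := hu.add hv.neg
  simpa only [sub_eq_add_neg] using this

lemma sum {ι : Type} [DecidableEq ι] (s : Finset ι) {u : ι → H b k} {f : ι → Plane → R3}
    (h : ∀ i, Rep (u i) (f i)) : Rep (∑ i ∈ s, u i) fun p => ∑ i ∈ s, f i p := by
  induction s using Finset.induction_on with
  | empty =>
    have h0 : Rep (0 : H b k) fun _ => 0 := by
      rw [Rep, D_eq_der (α := []) (Nat.zero_le k), map_zero]
      exact Lp.coeFn_zero _ _ _
    simpa using h0
  | insert i s hi ih =>
    have := (h i).add ih
    simpa only [Finset.sum_insert hi] using this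

lemma tri {u v w : H b 2} (hu : Rep u f) (hv : Rep v g) (hw : Rep w h) :
    Rep (triL b u v w) fun p => ⟪f p, g p⟫ • h p := by
  filter_upwards [D_triL u v w, hu, hv, hw] with p h1 h2 h3 h4
  rw [h1, WaveMapTorus.tri, h2, h3, h4]

lemma lin1 {u : Fin (4 * n) → H b k} {f : Fin (4 * n) → Plane → R3} (h : ∀ μ, Rep (u μ) (f μ))
    (v : Coord n) : Rep (lin1 u v) fun p => ∑ μ, v μ • f μ p := by
  rw [lin1_apply]
  exact .sum _ fun μ => (h μ).smul (v μ)

lemma lin2 {u : Fin (4 * n) → Fin (4 * n) → H b k} {f : Fin (4 * n) → Fin (4 * n) → Plane → R3}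
    (h : ∀ μ ν, Rep (u μ ν) (f μ ν)) (v w : Coord n) :
    Rep (lin2 u v w) fun p => ∑ μ, ∑ ν, (v μ * w ν) • f μ ν p := by
  rw [lin2_apply]
  exact .sum _ fun μ => .sum _ fun ν => (h μ ν).smul (v μ * w ν)

lemma congr (hu : Rep u f) (hfg : ∀ p, f p = g p) : Rep u g := funext hfg ▸ hu

lemma nonlin {τ Z Y φ L : H b 2} {y p : Fin 2 → H b 2} {τ' Z' Y' φ' L' : Plane → R3}
    {y' p' : Fin 2 → Plane → R3} (hτ : Rep τ τ') (hZ : Rep Z Z') (hY : Rep Y Y') (hφ : Rep φ φ')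
    (hL : Rep L L') (hy : ∀ i, Rep (y i) (y' i)) (hp : ∀ i, Rep (p i) (p' i)) (ε : ℝ) :
    Rep (nonlin (triL b) ε τ Z Y φ L y p) fun x =>
      -((2 : ℝ) • ⟪τ' x, Z' x⟫ • φ' x
        + ε • ((⟪Z' x, Z' x⟫ • φ' x - ∑ i, ⟪y' i x, y' i x⟫ • φ' x)
          + (⟪τ' x, τ' x⟫ • Y' x - (2 : ℝ) • ∑ i, ⟪p' i x, y' i x⟫ • Y' x))
        + ((2 * ε ^ 2) • ⟪τ' x, Z' x⟫ • Y' x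
          + ε ^ 3 • (⟪Z' x, Z' x⟫ • Y' x - ∑ i, ⟪y' i x, y' i x⟫ • Y' x))
        + ε • (⟪Y' x, Y' x⟫ • L' x + ∑ i, (2 : ℝ) • ⟪Y' x, y' i x⟫ • p' i x)) :=
  ((((hτ.tri hZ hφ).smul 2).add
    ((((hZ.tri hZ hφ).sub (.sum _ fun i => (hy i).tri (hy i) hφ)).add
      ((hτ.tri hτ hY).sub ((Rep.sum _ fun i => (hp i).tri (hy i) hY).smul 2))).smul ε)).add
    (((hτ.tri hZ hY).smul (2 * ε ^ 2)).add
      (((hZ.tri hZ hY).sub (.sum _ fun i => (hy i).tri (hy i) hY)).smul (ε ^ 3)))).add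
    (((hY.tri hY hL).add (.sum _ fun i => (hY.tri (hy i) (hp i)).smul 2)).smul ε) |>.neg

end Rep

end Forcing

end

end WaveMapTorus

namespace WaveMapTorus

noncomputable section

open SobolevInstances

set_option maxSynthPendingDepth 3

/-! ### The forcing terms in H² and bounds that are uniform on K. -/

section Terms

variable {b : Module.Basis (Fin 2) ℝ Plane} {n : ℕ}

lemma IsSmoothFam.add {P E : Type} [NormedAddCommGroup P] [NormedSpace ℝ P] [NormedAddCommGroup E]
    [NormedSpace ℝ E] {U : Set P} {f f' : P → Plane → E} (hf : IsSmoothFam b U f)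
    (hf' : IsSmoothFam b U f') : IsSmoothFam b U fun q p => f q p + f' q p :=
  ⟨hf.contDiffOn.add hf'.contDiffOn, fun q hq => (hf.periodic q hq).comp₂ (hf'.periodic q hq) _⟩

/-- The coefficient `ψ_{μν} + (ψ_μ · ψ_ν) ψ` of `v^μ v^ν` in `-k`. -/
def kCoeff (ψ : Coord n → Plane → R3) (μ ν : Fin (4 * n)) : Coord n → Plane → R3 :=
  fun q p => dq ν (dq μ ψ) q p + tri (dq μ ψ q) (dq ν ψ q) (ψ q) p

/-- Expanding |ψ_τ|² exhibits -k as linear in the acceleration plus quadratic in the velocity, with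
coefficients depending only on q. -/
lemma neg_kTerm_eq (ψ : Coord n → Plane → R3) (q v a : Coord n) (p : Plane) :
    (∑ μ, a μ • dq μ ψ q p) + ∑ μ, ∑ ν, (v μ * v ν) • kCoeff ψ μ ν q p = -kTerm ψ q v a p := by
  have h : ‖psiTau ψ q v p‖ ^ 2 = ∑ μ, ∑ ν, v μ * v ν * ⟪dq μ ψ q p, dq ν ψ q p⟫ := by
    rw [← real_inner_self_eq_norm_sq, psiTau, sum_inner]
    refine Finset.sum_congr rfl fun μ _ => ?_
    rw [inner_sum]
    refine Finset.sum_congr rfl fun ν _ => ?_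
    rw [real_inner_smul_left, real_inner_smul_right]
    ring
  rw [kTerm, neg_neg, psiTauTau, h, add_assoc]
  refine congrArg _ ?_
  simp only [Finset.sum_smul, ← Finset.sum_add_distrib, kCoeff, tri, smul_add, smul_smul]

/-- The operator coefficients of `-k` in `H²`. -/
def kLin (b : Module.Basis (Fin 2) ℝ Plane) (ψ : Coord n → Plane → R3) (q : Coord n) :
    Coord n →L[ℝ] H b 2 := lin1 fun μ => toH b 2 (dq μ ψ q)

/-- The quadratic coefficients of `-k` in `H²`. -/
def kQuad (b : Module.Basis (Fin 2) ℝ Plane) (ψ : Coord n → Plane → R3) (q : Coord n) :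
    Coord n →L[ℝ] Coord n →L[ℝ] H b 2 := lin2 fun μ ν => toH b 2 (kCoeff ψ μ ν q)

/-- The linear coefficients of `-L k` in `L²`. -/
def jacobiLin (b : Module.Basis (Fin 2) ℝ Plane) (ψ : Coord n → Plane → R3) (q : Coord n) :
    Coord n →L[ℝ] L2 b :=
  lin1 fun μ => secondOrder (lowerOrder b (ψ q)) (toH b 2 (dq μ ψ q))

/-- The quadratic coefficients of `-L k` in `L²`. -/
def jacobiQuad (b : Module.Basis (Fin 2) ℝ Plane) (ψ : Coord n → Plane → R3) (q : Coord n) :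
    Coord n →L[ℝ] Coord n →L[ℝ] L2 b :=
  lin2 fun μ ν => secondOrder (lowerOrder b (ψ q)) (toH b 2 (kCoeff ψ μ ν q))

/-- L acts on the coefficients alone, so -Lk has the form `accel` with `L²` coefficients that are
smooth in q. This makes Lk differentiable in time. -/
lemma secondOrder_accel (ψ : Coord n → Plane → R3) (q v a : Coord n) :
    secondOrder (lowerOrder b (ψ q)) (accel (kLin b ψ) (kQuad b ψ) q v a)
      = accel (jacobiLin b ψ) (jacobiQuad b ψ) q v a := by
  rw [accel, accel, map_add, kLin, kQuad, map_lin1, map_lin2]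
  rfl

/-- The nonlinearity `j'` as an element of `H²`. -/
def jH (ψ : Coord n → Plane → R3) (ε : ℝ) (q v : Coord n) (Y : H b 3) (Z : H b 2) : H b 2 :=
  nonlin (triL b) ε (kLin b ψ q v) Z (inclL (by norm_num) Y) (toH b 2 (ψ q)) (toH b 2 (lap (ψ q)))
    (fun i => shift i Y) fun i => toH b 2 (pd i (ψ q))

section Param

variable {U K : Set (Coord n)} {ψ : Coord n → Plane → R3}

lemma IsParametrization.dq_fam (hψ : IsParametrization b n U ψ) (μ : Fin (4 * n)) :
    IsSmoothFam b U (dq μ ψ) :=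
  hψ.isSmoothFam.dq hψ.isOpen μ

lemma IsParametrization.dq_dq_fam (hψ : IsParametrization b n U ψ) (μ ν : Fin (4 * n)) :
    IsSmoothFam b U (dq ν (dq μ ψ)) :=
  (hψ.dq_fam μ).dq hψ.isOpen ν

lemma IsParametrization.kCoeff_fam (hψ : IsParametrization b n U ψ) (μ ν : Fin (4 * n)) :
    IsSmoothFam b U (kCoeff ψ μ ν) :=
  (hψ.dq_dq_fam μ ν).add ((hψ.dq_fam μ).tri (hψ.dq_fam ν) hψ.isSmoothFam)

lemma IsParametrization.lap_fam (hψ : IsParametrization b n U ψ) :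
    IsSmoothFam b U fun q => lap (ψ q) :=
  .sum fun i _ => (hψ.isSmoothFam.pd hψ.isOpen i).pd hψ.isOpen i

lemma IsParametrization.continuousOn_kLin (hψ : IsParametrization b n U ψ) :
    ContinuousOn (kLin b ψ) U :=
  continuousOn_lin1 fun μ => (hψ.dq_fam μ).continuousOn_toH hψ.isOpen 2

lemma IsParametrization.continuousOn_kQuad (hψ : IsParametrization b n U ψ) :
    ContinuousOn (kQuad b ψ) U :=
  continuousOn_lin1 fun μ => continuousOn_lin1 fun ν =>
    (hψ.kCoeff_fam μ ν).continuousOn_toH hψ.isOpen 2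

lemma IsParametrization.contDiffOn_jacobiLin (hψ : IsParametrization b n U ψ) :
    ContDiffOn ℝ ∞ (jacobiLin b ψ) U :=
  contDiffOn_lin1 fun μ => hψ.isSmoothFam.contDiffOn_jacobi (hψ.dq_fam μ) hψ.isOpen

lemma IsParametrization.contDiffOn_jacobiQuad (hψ : IsParametrization b n U ψ) :
    ContDiffOn ℝ ∞ (jacobiQuad b ψ) U :=
  contDiffOn_lin1 fun μ => contDiffOn_lin1 fun ν =>
    hψ.isSmoothFam.contDiffOn_jacobi (hψ.kCoeff_fam μ ν) hψ.isOpen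

lemma IsParametrization.rep_accel (hψ : IsParametrization b n U ψ) {q : Coord n} (hq : q ∈ U)
    (v a : Coord n) : Rep (-accel (kLin b ψ) (kQuad b ψ) q v a) (kTerm ψ q v a) :=
  ((Rep.lin1 (fun μ => ((hψ.dq_fam μ).isSmooth hq).D_toH 2) a).add
    (Rep.lin2 (fun μ ν => ((hψ.kCoeff_fam μ ν).isSmooth hq).D_toH 2) v v)).neg.congr fun p => by
      rw [neg_kTerm_eq, neg_neg]

/-- Y, its first derivatives and Y_t all lie in `H b 2`; hence the cubic expression j' does too, and
L can be applied to it. -/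
lemma IsParametrization.rep_jH (hψ : IsParametrization b n U ψ) {q : Coord n} (hq : q ∈ U) (ε : ℝ)
    (v : Coord n) (Y : H b 3) (Z : H b 2) : Rep (jH ψ ε q v Y Z) (jTerm ψ ε q v Y Z) := by
  have hY : Rep (inclL (b := b) (k := 3) (m := 2) (by norm_num) Y) (D Y []) := by
    rw [Rep, D_eq_der (α := []) (Nat.zero_le 2), D_eq_der (α := []) (Nat.zero_le 3)]
    rfl
  have hy (i : Fin 2) : Rep (shift i Y) (D Y [i]) := by
    rw [Rep, D_eq_der (α := []) (Nat.zero_le 2), D_eq_der (α := [i]) (by simp), der_shift]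
    rfl
  have hτ : Rep (kLin b ψ q v) (psiTau ψ q v) :=
    Rep.lin1 (fun μ => ((hψ.dq_fam μ).isSmooth hq).D_toH 2) v
  refine (Rep.nonlin hτ (Filter.EventuallyEq.refl _ (D Z [])) hY
    ((hψ.isSmoothFam.isSmooth hq).D_toH 2) ((hψ.lap_fam.isSmooth hq).D_toH 2) hy
    (fun i => ((hψ.isSmoothFam.pd hψ.isOpen i).isSmooth hq).D_toH 2) ε).congr fun p => ?_
  simp only [jTerm, lorentz, Fin.sum_univ_two, real_inner_self_eq_norm_sq]
  module

lemma IsParametrization.exists_norm_jH_le (hψ : IsParametrization b n U ψ) (hK : IsCompact K)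
    (hKU : K ⊆ U) : ∃ C, 0 ≤ C ∧ ∀ q ∈ K, ∀ (ε r : ℝ) (v : Coord n) (Y : H b 3) (Z : H b 2), 0 ≤ ε →
      ε ≤ 1 → 1 ≤ r → ‖v‖ ≤ r → ‖Y‖ ≤ r → ‖Z‖ ≤ r → ‖jH ψ ε q v Y Z‖ ≤ C * r ^ 3 := by
  obtain ⟨C1, h1, H1⟩ := exists_norm_le_of_continuousOn hψ.continuousOn_kLin hK hKU
  obtain ⟨C2, h2, H2⟩ := exists_norm_le_of_continuousOn
    (hψ.isSmoothFam.continuousOn_toH hψ.isOpen 2) hK hKU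
  obtain ⟨C3, h3, H3⟩ := exists_norm_le_of_continuousOn
    (hψ.lap_fam.continuousOn_toH hψ.isOpen 2) hK hKU
  have hp (i : Fin 2) := exists_norm_le_of_continuousOn
    ((hψ.isSmoothFam.pd hψ.isOpen i).continuousOn_toH hψ.isOpen 2) hK hKU
  choose C4 h4 H4 using hp
  obtain ⟨I, hI, HI⟩ : ∃ I, 0 ≤ I ∧ ∀ Y : H b 3,
      ‖inclL (b := b) (k := 3) (m := 2) (by norm_num) Y‖ ≤ I * ‖Y‖ :=
    ⟨_, norm_nonneg _, ContinuousLinearMap.le_opNorm _⟩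
  have hJ (i : Fin 2) : ∃ J, 0 ≤ J ∧ ∀ Y : H b 3, ‖shift (b := b) (k := 2) i Y‖ ≤ J * ‖Y‖ :=
    ⟨_, norm_nonneg _, ContinuousLinearMap.le_opNorm _⟩
  choose J hJ HJ using hJ
  have h4s := Finset.sum_nonneg fun i (_ : i ∈ Finset.univ) => h4 i
  have hJs := Finset.sum_nonneg fun i (_ : i ∈ Finset.univ) => hJ i
  have h4l (i : Fin 2) := Finset.single_le_sum (fun i _ => h4 i) (Finset.mem_univ i)
  have hJl (i : Fin 2) := Finset.single_le_sum (fun i _ => hJ i) (Finset.mem_univ i)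
  -- One constant bounds all the factors by M r; the summand 1 is for Z, the other constants for the
  -- remaining factors.
  obtain ⟨M, hM⟩ : ∃ M, M = 1 + C1 + C2 + C3 + ∑ i, C4 i + I + ∑ i, J i := ⟨_, rfl⟩
  have hM0 : 0 ≤ M := by linarith
  refine ⟨20 * (‖triL b‖ * M ^ 3), by positivity, fun q hq ε r v Y Z hε hε1 hr hv hY hZ => ?_⟩
  have hr0 : 0 ≤ r := zero_le_one.trans hr
  have big {x c : ℝ} (hx : x ≤ c * r) (hc : c ≤ M) : x ≤ M * r :=
    hx.trans (mul_le_mul_of_nonneg_right hc hr0)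
  have big' {x c : ℝ} (hc0 : 0 ≤ c) (hx : x ≤ c) (hc : c ≤ M) : x ≤ M * r :=
    big (hx.trans (le_mul_of_one_le_right hc0 hr)) hc
  have b1 := big ((kLin b ψ q).le_of_opNorm_le_of_le (H1 q hq) hv) (by linarith)
  have b2 := big (hZ.trans_eq (one_mul r).symm) (by linarith)
  have b3 := big ((HI Y).trans (mul_le_mul_of_nonneg_left hY hI)) (by linarith)
  have b4 := big' h2 (H2 q hq) (by linarith)
  have b5 := big' h3 (H3 q hq) (by linarith)
  have b6 (i : Fin 2) := big ((HJ i Y).trans (mul_le_mul_of_nonneg_left hY (hJ i)))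
    (by linarith [hJl i])
  have b7 (i : Fin 2) := big' (h4 i) (H4 i q hq) (by linarith [h4l i])
  rw [mul_assoc, mul_assoc, ← mul_pow]
  exact norm_nonlin_le (triL b) hε hε1 b1 b2 b3 b4 b5 b6 b7

lemma IsParametrization.exists_norm_secondOrder_le (hψ : IsParametrization b n U ψ)
    (hK : IsCompact K) (hKU : K ⊆ U) : ∃ C, 0 ≤ C ∧ ∀ q ∈ K, ∀ u : H b 2,
      ‖secondOrder (lowerOrder b (ψ q)) u‖ ≤ C * ‖u‖ := by
  obtain ⟨C1, h1, H1⟩ := exists_norm_le_of_continuousOn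
    (hψ.isSmoothFam.contDiffOn_lowerOrder hψ.isOpen).continuousOn hK hKU
  set I := ‖inclL (b := b) one_le_two‖
  refine ⟨‖secondOrder (0 : H b 1 →L[ℝ] L2 b)‖ + C1 * I, by positivity, fun q hq u => ?_⟩
  rw [secondOrder_eq, add_mul, mul_assoc]
  exact norm_add_le_of_le (ContinuousLinearMap.le_opNorm _ _)
    ((lowerOrder b (ψ q)).le_of_opNorm_le_of_le (H1 q hq) (ContinuousLinearMap.le_opNorm _ _))

lemma IsSmoothFam.exists_norm_mulL_le {P : Type} [NormedAddCommGroup P] [NormedSpace ℝ P]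
    {U K : Set P} {A : P → Plane → R3 →L[ℝ] R3} (hA : IsSmoothFam b U A) (hU : IsOpen U)
    (hK : IsCompact K) (hKU : K ⊆ U) :
    ∃ C, 0 ≤ C ∧ ∀ q ∈ K, ∀ f, ‖mulL b (bcf (A q)) f‖ ≤ C * ‖f‖ := by
  obtain ⟨C, hC, H⟩ := exists_norm_le_of_continuousOn
    (IsSmoothFam.contDiffOn_clm_bcf (mulL b) hA hU).continuousOn hK hKU
  exact ⟨C, hC, fun q hq f => (mulL b (bcf (A q))).le_of_opNorm_le (H q hq) f⟩

/-- The explicit formulas of `improvedJacobi_one` involve derivatives of `u` up to order three and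
multiplications bounded uniformly on K. -/
lemma IsParametrization.exists_norm_improvedJacobi_le (hψ : IsParametrization b n U ψ)
    (hK : IsCompact K) (hKU : K ⊆ U) : ∃ C, 0 ≤ C ∧ ∀ q ∈ K, ∀ u : H b 3,
      ‖improvedJacobi (k := 1) (ψ q) u‖ ≤ C * ‖u‖ := by
  have hU := hψ.isOpen
  have hf := hψ.isSmoothFam
  obtain ⟨C0, h0, H0⟩ := hψ.exists_norm_secondOrder_le hK hKU
  obtain ⟨C1, h1, H1⟩ := (hf.coeffZero hU).exists_norm_mulL_le hU hK hKU
  have hz (j : Fin 2) := ((hf.coeffZero hU).pd hU j).exists_norm_mulL_le hU hK hKU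
  choose C2 h2 H2 using hz
  have ho (i : Fin 2) := (hf.coeffOne hU i).exists_norm_mulL_le hU hK hKU
  choose C3 h3 H3 using ho
  have hp (i j : Fin 2) := ((hf.coeffOne hU i).pd hU j).exists_norm_mulL_le hU hK hKU
  choose C4 h4 H4 using hp
  set I := ‖inclL (b := b) (k := 3) (m := 2) (by norm_num)‖
  have hI : 0 ≤ I := norm_nonneg _
  set M := C0 * I + ∑ j : Fin 2, (2 + (C2 j + C1) + ∑ i : Fin 2, (C4 i j + C3 i)) with hM
  have hMj (j : Fin 2) : 0 ≤ 2 + (C2 j + C1) + ∑ i : Fin 2, (C4 i j + C3 i) :=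
    add_nonneg (add_nonneg zero_le_two (add_nonneg (h2 j) h1))
      (Finset.sum_nonneg fun i _ => add_nonneg (h4 i j) (h3 i))
  have hM0 : 0 ≤ M := add_nonneg (mul_nonneg h0 hI) (Finset.sum_nonneg fun j _ => hMj j)
  refine ⟨Fintype.card (MultiIndex 1) * M, by positivity, fun q hq u => ?_⟩
  obtain ⟨e0, e1⟩ := (hf.isSmooth (hKU hq)).improvedJacobi_one u
  rw [mul_assoc]
  refine norm_H1_le ?_ fun j => ?_
  · rw [e0]
    refine (H0 q hq _).trans ?_
    have : ‖incl (by norm_num : 2 ≤ 3) u‖ ≤ I * ‖u‖ := (inclL (b := b) (k := 3) (m := 2)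
      (by norm_num)).le_opNorm u
    calc C0 * ‖incl (by norm_num : 2 ≤ 3) u‖ ≤ C0 * (I * ‖u‖) := by gcongr
      _ = (C0 * I) * ‖u‖ := by ring
      _ ≤ M * ‖u‖ := by
        gcongr
        exact le_add_of_nonneg_right (Finset.sum_nonneg fun j _ => hMj j)
  · rw [e1]
    have d (α : List (Fin 2)) (hα : α.length ≤ 3) : ‖der α hα u‖ ≤ 1 * ‖u‖ := by
      rw [one_mul]; exact norm_der_le _ _ _
    have tr {x : L2 b} {c : ℝ} {y : L2 b} (hc : 0 ≤ c) (h : ‖x‖ ≤ c * ‖y‖) (hy : ‖y‖ ≤ 1 * ‖u‖) :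
        ‖x‖ ≤ c * ‖u‖ := h.trans (by rw [one_mul] at hy; gcongr)
    have b1 : ‖-(∑ i, der [j, i, i] (le_refl 3) u)‖ ≤ 2 * ‖u‖ := by
      rw [norm_neg, Fin.sum_univ_two]
      refine (norm_add_le_of_le (d _ _) (d _ _)).trans_eq (by ring)
    have b2 := norm_add_le_of_le (tr (h2 j) (H2 j q hq _) (d [] (Nat.zero_le 3)))
      (tr h1 (H1 q hq _) (d [j] (by simp)))
    have b3 (i : Fin 2) := norm_add_le_of_le (tr (h4 i j) (H4 i j q hq _) (d [i] (by simp)))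
      (tr (h3 i) (H3 i q hq _) (d [j, i] (by simp)))
    refine (norm_add_le_of_le b1 (norm_add_le_of_le b2
      (norm_sum_le_of_le Finset.univ fun i _ => b3 i))).trans ?_
    have e : 2 * ‖u‖ + (C2 j * ‖u‖ + C1 * ‖u‖ + ∑ i, (C4 i j * ‖u‖ + C3 i * ‖u‖))
        = (2 + (C2 j + C1) + ∑ i : Fin 2, (C4 i j + C3 i)) * ‖u‖ := by
      simp only [Fin.sum_univ_two]; ring
    rw [e]
    refine mul_le_mul_of_nonneg_right ?_ (norm_nonneg u)
    refine (Finset.single_le_sum (f := fun j => 2 + (C2 j + C1) + ∑ i : Fin 2, (C4 i j + C3 i))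
      (fun j _ => hMj j) (Finset.mem_univ j)).trans ?_
    exact le_add_of_nonneg_left (mul_nonneg h0 hI)

end Param

end Terms

end

end WaveMapTorus

namespace WaveMapTorus

noncomputable section

open SobolevInstances

set_option maxSynthPendingDepth 3

/-! ### The curves of a solution -/

section SolutionCurves

variable {b : Module.Basis (Fin 2) ℝ Plane} {n : ℕ} {ε T t : ℝ}

lemma slowDeriv_zero (q : ℝ → Coord n) : slowDeriv ε T 0 q = q := by
  funext s
  simp [slowDeriv]

/-- Slow derivatives are normalized by powers of ε, so each differentiation in t releases one factor
ε. -/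
lemma hasDerivWithinAt_slowDeriv {q : ℝ → Coord n} (hε : 0 < ε) (hT : 0 < T)
    (hq : ContDiffOn ℝ 3 q (Icc 0 T)) {m : ℕ} (hm : m < 3) (ht : t ∈ Icc 0 T) :
    HasDerivWithinAt (slowDeriv ε T m q) (ε • slowDeriv ε T (m + 1) q t) (Icc 0 T) t := by
  have h := ((hq.differentiableOn_iteratedDerivWithin (m := m) (by exact_mod_cast hm)
    (uniqueDiffOn_Icc hT)) t ht).hasDerivWithinAt.const_smul (ε ^ m)⁻¹
  rw [← iteratedDerivWithin_succ] at h
  refine h.congr_deriv ?_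
  rw [slowDeriv, smul_smul, pow_succ', mul_inv, mul_inv_cancel_left₀ hε.ne']

lemma continuousOn_slowDeriv {q : ℝ → Coord n} (hT : 0 < T) (hq : ContDiffOn ℝ 3 q (Icc 0 T))
    {m : ℕ} (hm : m ≤ 3) : ContinuousOn (slowDeriv ε T m q) (Icc 0 T) :=
  ((hq.continuousOn_iteratedDerivWithin (by exact_mod_cast hm)
    (uniqueDiffOn_Icc hT)).const_smul (ε ^ m)⁻¹).congr fun _ _ => rfl

variable {ψ : Coord n → Plane → R3} {K U : Set (Coord n)} {q₀ q₁ : Coord n} {Y₀ : H b 3}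
  {Y₁ : H b 2} {q : ℝ → Coord n} {Y : ℝ → H b 3}

namespace IsSolution

lemma slowDeriv_one_init (S : IsSolution b ψ K ε T q₀ q₁ Y₀ Y₁ q Y) (hε : 0 < ε) :
    slowDeriv ε T 1 q 0 = q₁ := by
  rw [slowDeriv, iteratedDerivWithin_one, S.qt_init, smul_smul, pow_one, inv_mul_cancel₀ hε.ne',
    one_smul]

lemma hasDerivWithinAt_Y (S : IsSolution b ψ K ε T q₀ q₁ Y₀ Y₁ q Y) (ht : t ∈ Icc 0 T) :
    HasDerivWithinAt (fun s => inclL (m := 2) (by norm_num) (Y s)) (Yt T Y t) (Icc 0 T) t :=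
  (S.Y_C1.differentiableOn one_ne_zero t ht).hasDerivWithinAt

lemma continuousOn_Yt (S : IsSolution b ψ K ε T q₀ q₁ Y₀ Y₁ q Y) (hT : 0 < T) :
    ContinuousOn (Yt T Y) (Icc 0 T) :=
  S.Y_C1.continuousOn_derivWithin (uniqueDiffOn_Icc hT) le_rfl

/-- `Ytt` is defined through the inclusion of `H b 3` in `H b 1`; since inclusions commute with
differentiation, it is also the derivative of `Yt` in `H b 1`. -/
lemma hasDerivWithinAt_Yt (S : IsSolution b ψ K ε T q₀ q₁ Y₀ Y₁ q Y) (hT : 0 < T)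
    (ht : t ∈ Icc 0 T) :
    HasDerivWithinAt (fun s => inclL one_le_two (Yt T Y s)) (Ytt T Y t) (Icc 0 T) t := by
  have hu := uniqueDiffOn_Icc hT
  have e (s : ℝ) (hs : s ∈ Icc 0 T) :
      derivWithin (fun s => incl (m := 1) (by norm_num) (Y s)) (Icc 0 T) s
        = inclL one_le_two (Yt T Y s) :=
    ((inclL one_le_two).hasFDerivAt.comp_hasDerivWithinAt s (S.hasDerivWithinAt_Y hs)).derivWithin
      (hu s hs)
  have h := ((S.Y_C2.differentiableOn_iteratedDerivWithin (m := 1) (by norm_num)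
    hu) t ht).hasDerivWithinAt
  rw [← iteratedDerivWithin_succ, iteratedDerivWithin_one] at h
  exact h.congr (fun s hs => (e s hs).symm) (e t ht).symm

lemma continuousOn_Ytt (S : IsSolution b ψ K ε T q₀ q₁ Y₀ Y₁ q Y) (hT : 0 < T) :
    ContinuousOn (Ytt T Y) (Icc 0 T) :=
  S.Y_C2.continuousOn_iteratedDerivWithin (by norm_num) (uniqueDiffOn_Icc hT)

/-- The equation for `Y`, as an equation in `H¹`. -/
lemma Ytt_add_improvedJacobi (S : IsSolution b ψ K ε T q₀ q₁ Y₀ Y₁ q Y)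
    (hψ : IsParametrization b n U ψ) (hKU : K ⊆ U) (ht : t ∈ Icc 0 T) :
    Ytt T Y t + improvedJacobi (k := 1) (ψ (q t)) (Y t)
      = inclL one_le_two (-accel (kLin b ψ) (kQuad b ψ) (q t) (slowDeriv ε T 1 q t)
          (slowDeriv ε T 2 q t)
        + ε • jH ψ ε (q t) (slowDeriv ε T 1 q t) (Y t) (Yt T Y t)) := by
  refine H_ext_ae ?_
  have hq := hKU (S.q_mem t ht)
  have h := (hψ.rep_accel hq (slowDeriv ε T 1 q t) (slowDeriv ε T 2 q t)).add
    ((hψ.rep_jH hq ε (slowDeriv ε T 1 q t) (Y t) (Yt T Y t)).smul ε)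
  have e (u : H b 2) : D (inclL one_le_two u) [] = D u [] := by
    rw [D_eq_der (α := []) (Nat.zero_le 2), D_eq_der (α := []) (Nat.zero_le 1)]
    rfl
  filter_upwards [S.Y_eq t ht, h, D_add (Ytt T Y t) (improvedJacobi (k := 1) (ψ (q t)) (Y t))] with
    p h1 h2 h3
  rw [h3, Pi.add_apply, h1, e, h2]

end IsSolution

section Rates

variable {X : Type} [NormedAddCommGroup X] [NormedSpace ℝ X] {G : Coord n → X}

/-- The first time derivative of `G(q)`. -/
def rate (G : Coord n → X) (ε T : ℝ) (q : ℝ → Coord n) (t : ℝ) : X :=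
  ε • fderiv ℝ G (q t) (slowDeriv ε T 1 q t)

/-- The second time derivative of `G(q)`. -/
def rateRate (G : Coord n → X) (ε T : ℝ) (q : ℝ → Coord n) (t : ℝ) : X :=
  (ε ^ 2) • accel (fderiv ℝ G) (fderiv ℝ (fderiv ℝ G)) (q t) (slowDeriv ε T 1 q t)
    (slowDeriv ε T 2 q t)

lemma IsSolution.continuousOn_q (S : IsSolution b ψ K ε T q₀ q₁ Y₀ Y₁ q Y) :
    ContinuousOn q (Icc 0 T) := S.q_C3.continuousOn

lemma IsSolution.hasDerivWithinAt_q (S : IsSolution b ψ K ε T q₀ q₁ Y₀ Y₁ q Y) (hε : 0 < ε)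
    (hT : 0 < T) (ht : t ∈ Icc 0 T) :
    HasDerivWithinAt q (ε • slowDeriv ε T 1 q t) (Icc 0 T) t := by
  simpa only [slowDeriv_zero] using
    hasDerivWithinAt_slowDeriv hε hT S.q_C3 (m := 0) (by norm_num) ht

lemma IsSolution.hasDerivWithinAt_comp (S : IsSolution b ψ K ε T q₀ q₁ Y₀ Y₁ q Y) (hU : IsOpen U)
    (hKU : K ⊆ U) (hG : ContDiffOn ℝ ∞ G U) (hε : 0 < ε) (hT : 0 < T) (ht : t ∈ Icc 0 T) :
    HasDerivWithinAt (fun s => G (q s)) (rate G ε T q t) (Icc 0 T) t ∧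
    HasDerivWithinAt (rate G ε T q) (rateRate G ε T q t) (Icc 0 T) t :=
  hasDerivWithinAt_fderiv_curve hU hG (hKU (S.q_mem t ht)) (S.hasDerivWithinAt_q hε hT ht)
    (hasDerivWithinAt_slowDeriv hε hT S.q_C3 (by norm_num) ht)

lemma IsSolution.continuousOn_rateRate (S : IsSolution b ψ K ε T q₀ q₁ Y₀ Y₁ q Y) (hU : IsOpen U)
    (hKU : K ⊆ U) (hG : ContDiffOn ℝ ∞ G U) (hT : 0 < T) :
    ContinuousOn (rateRate G ε T q) (Icc 0 T) := by
  have hG' : ContDiffOn ℝ ∞ (fderiv ℝ G) U := hG.fderiv_of_isOpen hU (by simp)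
  exact continuousOn_const.smul (continuousOn_accel hG'.continuousOn
    (hG'.continuousOn_fderiv_of_isOpen hU (by simp)) (fun s hs => hKU (S.q_mem s hs))
    S.continuousOn_q (continuousOn_slowDeriv hT S.q_C3 (by norm_num))
    (continuousOn_slowDeriv hT S.q_C3 (by norm_num)))

lemma exists_norm_rate_le (hU : IsOpen U) (hK : IsCompact K) (hKU : K ⊆ U)
    (hG : ContDiffOn ℝ ∞ G U) : ∃ C, 0 ≤ C ∧ ∀ (ε T t : ℝ) (q : ℝ → Coord n), 0 < ε → q t ∈ K →
      ‖rate G ε T q t‖ ≤ ε * (C * ‖slowDeriv ε T 1 q t‖) := by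
  obtain ⟨C, hC, h⟩ := exists_norm_le_of_continuousOn
    (hG.continuousOn_fderiv_of_isOpen hU (by simp)) hK hKU
  refine ⟨C, hC, fun ε T t q hε hq => ?_⟩
  rw [rate, norm_smul, Real.norm_of_nonneg hε.le]
  gcongr
  exact (fderiv ℝ G (q t)).le_of_opNorm_le (h _ hq) _

lemma exists_norm_rateRate_le (hU : IsOpen U) (hK : IsCompact K) (hKU : K ⊆ U)
    (hG : ContDiffOn ℝ ∞ G U) : ∃ C, 0 ≤ C ∧ ∀ (ε T t : ℝ) (q : ℝ → Coord n), 0 < ε → ε ≤ 1 →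
      q t ∈ K → ‖rateRate G ε T q t‖
        ≤ ε * (C * (‖slowDeriv ε T 2 q t‖ + ‖slowDeriv ε T 1 q t‖ ^ 2)) := by
  have hG' : ContDiffOn ℝ ∞ (fderiv ℝ G) U := hG.fderiv_of_isOpen hU (by simp)
  obtain ⟨C, hC, h⟩ := exists_norm_accel_le hG'.continuousOn
    (hG'.continuousOn_fderiv_of_isOpen hU (by simp)) hK hKU
  refine ⟨C, hC, fun ε T t q hε hε1 hq => ?_⟩
  rw [rateRate, norm_smul, Real.norm_of_nonneg (by positivity)]
  have := h _ hq (slowDeriv ε T 1 q t) (slowDeriv ε T 2 q t)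
  -- One of the two factors ε is given away.
  have h2 : ε ^ 2 ≤ ε := by nlinarith
  gcongr

end Rates

/-- The family of operators `q ↦ lowerOrder b (ψ q)`. -/
def lowerOrderFam (b : Module.Basis (Fin 2) ℝ Plane) (ψ : Coord n → Plane → R3) (q : Coord n) :
    H b 1 →L[ℝ] L2 b := lowerOrder b (ψ q)

lemma IsParametrization.contDiffOn_lowerOrderFam (hψ : IsParametrization b n U ψ) :
    ContDiffOn ℝ ∞ (lowerOrderFam b ψ) U :=
  hψ.isSmoothFam.contDiffOn_lowerOrder hψ.isOpen

/-- The time derivative of `L Y`. -/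
def jacobiRate (ψ : Coord n → Plane → R3) (ε T : ℝ) (q : ℝ → Coord n) (Y : ℝ → H b 3) (t : ℝ) :
    L2 b :=
  secondOrder (lowerOrderFam b ψ (q t)) (Yt T Y t)
    + rate (lowerOrderFam b ψ) ε T q t (inclL one_le_two (inclL (by norm_num : 2 ≤ 3) (Y t)))

/-- Kinetic part: (LY)_t is computed by the product rule in `L²`. Potential part: `Q1_eq` at w = LY.
Hence E₂ is the natural energy of the equation satisfied by w. -/
lemma IsSolution.E2_eq_waveEnergy (S : IsSolution b ψ K ε T q₀ q₁ Y₀ Y₁ q Y)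
    (hψ : IsParametrization b n U ψ) (hKU : K ⊆ U) (hε : 0 < ε) (hT : 0 < T) (ht : t ∈ Icc 0 T) :
    E2 ψ T q Y t = waveEnergy (der [] (Nat.zero_le 1)) (dirichlet b)
      (fun s => lowerOrderFam b ψ (q s)) (fun s => improvedJacobi (k := 1) (ψ (q s)) (Y s))
      (jacobiRate ψ ε T q Y) t := by
  have hs (s : ℝ) (hs : s ∈ Icc 0 T) : IsSmooth b (ψ (q s)) :=
    hψ.isSmoothFam.isSmooth (hKU (S.q_mem s hs))
  have h := (ofL2 b).hasFDerivAt.comp_hasDerivWithinAt t (hasDerivWithinAt_secondOrder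
    (S.hasDerivWithinAt_comp hψ.isOpen hKU hψ.contDiffOn_lowerOrderFam hε hT ht).1
    (S.hasDerivWithinAt_Y ht))
  have e : derivWithin (fun s => (improvedJacobi (k := 0) (ψ (q s))
      (incl (m := 2) (by norm_num) (Y s)) : H b 0)) (Icc 0 T) t
      = ofL2 b (jacobiRate ψ ε T q Y t) :=
    (h.congr (fun s hs' => (hs s hs').improvedJacobi_zero _)
      ((hs t ht).improvedJacobi_zero _)).derivWithin (uniqueDiffOn_Icc hT t ht)
  rw [E2, e, norm_ofL2, waveEnergy, Q2, (hs t ht).Q1_eq]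
  rfl

/-- The right hand side `k + ε j'` of the equation for `Y`, in `H²`. -/
def forcing (ψ : Coord n → Plane → R3) (ε T : ℝ) (q : ℝ → Coord n) (Y : ℝ → H b 3) (t : ℝ) :
    H b 2 :=
  -accel (kLin b ψ) (kQuad b ψ) (q t) (slowDeriv ε T 1 q t) (slowDeriv ε T 2 q t)
    + ε • jH ψ ε (q t) (slowDeriv ε T 1 q t) (Y t) (Yt T Y t)

lemma IsSolution.mapsTo (S : IsSolution b ψ K ε T q₀ q₁ Y₀ Y₁ q Y) (hKU : K ⊆ U) :
    MapsTo q (Icc 0 T) U := fun s hs => hKU (S.q_mem s hs)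

lemma IsSolution.continuousOn_jH (S : IsSolution b ψ K ε T q₀ q₁ Y₀ Y₁ q Y)
    (hψ : IsParametrization b n U ψ) (hKU : K ⊆ U) (hT : 0 < T) :
    ContinuousOn (fun s => jH ψ ε (q s) (slowDeriv ε T 1 q s) (Y s) (Yt T Y s)) (Icc 0 T) := by
  have hU := hψ.isOpen
  have hm := S.mapsTo hKU
  have cf {f : Coord n → Plane → R3} (hf : IsSmoothFam b U f) :
      ContinuousOn (fun s => toH b 2 (f (q s))) (Icc 0 T) :=
    (hf.continuousOn_toH hU 2).comp S.continuousOn_q hm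
  have cY : ContinuousOn (fun s => inclL (m := 2) (by norm_num) (Y s)) (Icc 0 T) :=
    (inclL _).continuous.comp_continuousOn S.Y_C0
  have cτ : ContinuousOn (fun s => kLin b ψ (q s) (slowDeriv ε T 1 q s)) (Icc 0 T) :=
    (hψ.continuousOn_kLin.comp S.continuousOn_q hm).clm_apply
      (continuousOn_slowDeriv hT S.q_C3 (by norm_num))
  have cs (i : Fin 2) : ContinuousOn (fun s => shift i (Y s)) (Icc 0 T) :=
    (shift i).continuous.comp_continuousOn S.Y_C0
  have cp (i : Fin 2) : ContinuousOn (fun s => toH b 2 (pd i (ψ (q s)))) (Icc 0 T) :=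
    cf (hψ.isSmoothFam.pd hU i)
  have cφ := cf hψ.isSmoothFam
  have cL := cf hψ.lap_fam
  have key := continuousOn_nonlin (triL b) ε cτ (S.continuousOn_Yt hT) cY cφ cL
    (y := fun i s => shift i (Y s)) cs (p := fun i s => toH b 2 (pd i (ψ (q s)))) cp
  refine key.congr fun s _ => ?_
  rw [jH]

lemma IsSolution.continuousOn_forcing (S : IsSolution b ψ K ε T q₀ q₁ Y₀ Y₁ q Y)
    (hψ : IsParametrization b n U ψ) (hKU : K ⊆ U) (hT : 0 < T) :
    ContinuousOn (forcing ψ ε T q Y) (Icc 0 T) :=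
  (continuousOn_accel hψ.continuousOn_kLin hψ.continuousOn_kQuad (S.mapsTo hKU) S.continuousOn_q
    (continuousOn_slowDeriv hT S.q_C3 (by norm_num))
    (continuousOn_slowDeriv hT S.q_C3 (by norm_num))).neg.add
    ((S.continuousOn_jH hψ hKU hT).const_smul ε)

/-- The energy identity for the second order energy. -/
lemma IsSolution.E2_sub (S : IsSolution b ψ K ε T q₀ q₁ Y₀ Y₁ q Y)
    (hψ : IsParametrization b n U ψ) (hKU : K ⊆ U) (hε : 0 < ε) (hT : 0 < T) (ht : t ∈ Icc 0 T) :
    E2 ψ T q Y t - E2 ψ T q Y 0 = ∫ s in (0 : ℝ)..t,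
      (⟪secondOrder (lowerOrderFam b ψ (q s)) (forcing ψ ε T q Y s)
          + (2 : ℝ) • rate (lowerOrderFam b ψ) ε T q s (inclL one_le_two (Yt T Y s))
          + rateRate (lowerOrderFam b ψ) ε T q s
            (inclL one_le_two (inclL (by norm_num : 2 ≤ 3) (Y s))), jacobiRate ψ ε T q Y s⟫
        + 1 / 2 * ⟪rate (lowerOrderFam b ψ) ε T q s (improvedJacobi (k := 1) (ψ (q s)) (Y s)),
            der [] (Nat.zero_le 1) (improvedJacobi (k := 1) (ψ (q s)) (Y s))⟫) := by
  have h0 : (0 : ℝ) ∈ Icc 0 T := ⟨le_rfl, hT.le⟩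
  have hs (s : ℝ) (hs : s ∈ Icc 0 T) : IsSmooth b (ψ (q s)) :=
    hψ.isSmoothFam.isSmooth (S.mapsTo hKU hs)
  have hG (s : ℝ) (hs : s ∈ Icc 0 T) :=
    S.hasDerivWithinAt_comp hψ.isOpen hKU hψ.contDiffOn_lowerOrderFam hε hT hs
  have hc := S.continuousOn_rateRate hψ.isOpen hKU hψ.contDiffOn_lowerOrderFam hT
  rw [S.E2_eq_waveEnergy hψ hKU hε hT ht, S.E2_eq_waveEnergy hψ hKU hε hT h0]
  exact waveEnergy_secondOrder_sub (fun s hs => (hG s hs).1) (fun s hs => (hG s hs).2) hc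
    (fun s hs' u v => (hs s hs').inner_lowerOrder_comm u v) (fun s hs => S.hasDerivWithinAt_Y hs)
    (S.continuousOn_Yt hT) (fun s hs => S.hasDerivWithinAt_Yt hT hs) (S.continuousOn_Ytt hT)
    (S.continuousOn_forcing hψ hKU hT)
    (fun s hs => S.Ytt_add_improvedJacobi hψ hKU hs)
    (fun s hs' => ((hs s hs').improvedJacobi_one _).1) ht

end SolutionCurves

end

end WaveMapTorus

namespace WaveMapTorus

noncomputable section

open SobolevInstances

set_option maxSynthPendingDepth 3

/-! ### The initial acceleration -/

section Acceleration

variable {b : Module.Basis (Fin 2) ℝ Plane} {n : ℕ} {U K : Set (Coord n)}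
  {ψ : Coord n → Plane → R3}

lemma Rep.abs_ip_le {k : ℕ} {u : H b k} {f g : Plane → R3} (hu : Rep u f) (hg : IsSmooth b g) :
    |ip b f g| ≤ ‖toH b 2 g‖ * ‖u‖ := by
  have h : der [] (Nat.zero_le k) u =ᵐ[torusMeasure b] f := by
    rwa [Rep, D_eq_der (α := []) (Nat.zero_le k)] at hu
  have h2 : ‖emb b g‖ ≤ ‖toH b 2 g‖ := by
    have := hg.der_toH [] (Nat.zero_le 2)
    rw [pdl] at this
    rw [← this]
    exact norm_der_le _ _ _
  rw [hg.ip_eq h]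
  exact (abs_real_inner_le_norm _ _).trans (mul_le_mul h2 (norm_der_le _ _ _) (norm_nonneg _)
    (norm_nonneg _))

lemma IsSmoothFam.exists_norm_toH_le {ι : Type} [Fintype ι] {F : ι → Coord n → Plane → R3}
    (hF : ∀ i, IsSmoothFam b U (F i)) (hU : IsOpen U) (hK : IsCompact K) (hKU : K ⊆ U) :
    ∃ C, 0 ≤ C ∧ ∀ q ∈ K, ∀ i, ‖toH b 2 (F i q)‖ ≤ C := by
  have h (i : ι) := exists_norm_le_of_continuousOn ((hF i).continuousOn_toH hU 2) hK hKU
  choose C hC H using h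
  exact ⟨∑ i, C i, Finset.sum_nonneg fun i _ => hC i, fun q hq i => (H i q hq).trans
    (Finset.single_le_sum (fun i _ => hC i) (Finset.mem_univ i))⟩

lemma abs_sum_le_mul {N : ℕ} {f : Fin N → ℝ} {c : ℝ} (h : ∀ i, |f i| ≤ c) :
    |∑ i, f i| ≤ N * c := by
  refine (Finset.abs_sum_le_sum_abs _ _).trans ((Finset.sum_le_card_nsmul _ _ c
    fun i _ => h i).trans_eq ?_)
  rw [Finset.card_univ, Fintype.card_fin, nsmul_eq_mul]

lemma norm_coord_le {N : ℕ} {a : EuclideanSpace ℝ (Fin N)} {c : ℝ} (hc : 0 ≤ c)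
    (h : ∀ i, |a i| ≤ c) : ‖a‖ ≤ N * c := by
  refine abs_le_of_sq_le_sq (a := ‖a‖) ?_ (by positivity) |> (abs_of_nonneg (norm_nonneg a) ▸ ·)
  rw [EuclideanSpace.norm_sq_eq]
  refine (Finset.sum_le_card_nsmul _ _ (c ^ 2) fun i _ => ?_).trans ?_
  · exact pow_le_pow_left₀ (norm_nonneg _) (h i) 2
  · rw [Finset.card_univ, Fintype.card_fin, nsmul_eq_mul, mul_pow]
    gcongr
    exact_mod_cast Nat.le_self_pow two_ne_zero N

lemma abs_mul_le {x y c d : ℝ} (hx : |x| ≤ c) (hy : |y| ≤ d) : |x * y| ≤ c * d := by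
  rw [abs_mul]
  exact mul_le_mul hx hy (abs_nonneg _) ((abs_nonneg _).trans hx)

lemma abs_coord_le {a : Coord n} {r : ℝ} (h : ‖a‖ ≤ r) (i : Fin (4 * n)) : |a i| ≤ r :=
  (PiLp.norm_apply_le a i).trans h

/-- At a time when `ε² ‖Y‖` is small, the equation for `q` bounds the acceleration. -/
lemma IsParametrization.exists_norm_acceleration_le (hψ : IsParametrization b n U ψ)
    (hK : IsCompact K) (hKU : K ⊆ U) : ∃ κ > (0 : ℝ), ∃ C, 0 ≤ C ∧ ∀ q ∈ K, ∀ (ε r : ℝ)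
      (v a : Coord n) (Y : H b 3) (Z : H b 2), 0 ≤ ε → ε ≤ 1 → 1 ≤ r → ‖v‖ ≤ r → ‖Y‖ ≤ r →
      ‖Z‖ ≤ r → ε ^ 2 * ‖Y‖ ≤ κ →
      (∀ μ, a μ + ∑ l, ∑ ν, christoffel b ψ q μ l ν * v l * v ν
        = ε * hTerm ψ ε q v Y Z μ + ε ^ 2 * ∑ ν, ∑ l, (metric b ψ q)⁻¹ μ ν
            * ip b (D Y []) (dq l (dq ν ψ) q) * a l) → ‖a‖ ≤ C * r ^ 3 := by
  have hU := hψ.isOpen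
  obtain ⟨M0, hM0, H0⟩ := hψ.exists_metric_inv_le hK hKU
  obtain ⟨M1, hM1, H1⟩ := IsSmoothFam.exists_norm_toH_le (F := fun μ => dq μ ψ) hψ.dq_fam hU hK hKU
  obtain ⟨M2, hM2, H2⟩ := IsSmoothFam.exists_norm_toH_le
    (F := fun x : Fin (4 * n) × Fin (4 * n) => dq x.2 (dq x.1 ψ)) (fun x => hψ.dq_dq_fam x.1 x.2)
    hU hK hKU
  obtain ⟨M3, hM3, H3⟩ := IsSmoothFam.exists_norm_toH_le
    (F := fun x : (Fin (4 * n) × Fin (4 * n)) × Fin (4 * n) => dq x.2 (dq x.1.2 (dq x.1.1 ψ)))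
    (fun x => (hψ.dq_dq_fam x.1.1 x.1.2).dq hU x.2) hU hK hKU
  obtain ⟨M4, hM4, H4⟩ := hψ.exists_norm_jH_le hK hKU
  obtain ⟨N, hN⟩ : ∃ N : ℝ, N = (4 * n : ℕ) := ⟨_, rfl⟩
  have hN0 : 0 ≤ N := hN ▸ Nat.cast_nonneg _
  obtain ⟨B, hB⟩ : ∃ B, B = N * (N * (M0 * M2)) := ⟨_, rfl⟩
  have hB0 : 0 ≤ B := by rw [hB]; positivity
  obtain ⟨A, hA⟩ : ∃ A, A = N * (N * (N * (M0 * (M2 * M1))))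
    + N * (M0 * (M1 * M4 + 2 * (N * M2) + N * (N * M3))) := ⟨_, rfl⟩
  have hA0 : 0 ≤ A := by rw [hA]; positivity
  -- The acceleration occurs on both sides. This κ makes its coefficient on the right at most ½, so
  -- that ½‖a‖ ≤ N A r³.
  refine ⟨1 / (2 * (N * B + 1)), by positivity, 2 * (N * A), by positivity, ?_⟩
  intro q hq ε r v a Y Z hε hε1 hr hv hY hZ hsmall heq
  have hr0 : 0 ≤ r := zero_le_one.trans hr
  have r13 : r ≤ r ^ 3 := le_self_pow₀ hr (by norm_num)
  have r23 : r ^ 2 ≤ r ^ 3 := pow_le_pow_right₀ hr (by norm_num)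
  have hqU := hKU hq
  have s1 (μ : Fin (4 * n)) := (hψ.dq_fam μ).isSmooth hqU
  have s2 (μ ν : Fin (4 * n)) := (hψ.dq_dq_fam μ ν).isSmooth hqU
  have s3 (μ ν l : Fin (4 * n)) := ((hψ.dq_dq_fam μ ν).dq hU l).isSmooth hqU
  have r1 (α : Fin (4 * n)) : Rep (toH b 2 (dq α ψ q)) (dq α ψ q) := (s1 α).D_toH 2
  have rY : Rep Y (D Y []) := Filter.EventuallyEq.refl _ _
  have rZ : Rep Z (D Z []) := Filter.EventuallyEq.refl _ _
  have hj := H4 q hq ε r v Y Z hε hε1 hr hv hY hZ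
  have sum {f : Fin (4 * n) → ℝ} {c : ℝ} (h : ∀ i, |f i| ≤ c) : |∑ i, f i| ≤ N * c :=
    hN ▸ abs_sum_le_mul h
  have hε2 : ε ^ 2 ≤ 1 := pow_le_one₀ hε hε1
  have key (μ : Fin (4 * n)) : |a μ| ≤ A * r ^ 3 + B * (ε ^ 2 * ‖Y‖) * ‖a‖ := by
    have c1 : |∑ l, ∑ ν, christoffel b ψ q μ l ν * v l * v ν|
        ≤ N * (N * (N * (M0 * (M2 * M1)) * r * r)) := by
      refine sum fun l => sum fun ν => abs_mul_le (abs_mul_le (sum fun α =>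
        abs_mul_le (H0 q hq μ α) ?_) (abs_coord_le hv l)) (abs_coord_le hv ν)
      exact (r1 α).abs_ip_le (s2 l ν) |>.trans
        (mul_le_mul (H2 q hq (l, ν)) (H1 q hq α) (norm_nonneg _) hM2)
    have c2 : |hTerm ψ ε q v Y Z μ|
        ≤ N * (M0 * (M1 * (M4 * r ^ 3) + 2 * (N * (M2 * r * r)) + 1 * (N * (N * (M3 * r * r * r))))) := by
      refine sum fun ν => abs_mul_le (H0 q hq μ ν) ((abs_add_three _ _ _).trans
        (add_le_add (add_le_add ?_ (abs_mul_le (abs_of_pos two_pos).le (sum fun l => ?_)))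
          (abs_mul_le (abs_le.2 ⟨by linarith, hε1⟩) (sum fun l => sum fun k => ?_))))
      · exact ((hψ.rep_jH hqU ε v Y Z).abs_ip_le (s1 ν)).trans
          (mul_le_mul (H1 q hq ν) hj (norm_nonneg _) hM1)
      · exact abs_mul_le ((rZ.abs_ip_le (s2 ν l)).trans
          (mul_le_mul (H2 q hq (ν, l)) hZ (norm_nonneg _) hM2)) (abs_coord_le hv l)
      · exact abs_mul_le (abs_mul_le ((rY.abs_ip_le (s3 ν l k)).trans
          (mul_le_mul (H3 q hq ((ν, l), k)) hY (norm_nonneg _) hM3)) (abs_coord_le hv l))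
          (abs_coord_le hv k)
    have c3 : |∑ ν, ∑ l, (metric b ψ q)⁻¹ μ ν * ip b (D Y []) (dq l (dq ν ψ) q) * a l|
        ≤ N * (N * (M0 * (M2 * ‖Y‖) * ‖a‖)) := by
      refine sum fun ν => sum fun l => abs_mul_le (abs_mul_le (H0 q hq μ ν) ?_)
        (abs_coord_le le_rfl l)
      exact (rY.abs_ip_le (s2 ν l)).trans
        (mul_le_mul_of_nonneg_right (H2 q hq (ν, l)) (norm_nonneg _))
    have e : a μ = ε * hTerm ψ ε q v Y Z μ + ε ^ 2 * (∑ ν, ∑ l, (metric b ψ q)⁻¹ μ ν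
        * ip b (D Y []) (dq l (dq ν ψ) q) * a l)
        + -∑ l, ∑ ν, christoffel b ψ q μ l ν * v l * v ν := by rw [← heq μ]; ring
    have d1 := abs_mul_le (abs_le.2 ⟨by linarith, hε1⟩ : |ε| ≤ 1) c2
    have d2 := abs_mul_le (abs_of_nonneg (sq_nonneg ε)).le c3
    rw [← abs_neg] at c1
    rw [e]
    refine (abs_add_three _ _ _).trans ((add_le_add (add_le_add d1 d2) c1).trans ?_)
    have p1 : 0 ≤ N * (N * (N * (M0 * (M2 * M1)))) := by positivity
    have p2 : 0 ≤ N * (M0 * (2 * (N * M2))) := by positivity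
    have q1 := mul_le_mul_of_nonneg_left r23 p1
    have q2 := mul_le_mul_of_nonneg_left r23 p2
    rw [hA, hB]
    linear_combination q1 + q2
  -- Summing the components costs the dimension N.
  have key2 : ‖a‖ ≤ N * (A * r ^ 3 + B * (ε ^ 2 * ‖Y‖) * ‖a‖) :=
    hN ▸ norm_coord_le (by positivity) key
  have hs : N * B * (ε ^ 2 * ‖Y‖) ≤ 1 / 2 := by
    have : (N * B + 1) * (ε ^ 2 * ‖Y‖) ≤ 1 / 2 := by
      refine (mul_le_mul_of_nonneg_left hsmall (by positivity)).trans_eq ?_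
      field_simp
    have h2 : 0 ≤ ε ^ 2 * ‖Y‖ := by positivity
    linarith
  have := mul_le_mul_of_nonneg_right hs (norm_nonneg a)
  linarith

end Acceleration

end

end WaveMapTorus

namespace WaveMapTorus

noncomputable section

open SobolevInstances

set_option maxSynthPendingDepth 3

/-! ### Quasi-conservation of the second order energy -/

section QuasiConservation

variable {b : Module.Basis (Fin 2) ℝ Plane} {n : ℕ} {ε T t : ℝ} {ψ : Coord n → Plane → R3}
  {K U : Set (Coord n)} {q₀ q₁ : Coord n} {Y₀ : H b 3} {Y₁ : H b 2} {q : ℝ → Coord n}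
  {Y : ℝ → H b 3}

/-- The part of the time derivative of the force on `L Y` which is of order `ε`. -/
def source (ψ : Coord n → Plane → R3) (ε T : ℝ) (q : ℝ → Coord n) (Y : ℝ → H b 3) (t : ℝ) : L2 b :=
  ε • secondOrder (lowerOrderFam b ψ (q t)) (jH ψ ε (q t) (slowDeriv ε T 1 q t) (Y t) (Yt T Y t))
    + (2 : ℝ) • rate (lowerOrderFam b ψ) ε T q t (inclL one_le_two (Yt T Y t))
    + rateRate (lowerOrderFam b ψ) ε T q t (inclL one_le_two (inclL (by norm_num : 2 ≤ 3) (Y t)))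

/-- The function `-L k` along a solution. -/
def drift (b : Module.Basis (Fin 2) ℝ Plane) (ψ : Coord n → Plane → R3) (ε T : ℝ)
    (q : ℝ → Coord n) (t : ℝ) : L2 b :=
  accel (jacobiLin b ψ) (jacobiQuad b ψ) (q t) (slowDeriv ε T 1 q t) (slowDeriv ε T 2 q t)

/-- The derivative of `-L k` with respect to the slow time. -/
def driftDeriv (b : Module.Basis (Fin 2) ℝ Plane) (ψ : Coord n → Plane → R3) (ε T : ℝ)
    (q : ℝ → Coord n) (t : ℝ) : L2 b :=
  accelDeriv (jacobiLin b ψ) (jacobiQuad b ψ) (q t) (slowDeriv ε T 1 q t) (slowDeriv ε T 2 q t)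
    (slowDeriv ε T 3 q t)

/-- The function `L Y` along a solution. -/
def jacobiY (ψ : Coord n → Plane → R3) (q : ℝ → Coord n) (Y : ℝ → H b 3) (t : ℝ) : L2 b :=
  secondOrder (lowerOrderFam b ψ (q t)) (inclL (by norm_num : 2 ≤ 3) (Y t))

/-- The potential part of the derivative of the energy. -/
def potentialRate (ψ : Coord n → Plane → R3) (ε T : ℝ) (q : ℝ → Coord n) (Y : ℝ → H b 3) (t : ℝ) :
    ℝ :=
  ⟪rate (lowerOrderFam b ψ) ε T q t (improvedJacobi (k := 1) (ψ (q t)) (Y t)),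
    der [] (Nat.zero_le 1) (improvedJacobi (k := 1) (ψ (q t)) (Y t))⟫

namespace IsSolution

lemma hasDerivWithinAt_drift (S : IsSolution b ψ K ε T q₀ q₁ Y₀ Y₁ q Y)
    (hψ : IsParametrization b n U ψ) (hKU : K ⊆ U) (hε : 0 < ε) (hT : 0 < T) (ht : t ∈ Icc 0 T) :
    HasDerivWithinAt (drift b ψ ε T q) (ε • driftDeriv b ψ ε T q t) (Icc 0 T) t :=
  hasDerivWithinAt_accel hψ.isOpen hψ.contDiffOn_jacobiLin hψ.contDiffOn_jacobiQuad
    (S.mapsTo hKU ht) (S.hasDerivWithinAt_q hε hT ht)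
    (hasDerivWithinAt_slowDeriv hε hT S.q_C3 (by norm_num) ht)
    (hasDerivWithinAt_slowDeriv hε hT S.q_C3 (by norm_num) ht)

lemma continuousOn_driftDeriv (S : IsSolution b ψ K ε T q₀ q₁ Y₀ Y₁ q Y)
    (hψ : IsParametrization b n U ψ) (hKU : K ⊆ U) (hT : 0 < T) :
    ContinuousOn (driftDeriv b ψ ε T q) (Icc 0 T) :=
  continuousOn_accelDeriv hψ.isOpen hψ.contDiffOn_jacobiLin hψ.contDiffOn_jacobiQuad
    (S.mapsTo hKU) S.continuousOn_q (continuousOn_slowDeriv hT S.q_C3 (by norm_num))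
    (continuousOn_slowDeriv hT S.q_C3 (by norm_num))
    (continuousOn_slowDeriv hT S.q_C3 (by norm_num))

lemma hasDerivWithinAt_jacobiY (S : IsSolution b ψ K ε T q₀ q₁ Y₀ Y₁ q Y)
    (hψ : IsParametrization b n U ψ) (hKU : K ⊆ U) (hε : 0 < ε) (hT : 0 < T) (ht : t ∈ Icc 0 T) :
    HasDerivWithinAt (jacobiY ψ q Y) (jacobiRate ψ ε T q Y t) (Icc 0 T) t :=
  hasDerivWithinAt_secondOrder
    (S.hasDerivWithinAt_comp hψ.isOpen hKU hψ.contDiffOn_lowerOrderFam hε hT ht).1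
    (S.hasDerivWithinAt_Y ht)

lemma continuousOn_lowerOrderFam (S : IsSolution b ψ K ε T q₀ q₁ Y₀ Y₁ q Y)
    (hψ : IsParametrization b n U ψ) (hKU : K ⊆ U) :
    ContinuousOn (fun s => lowerOrderFam b ψ (q s)) (Icc 0 T) :=
  hψ.contDiffOn_lowerOrderFam.continuousOn.comp S.continuousOn_q (S.mapsTo hKU)

lemma continuousOn_rate (S : IsSolution b ψ K ε T q₀ q₁ Y₀ Y₁ q Y)
    (hψ : IsParametrization b n U ψ) (hKU : K ⊆ U) (hε : 0 < ε) (hT : 0 < T) :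
    ContinuousOn (rate (lowerOrderFam b ψ) ε T q) (Icc 0 T) := fun _ ht =>
  (S.hasDerivWithinAt_comp hψ.isOpen hKU hψ.contDiffOn_lowerOrderFam hε hT ht).2.continuousWithinAt

lemma continuousOn_inclY (S : IsSolution b ψ K ε T q₀ q₁ Y₀ Y₁ q Y) :
    ContinuousOn (fun s => inclL one_le_two (inclL (by norm_num : 2 ≤ 3) (Y s))) (Icc 0 T) :=
  (inclL one_le_two).continuous.comp_continuousOn ((inclL _).continuous.comp_continuousOn S.Y_C0)

lemma continuousOn_inclYt (S : IsSolution b ψ K ε T q₀ q₁ Y₀ Y₁ q Y) (hT : 0 < T) :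
    ContinuousOn (fun s => inclL one_le_two (Yt T Y s)) (Icc 0 T) :=
  (inclL one_le_two).continuous.comp_continuousOn (S.continuousOn_Yt hT)

lemma continuousOn_jacobiRate (S : IsSolution b ψ K ε T q₀ q₁ Y₀ Y₁ q Y)
    (hψ : IsParametrization b n U ψ) (hKU : K ⊆ U) (hε : 0 < ε) (hT : 0 < T) :
    ContinuousOn (jacobiRate ψ ε T q Y) (Icc 0 T) :=
  (continuousOn_secondOrder (S.continuousOn_lowerOrderFam hψ hKU) (S.continuousOn_Yt hT)).add
    ((S.continuousOn_rate hψ hKU hε hT).clm_apply S.continuousOn_inclY)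

lemma continuousOn_source (S : IsSolution b ψ K ε T q₀ q₁ Y₀ Y₁ q Y)
    (hψ : IsParametrization b n U ψ) (hKU : K ⊆ U) (hε : 0 < ε) (hT : 0 < T) :
    ContinuousOn (source ψ ε T q Y) (Icc 0 T) :=
  (((continuousOn_secondOrder (S.continuousOn_lowerOrderFam hψ hKU)
    (S.continuousOn_jH hψ hKU hT)).const_smul ε).add
    (((S.continuousOn_rate hψ hKU hε hT).clm_apply (S.continuousOn_inclYt hT)).const_smul
      (2 : ℝ))).add
    ((S.continuousOn_rateRate hψ.isOpen hKU hψ.contDiffOn_lowerOrderFam hT).clm_apply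
      S.continuousOn_inclY)

lemma continuousOn_potentialRate (S : IsSolution b ψ K ε T q₀ q₁ Y₀ Y₁ q Y)
    (hψ : IsParametrization b n U ψ) (hKU : K ⊆ U) (hε : 0 < ε) (hT : 0 < T) :
    ContinuousOn (potentialRate ψ ε T q Y) (Icc 0 T) := by
  have hw : ContinuousOn (fun s => improvedJacobi (k := 1) (ψ (q s)) (Y s)) (Icc 0 T) :=
    (((inclL one_le_two).continuous.comp_continuousOn (S.continuousOn_forcing hψ hKU hT)).sub
      (S.continuousOn_Ytt hT)).congr
      fun s hs => eq_sub_of_add_eq' (S.Ytt_add_improvedJacobi hψ hKU hs)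
  exact ((S.continuousOn_rate hψ hKU hε hT).clm_apply hw).inner
    ((der [] (Nat.zero_le 1)).continuous.comp_continuousOn hw)

/-- Separates the part of order ε from Lk = -`drift`, the only forcing of order one. -/
lemma secondOrder_forcing (ψ : Coord n → Plane → R3) (q : ℝ → Coord n) (Y : ℝ → H b 3) :
    secondOrder (lowerOrderFam b ψ (q t)) (forcing ψ ε T q Y t)
      = ε • secondOrder (lowerOrderFam b ψ (q t))
          (jH ψ ε (q t) (slowDeriv ε T 1 q t) (Y t) (Yt T Y t)) - drift b ψ ε T q t := by
  rw [forcing, map_add, map_neg, map_smul, lowerOrderFam, secondOrder_accel, drift]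
  abel

lemma continuousOn_drift (S : IsSolution b ψ K ε T q₀ q₁ Y₀ Y₁ q Y)
    (hψ : IsParametrization b n U ψ) (hKU : K ⊆ U) (hε : 0 < ε) (hT : 0 < T) :
    ContinuousOn (drift b ψ ε T q) (Icc 0 T) := fun _ hs =>
  (S.hasDerivWithinAt_drift hψ hKU hε hT hs).continuousWithinAt

lemma continuousOn_jacobiY (S : IsSolution b ψ K ε T q₀ q₁ Y₀ Y₁ q Y)
    (hψ : IsParametrization b n U ψ) (hKU : K ⊆ U) (hε : 0 < ε) (hT : 0 < T) :
    ContinuousOn (jacobiY ψ q Y) (Icc 0 T) := fun _ hs =>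
  (S.hasDerivWithinAt_jacobiY hψ hKU hε hT hs).continuousWithinAt

lemma continuousOn_energyRate (S : IsSolution b ψ K ε T q₀ q₁ Y₀ Y₁ q Y)
    (hψ : IsParametrization b n U ψ) (hKU : K ⊆ U) (hε : 0 < ε) (hT : 0 < T) :
    ContinuousOn (fun s => ⟪source ψ ε T q Y s, jacobiRate ψ ε T q Y s⟫
      + 1 / 2 * potentialRate ψ ε T q Y s + ε * ⟪driftDeriv b ψ ε T q s, jacobiY ψ q Y s⟫)
      (Icc 0 T) :=
  (((S.continuousOn_source hψ hKU hε hT).inner (𝕜 := ℝ) (S.continuousOn_jacobiRate hψ hKU hε hT)).add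
    (continuousOn_const.mul (S.continuousOn_potentialRate hψ hKU hε hT))).add
    (continuousOn_const.mul ((S.continuousOn_driftDeriv hψ hKU hT).inner (𝕜 := ℝ)
      (S.continuousOn_jacobiY hψ hKU hε hT)))

/-- The corrected energy `E₂ - ⟨L k, L Y⟩` varies slowly. -/
lemma E2_add_inner_sub (S : IsSolution b ψ K ε T q₀ q₁ Y₀ Y₁ q Y)
    (hψ : IsParametrization b n U ψ) (hKU : K ⊆ U) (hε : 0 < ε) (hT : 0 < T) (ht : t ∈ Icc 0 T) :
    (E2 ψ T q Y t + ⟪drift b ψ ε T q t, jacobiY ψ q Y t⟫)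
      - (E2 ψ T q Y 0 + ⟪drift b ψ ε T q 0, jacobiY ψ q Y 0⟫)
      = ∫ s in (0 : ℝ)..t, (⟪source ψ ε T q Y s, jacobiRate ψ ε T q Y s⟫
        + 1 / 2 * potentialRate ψ ε T q Y s + ε * ⟪driftDeriv b ψ ε T q s, jacobiY ψ q Y s⟫) := by
  have hI {f : ℝ → ℝ} (hf : ContinuousOn f (Icc 0 T)) : IntervalIntegrable f volume 0 t :=
    (hf.mono (by rw [uIcc_of_le ht.1]; exact Icc_subset_Icc_right ht.2)).intervalIntegrable
  have cd := S.continuousOn_drift hψ hKU hε hT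
  have cz := S.continuousOn_jacobiY hψ hKU hε hT
  have cr := S.continuousOn_jacobiRate hψ hKU hε hT
  have cs := S.continuousOn_source hψ hKU hε hT
  have cp := S.continuousOn_potentialRate hψ hKU hε hT
  have cdd := S.continuousOn_driftDeriv hψ hKU hT
  -- Integration by parts in time: the first integrand is the term of order one that enters the
  -- energy with the opposite sign, and the second carries ε because `drift` depends on slow
  -- quantities only.
  have h2 : ∫ s in (0 : ℝ)..t, (⟪drift b ψ ε T q s, jacobiRate ψ ε T q Y s⟫
      + ⟪ε • driftDeriv b ψ ε T q s, jacobiY ψ q Y s⟫)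
      = ⟪drift b ψ ε T q t, jacobiY ψ q Y t⟫ - ⟪drift b ψ ε T q 0, jacobiY ψ q Y 0⟫ :=
    intervalIntegral.integral_eq_sub_of_hasDerivAt_of_le ht.1
      ((cd.inner (𝕜 := ℝ) cz).mono (Icc_subset_Icc_right ht.2))
      (fun s hs => ((S.hasDerivWithinAt_drift hψ hKU hε hT ⟨hs.1.le, hs.2.le.trans ht.2⟩).inner ℝ
        (S.hasDerivWithinAt_jacobiY hψ hKU hε hT ⟨hs.1.le, hs.2.le.trans ht.2⟩)).hasDerivAt
        (Icc_mem_nhds hs.1 (hs.2.trans_le ht.2)))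
      (hI ((cd.inner (𝕜 := ℝ) cr).add ((cdd.const_smul ε).inner (𝕜 := ℝ) cz)))
  have h1 : E2 ψ T q Y t - E2 ψ T q Y 0 = ∫ s in (0 : ℝ)..t,
      (⟪source ψ ε T q Y s - drift b ψ ε T q s, jacobiRate ψ ε T q Y s⟫
        + 1 / 2 * potentialRate ψ ε T q Y s) := by
    rw [S.E2_sub hψ hKU hε hT ht]
    refine intervalIntegral.integral_congr fun s _ => ?_
    simp only [secondOrder_forcing, potentialRate, source]
    congr 2
    abel
  have i1 : IntervalIntegrable (fun s => ⟪source ψ ε T q Y s - drift b ψ ε T q s,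
      jacobiRate ψ ε T q Y s⟫ + 1 / 2 * potentialRate ψ ε T q Y s) volume 0 t :=
    hI (((cs.sub cd).inner (𝕜 := ℝ) cr).add (continuousOn_const.mul cp))
  have i2 : IntervalIntegrable (fun s => ⟪drift b ψ ε T q s, jacobiRate ψ ε T q Y s⟫
      + ⟪ε • driftDeriv b ψ ε T q s, jacobiY ψ q Y s⟫) volume 0 t :=
    hI ((cd.inner (𝕜 := ℝ) cr).add ((cdd.const_smul ε).inner (𝕜 := ℝ) cz))
  rw [add_sub_add_comm, h1, ← h2, ← intervalIntegral.integral_add i1 i2]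
  refine intervalIntegral.integral_congr fun s _ => ?_
  simp only [inner_sub_left, real_inner_smul_left]
  ring

end IsSolution

end QuasiConservation

end

end WaveMapTorus

namespace WaveMapTorus

noncomputable section

open SobolevInstances

set_option maxSynthPendingDepth 3

/-! ### Estimates along a solution -/

section Estimates

variable {b : Module.Basis (Fin 2) ℝ Plane} {n : ℕ} {ψ : Coord n → Plane → R3}
  {K U : Set (Coord n)}

/-- Fewer multi-indices enter the sum of squares. -/
lemma norm_inclL_le {k m : ℕ} (h : m ≤ k) (u : H b k) : ‖inclL h u‖ ≤ ‖u‖ := by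
  refine abs_le_of_sq_le_sq (a := ‖inclL h u‖) ?_ (norm_nonneg u) |> (abs_of_nonneg
    (norm_nonneg (inclL h u)) ▸ ·)
  have h1 : ‖inclL h u‖ ^ 2 = ∑ α : MultiIndex m, ‖u.1 ⟨α.1, α.2.trans h⟩‖ ^ 2 :=
    PiLp.norm_sq_eq_of_L2 _ _
  have h2 : ‖u‖ ^ 2 = ∑ α : MultiIndex k, ‖u.1 α‖ ^ 2 := PiLp.norm_sq_eq_of_L2 _ _
  let f : MultiIndex m ↪ MultiIndex k :=
    ⟨fun α => ⟨α.1, α.2.trans h⟩, fun α β hαβ => Subtype.ext (congrArg (fun γ => γ.1) hαβ)⟩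
  rw [h1, h2]
  exact (Finset.sum_map Finset.univ f fun α => ‖u.1 α‖ ^ 2).symm.le.trans
    (Finset.sum_le_univ_sum_of_nonneg fun α => sq_nonneg _)

/-- The five norms which control the growth of the energy are bounded by `r`. -/
structure SizeLE (ε T : ℝ) (q : ℝ → Coord n) (Y : ℝ → H b 3) (t r : ℝ) : Prop where
  one_le : 1 ≤ r
  vel : ‖slowDeriv ε T 1 q t‖ ≤ r
  acc : ‖slowDeriv ε T 2 q t‖ ≤ r
  jerk : ‖slowDeriv ε T 3 q t‖ ≤ r
  field : ‖Y t‖ ≤ r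
  fieldDeriv : ‖Yt T Y t‖ ≤ r

lemma IsParametrization.exists_norm_jacobiY_le (hψ : IsParametrization b n U ψ) (hK : IsCompact K)
    (hKU : K ⊆ U) : ∃ C, 0 ≤ C ∧ ∀ (t : ℝ) (q : ℝ → Coord n) (Y : ℝ → H b 3), q t ∈ K →
      ‖jacobiY ψ q Y t‖ ≤ C * ‖inclL (m := 2) (by norm_num) (Y t)‖ := by
  obtain ⟨C, hC, h⟩ := hψ.exists_norm_secondOrder_le hK hKU
  exact ⟨C, hC, fun t q Y hq => h _ hq _⟩

lemma IsParametrization.exists_norm_drift_le (hψ : IsParametrization b n U ψ) (hK : IsCompact K)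
    (hKU : K ⊆ U) : ∃ C, 0 ≤ C ∧ ∀ (ε T t : ℝ) (q : ℝ → Coord n), q t ∈ K →
      ‖drift b ψ ε T q t‖ ≤ C * (‖slowDeriv ε T 2 q t‖ + ‖slowDeriv ε T 1 q t‖ ^ 2) := by
  obtain ⟨C, hC, h⟩ := exists_norm_accel_le hψ.contDiffOn_jacobiLin.continuousOn
    hψ.contDiffOn_jacobiQuad.continuousOn hK hKU
  exact ⟨C, hC, fun ε T t q hq => h _ hq _ _⟩

lemma IsParametrization.exists_norm_driftDeriv_le (hψ : IsParametrization b n U ψ)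
    (hK : IsCompact K) (hKU : K ⊆ U) : ∃ C, 0 ≤ C ∧ ∀ (ε T t r : ℝ) (q : ℝ → Coord n)
      (Y : ℝ → H b 3), q t ∈ K → SizeLE ε T q Y t r → ‖driftDeriv b ψ ε T q t‖ ≤ C * r ^ 3 := by
  obtain ⟨C, hC, h⟩ := exists_norm_accelDeriv_le hψ.isOpen hψ.contDiffOn_jacobiLin
    hψ.contDiffOn_jacobiQuad hK hKU
  exact ⟨C, hC, fun ε T t r q Y hq hs => h _ hq _ _ _ _ hs.one_le hs.vel hs.acc hs.jerk⟩

/-- (LY)_t involves q only up to its first derivative. No bound on q̈ or on the third derivative is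
assumed, so the estimate applies to the initial energy. -/
lemma IsParametrization.exists_norm_jacobiRate_le (hψ : IsParametrization b n U ψ)
    (hK : IsCompact K) (hKU : K ⊆ U) : ∃ C, 0 ≤ C ∧ ∀ (ε T t r : ℝ) (q : ℝ → Coord n)
      (Y : ℝ → H b 3), 0 < ε → ε ≤ 1 → q t ∈ K → 1 ≤ r → ‖slowDeriv ε T 1 q t‖ ≤ r → ‖Y t‖ ≤ r →
      ‖Yt T Y t‖ ≤ r → ‖jacobiRate ψ ε T q Y t‖ ≤ C * r ^ 2 := by
  obtain ⟨C1, h1, H1⟩ := hψ.exists_norm_secondOrder_le hK hKU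
  obtain ⟨C2, h2, H2⟩ := exists_norm_rate_le hψ.isOpen hK hKU hψ.contDiffOn_lowerOrderFam
  refine ⟨C1 + C2, by positivity, fun ε T t r q Y hε hε1 hq hr hv hY hZ => ?_⟩
  have hr0 : 0 ≤ r := zero_le_one.trans hr
  have e1 : ‖secondOrder (lowerOrderFam b ψ (q t)) (Yt T Y t)‖ ≤ C1 * r :=
    (H1 _ hq _).trans (mul_le_mul_of_nonneg_left hZ h1)
  have e2 : ‖rate (lowerOrderFam b ψ) ε T q t‖ ≤ C2 * r := by
    refine (H2 ε T t q hε hq).trans ?_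
    have : C2 * ‖slowDeriv ε T 1 q t‖ ≤ C2 * r := mul_le_mul_of_nonneg_left hv h2
    exact (mul_le_mul hε1 this (by positivity) zero_le_one).trans_eq (one_mul _)
  have e3 : ‖inclL one_le_two (inclL (by norm_num : 2 ≤ 3) (Y t))‖ ≤ r :=
    (norm_inclL_le _ _).trans ((norm_inclL_le _ _).trans hY)
  refine (norm_add_le_of_le e1 (ContinuousLinearMap.le_of_opNorm_le_of_le _ e2 e3)).trans ?_
  have r12 : r ≤ r ^ 2 := le_self_pow₀ hr (by norm_num)
  have := mul_le_mul_of_nonneg_left r12 h1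
  linear_combination this

/-- Every term carries ε: j' explicitly, the first derivative of N through q_t = ε q̇, the second
through ε² ≤ ε. -/
lemma IsParametrization.exists_norm_source_le (hψ : IsParametrization b n U ψ)
    (hK : IsCompact K) (hKU : K ⊆ U) : ∃ C, 0 ≤ C ∧ ∀ (ε T t r : ℝ) (q : ℝ → Coord n)
      (Y : ℝ → H b 3), 0 < ε → ε ≤ 1 → q t ∈ K → SizeLE ε T q Y t r →
      ‖source ψ ε T q Y t‖ ≤ ε * (C * r ^ 3) := by
  obtain ⟨C1, h1, H1⟩ := hψ.exists_norm_secondOrder_le hK hKU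
  obtain ⟨C2, h2, H2⟩ := exists_norm_rate_le hψ.isOpen hK hKU hψ.contDiffOn_lowerOrderFam
  obtain ⟨C3, h3, H3⟩ := exists_norm_rateRate_le hψ.isOpen hK hKU hψ.contDiffOn_lowerOrderFam
  obtain ⟨C4, h4, H4⟩ := hψ.exists_norm_jH_le hK hKU
  refine ⟨C1 * C4 + 2 * C2 + C3 * 2, by positivity, fun ε T t r q Y hε hε1 hq hs => ?_⟩
  obtain ⟨hr, hv, ha, -, hY, hZ⟩ := hs
  have hr0 : 0 ≤ r := zero_le_one.trans hr
  have r12 : r ≤ r ^ 2 := le_self_pow₀ hr (by norm_num)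
  have r23 : r ^ 2 ≤ r ^ 3 := pow_le_pow_right₀ hr (by norm_num)
  have e1 : ‖secondOrder (lowerOrderFam b ψ (q t))
      (jH ψ ε (q t) (slowDeriv ε T 1 q t) (Y t) (Yt T Y t))‖ ≤ C1 * (C4 * r ^ 3) :=
    (H1 _ hq _).trans (mul_le_mul_of_nonneg_left (H4 _ hq ε r _ _ _ hε.le hε1 hr hv hY hZ) h1)
  have e2 : ‖rate (lowerOrderFam b ψ) ε T q t‖ ≤ ε * (C2 * r) :=
    (H2 ε T t q hε hq).trans (by gcongr)
  have e3 : ‖rateRate (lowerOrderFam b ψ) ε T q t‖ ≤ ε * (C3 * (2 * r ^ 2)) := by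
    refine (H3 ε T t q hε hε1 hq).trans ?_
    have := pow_le_pow_left₀ (norm_nonneg _) hv 2
    gcongr
    linarith
  have e4 : ‖inclL one_le_two (inclL (by norm_num : 2 ≤ 3) (Y t))‖ ≤ r :=
    (norm_inclL_le _ _).trans ((norm_inclL_le _ _).trans hY)
  have e5 : ‖inclL one_le_two (Yt T Y t)‖ ≤ r := (norm_inclL_le _ _).trans hZ
  have d1 : ‖ε • secondOrder (lowerOrderFam b ψ (q t))
      (jH ψ ε (q t) (slowDeriv ε T 1 q t) (Y t) (Yt T Y t))‖ ≤ ε * (C1 * (C4 * r ^ 3)) := by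
    rw [norm_smul, Real.norm_of_nonneg hε.le]
    gcongr
  have d2 : ‖(2 : ℝ) • rate (lowerOrderFam b ψ) ε T q t (inclL one_le_two (Yt T Y t))‖
      ≤ 2 * (ε * (C2 * r) * r) := by
    rw [norm_smul, Real.norm_of_nonneg zero_le_two]
    exact mul_le_mul_of_nonneg_left (ContinuousLinearMap.le_of_opNorm_le_of_le _ e2 e5) zero_le_two
  have d3 := ContinuousLinearMap.le_of_opNorm_le_of_le _ e3 e4
  refine (norm_add_le_of_le (norm_add_le_of_le d1 d2) d3).trans ?_
  have := mul_le_mul_of_nonneg_left r23 (by positivity : 0 ≤ 2 * (ε * C2))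
  linear_combination this

lemma IsParametrization.exists_abs_potentialRate_le (hψ : IsParametrization b n U ψ)
    (hK : IsCompact K) (hKU : K ⊆ U) : ∃ C, 0 ≤ C ∧ ∀ (ε T t r : ℝ) (q : ℝ → Coord n)
      (Y : ℝ → H b 3), 0 < ε → q t ∈ K → SizeLE ε T q Y t r →
      |potentialRate ψ ε T q Y t| ≤ ε * (C * r ^ 3) := by
  obtain ⟨C1, h1, H1⟩ := hψ.exists_norm_improvedJacobi_le hK hKU
  obtain ⟨C2, h2, H2⟩ := exists_norm_rate_le hψ.isOpen hK hKU hψ.contDiffOn_lowerOrderFam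
  refine ⟨C2 * C1 * C1, by positivity, fun ε T t r q Y hε hq hs => ?_⟩
  have e1 : ‖improvedJacobi (k := 1) (ψ (q t)) (Y t)‖ ≤ C1 * r :=
    (H1 _ hq _).trans (mul_le_mul_of_nonneg_left hs.field h1)
  have e2 : ‖rate (lowerOrderFam b ψ) ε T q t‖ ≤ ε * (C2 * r) :=
    (H2 ε T t q hε hq).trans (by have := hs.vel; gcongr)
  have d1 := ContinuousLinearMap.le_of_opNorm_le_of_le _ e2 e1
  have d2 : ‖der [] (Nat.zero_le 1) (improvedJacobi (k := 1) (ψ (q t)) (Y t))‖ ≤ C1 * r :=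
    (norm_der_le _ _ _).trans e1
  refine (abs_real_inner_le_norm _ _).trans ((mul_le_mul d1 d2 (norm_nonneg _)
    ((norm_nonneg _).trans d1)).trans_eq ?_)
  ring

/-- The derivative of the corrected energy is of order `ε`. -/
lemma IsParametrization.exists_energyRate_le (hψ : IsParametrization b n U ψ)
    (hK : IsCompact K) (hKU : K ⊆ U) : ∃ C, 0 ≤ C ∧ ∀ (ε T t r : ℝ) (q : ℝ → Coord n)
      (Y : ℝ → H b 3), 0 < ε → ε ≤ 1 → q t ∈ K → SizeLE ε T q Y t r →
      ⟪source ψ ε T q Y t, jacobiRate ψ ε T q Y t⟫ + 1 / 2 * potentialRate ψ ε T q Y t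
        + ε * ⟪driftDeriv b ψ ε T q t, jacobiY ψ q Y t⟫ ≤ ε * (C * r ^ 5) := by
  obtain ⟨C1, h1, H1⟩ := hψ.exists_norm_source_le hK hKU
  obtain ⟨C2, h2, H2⟩ := hψ.exists_norm_jacobiRate_le hK hKU
  obtain ⟨C3, h3, H3⟩ := hψ.exists_abs_potentialRate_le hK hKU
  obtain ⟨C4, h4, H4⟩ := hψ.exists_norm_driftDeriv_le hK hKU
  obtain ⟨C5, h5, H5⟩ := hψ.exists_norm_jacobiY_le hK hKU
  -- The three terms have degrees 3 + 2, 3 and 3 + 1 in r; since 1 ≤ r, all are at most r⁵.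
  refine ⟨C1 * C2 + 1 / 2 * C3 + C4 * C5, by positivity, fun ε T t r q Y hε hε1 hq hs => ?_⟩
  have hr0 : 0 ≤ r := zero_le_one.trans hs.one_le
  have r35 : r ^ 3 ≤ r ^ 5 := pow_le_pow_right₀ hs.one_le (by norm_num)
  have r45 : r ^ 4 ≤ r ^ 5 := pow_le_pow_right₀ hs.one_le (by norm_num)
  have e1 := H1 ε T t r q Y hε hε1 hq hs
  have e2 := H2 ε T t r q Y hε hε1 hq hs.one_le hs.vel hs.field hs.fieldDeriv
  have e3 := le_of_abs_le (H3 ε T t r q Y hε hq hs)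
  have e4 := H4 ε T t r q Y hq hs
  have e5 : ‖jacobiY ψ q Y t‖ ≤ C5 * r := (H5 t q Y hq).trans
    (mul_le_mul_of_nonneg_left ((norm_inclL_le _ _).trans hs.field) h5)
  have d1 := (real_inner_le_norm (source ψ ε T q Y t) (jacobiRate ψ ε T q Y t)).trans
    (mul_le_mul e1 e2 (norm_nonneg _) (by positivity))
  have d2 := (real_inner_le_norm (driftDeriv b ψ ε T q t) (jacobiY ψ q Y t)).trans
    (mul_le_mul e4 e5 (norm_nonneg _) (by positivity))
  have d3 := mul_le_mul_of_nonneg_left d2 hε.le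
  have p1 := mul_le_mul_of_nonneg_left r35 (by positivity : 0 ≤ ε * (1 / 2 * C3))
  have p2 := mul_le_mul_of_nonneg_left r45 (by positivity : 0 ≤ ε * (C4 * C5))
  linear_combination d1 + d3 + 1 / 2 * e3 + p1 + p2

/-- A bound for the energy at a single time. -/
lemma IsSolution.exists_E2_le (hψ : IsParametrization b n U ψ) (hK : IsCompact K) (hKU : K ⊆ U) :
    ∃ C, 0 ≤ C ∧ ∀ (ε T t r : ℝ) (q₀ q₁ : Coord n) (Y₀ : H b 3) (Y₁ : H b 2) (q : ℝ → Coord n)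
      (Y : ℝ → H b 3), 0 < ε → ε ≤ 1 → 0 < T → IsSolution b ψ K ε T q₀ q₁ Y₀ Y₁ q Y →
      t ∈ Icc 0 T → 1 ≤ r → ‖slowDeriv ε T 1 q t‖ ≤ r → ‖Y t‖ ≤ r → ‖Yt T Y t‖ ≤ r →
      E2 ψ T q Y t ≤ C * r ^ 4 := by
  obtain ⟨C1, h1, H1⟩ := hψ.exists_norm_jacobiRate_le hK hKU
  obtain ⟨C2, h2, H2⟩ := hψ.exists_norm_improvedJacobi_le hK hKU
  obtain ⟨C3, h3, H3⟩ := exists_norm_le_of_continuousOn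
    hψ.contDiffOn_lowerOrderFam.continuousOn hK hKU
  obtain ⟨C4, h4, H4⟩ : ∃ C, 0 ≤ C ∧ ‖dirichlet b‖ ≤ C := ⟨_, norm_nonneg _, le_rfl⟩
  refine ⟨1 / 2 * C1 ^ 2 + 1 / 2 * (C4 * C2 * C2 + C3 * C2 * C2), by positivity, ?_⟩
  intro ε T t r q₀ q₁ Y₀ Y₁ q Y hε hε1 hT S ht hr hv hY hZ
  have hr0 : 0 ≤ r := zero_le_one.trans hr
  have hq := S.q_mem t ht
  rw [S.E2_eq_waveEnergy hψ hKU hε hT ht, waveEnergy]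
  have e1 := pow_le_pow_left₀ (norm_nonneg _) (H1 ε T t r q Y hε hε1 hq hr hv hY hZ) 2
  have e2 : ‖improvedJacobi (k := 1) (ψ (q t)) (Y t)‖ ≤ C2 * r :=
    (H2 _ hq _).trans (mul_le_mul_of_nonneg_left hY h2)
  have e3 := (le_abs_self _).trans (ContinuousLinearMap.le_of_opNorm_le_of_le _
    (ContinuousLinearMap.le_of_opNorm_le_of_le _ H4 e2) e2)
  have e4 := (real_inner_le_norm (lowerOrderFam b ψ (q t) (improvedJacobi (k := 1) (ψ (q t)) (Y t)))
    (der [] (Nat.zero_le 1) (improvedJacobi (k := 1) (ψ (q t)) (Y t)))).trans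
    (mul_le_mul (ContinuousLinearMap.le_of_opNorm_le_of_le _ (H3 _ hq) e2)
      ((norm_der_le _ _ _).trans e2) (norm_nonneg _) (by positivity))
  have r24 := mul_le_mul_of_nonneg_left (pow_le_pow_right₀ hr (by norm_num : 2 ≤ 4))
    (by positivity : 0 ≤ 1 / 2 * (C4 * C2 * C2 + C3 * C2 * C2))
  linear_combination 1 / 2 * e1 + 1 / 2 * e3 + 1 / 2 * e4 + r24

end Estimates

end

end WaveMapTorus

namespace WaveMapTorus

noncomputable section

open SobolevInstances

set_option maxSynthPendingDepth 3

/-! ### The bounding function and the final estimate. -/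

section Bounding

lemma isBoundingFunction_pow {m : ℕ} [NeZero m] {C : ℝ} (hC : 0 < C) {k : ℕ} (hk : k ≠ 0) :
    IsBoundingFunction fun x : Fin m → ℝ => C * (1 + ∑ i, x i) ^ k where
  smooth := by fun_prop
  pos x hx := by
    have : 0 ≤ ∑ i, x i := Finset.sum_nonneg fun i _ => hx i
    positivity
  increasing x hx y _ hxy := by
    have h0 : 0 ≤ ∑ i, x i := Finset.sum_nonneg fun i _ => hx i
    have h1 : ∑ i, x i < ∑ i, y i := Fintype.sum_strictMono hxy
    have h2 : 1 + ∑ i, x i < 1 + ∑ i, y i := by linarith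
    exact mul_lt_mul_of_pos_left (pow_lt_pow_left₀ h2 (by linarith) hk) hC

variable {b : Module.Basis (Fin 2) ℝ Plane} {n : ℕ} {ε T t : ℝ} {q : ℝ → Coord n}
  {Y : ℝ → H b 3}

/-- One plus the sum of the five norms bounds each of them and is at least 1, so a power of it can
serve as bounding function. -/
lemma sizeLE_sum (ε T t : ℝ) (q : ℝ → Coord n) (Y : ℝ → H b 3) :
    SizeLE ε T q Y t (1 + ∑ i, ![‖slowDeriv ε T 1 q t‖, ‖slowDeriv ε T 2 q t‖,
      ‖slowDeriv ε T 3 q t‖, ‖Y t‖, ‖Yt T Y t‖] i) := by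
  have h1 := norm_nonneg (slowDeriv ε T 1 q t)
  have h2 := norm_nonneg (slowDeriv ε T 2 q t)
  have h3 := norm_nonneg (slowDeriv ε T 3 q t)
  have h4 := norm_nonneg (Y t)
  have h5 := norm_nonneg (Yt T Y t)
  simp only [Fin.sum_univ_five, Matrix.cons_val]
  constructor <;> linarith

lemma continuousOn_size {ψ : Coord n → Plane → R3} {K : Set (Coord n)} {q₀ q₁ : Coord n}
    {Y₀ : H b 3} {Y₁ : H b 2} (S : IsSolution b ψ K ε T q₀ q₁ Y₀ Y₁ q Y) (hT : 0 < T) :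
    ContinuousOn (fun t => ![‖slowDeriv ε T 1 q t‖, ‖slowDeriv ε T 2 q t‖,
      ‖slowDeriv ε T 3 q t‖, ‖Y t‖, ‖Yt T Y t‖]) (Icc 0 T) := by
  have hv {m : ℕ} (hm : m ≤ 3) : ContinuousOn (fun t => ‖slowDeriv ε T m q t‖) (Icc 0 T) :=
    (continuousOn_slowDeriv hT S.q_C3 hm).norm
  refine continuousOn_pi.2 fun i => ?_
  fin_cases i
  · exact hv (by norm_num)
  · exact hv (by norm_num)
  · exact hv le_rfl
  · exact S.Y_C0.norm
  · exact (S.continuousOn_Yt hT).norm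

/-- Quasi-conservation of the second order energy. -/
lemma IsParametrization.exists_E2_le {U K : Set (Coord n)} {ψ : Coord n → Plane → R3}
    (hψ : IsParametrization b n U ψ) (hK : IsCompact K) (hKU : K ⊆ U) :
    ∃ κ > (0 : ℝ), ∃ C > (0 : ℝ), ∃ c : (Fin 5 → ℝ) → ℝ, IsBoundingFunction c ∧
      ∀ (q₀ q₁ : Coord n) (Y₀ : H b 3) (Y₁ : H b 2), ∃ C₀ > (0 : ℝ),
        ∀ Γ d ε T : ℝ, 0 < Γ → 0 < d →
          q₀ ∈ K → d < Metric.infDist q₀ (frontier K) →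
          ‖q₁‖ < Γ → ‖Y₀‖ < Γ → ‖Y₁‖ < Γ →
          0 < ε → ε ≤ 1 → ε < κ / √Γ → 0 < T →
          ∀ (q : ℝ → Coord n) (Y : ℝ → H b 3), IsSolution b ψ K ε T q₀ q₁ Y₀ Y₁ q Y →
            ∀ t ∈ Set.Icc 0 T,
              E2 ψ T q Y t
                ≤ C₀ + C * (‖slowDeriv ε T 2 q t‖ + ‖slowDeriv ε T 1 q t‖ ^ 2)
                      * ‖incl (m := 2) (by norm_num) (Y t)‖
                  + ε * ∫ s in (0 : ℝ)..t,
                      c ![‖slowDeriv ε T 1 q s‖, ‖slowDeriv ε T 2 q s‖, ‖slowDeriv ε T 3 q s‖,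
                        ‖Y s‖, ‖Yt T Y s‖] := by
  obtain ⟨κ, hκ, Ca, hCa, Ha⟩ := hψ.exists_norm_acceleration_le hK hKU
  obtain ⟨C1, h1, H1⟩ := hψ.exists_energyRate_le hK hKU
  obtain ⟨C2, h2, H2⟩ := IsSolution.exists_E2_le hψ hK hKU
  obtain ⟨C3, h3, H3⟩ := hψ.exists_norm_drift_le hK hKU
  obtain ⟨C4, h4, H4⟩ := hψ.exists_norm_jacobiY_le hK hKU
  -- The square root turns ε < √κ/√Γ into ε²Γ < κ. The exponent 5 is that of `exists_energyRate_le`;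
  -- the added ones in the constants secure positivity.
  refine ⟨√κ, Real.sqrt_pos.2 hκ, C3 * C4 + 1, by positivity,
    fun x => (C1 + 1) * (1 + ∑ i, x i) ^ 5, isBoundingFunction_pow (by positivity) (by norm_num),
    fun q₀ q₁ Y₀ Y₁ => ?_⟩
  obtain ⟨r, hr⟩ : ∃ r, r = 1 + ‖q₁‖ + ‖Y₀‖ + ‖Y₁‖ := ⟨_, rfl⟩
  have n1 := norm_nonneg q₁
  have n2 := norm_nonneg Y₀
  have n3 := norm_nonneg Y₁
  have hr1 : 1 ≤ r := by linarith
  have hr0 : 0 ≤ r := by linarith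
  -- Bounds for E₂(0) and for the correction at time 0, where Ca r³ stands for |q̈(0)|. Everything
  -- depends on the data through r, and on neither Γ nor ε.
  refine ⟨C2 * r ^ 4 + C3 * (Ca * r ^ 3 + r ^ 2) * (C4 * r) + 1, by positivity, ?_⟩
  intro Γ d ε T hΓ _ _ _ _ hY₀ _ hε hε1 hεκ hT q Y S t ht
  have h0 : (0 : ℝ) ∈ Icc 0 T := ⟨le_rfl, hT.le⟩
  have ev := S.slowDeriv_one_init hε
  have bv : ‖slowDeriv ε T 1 q 0‖ ≤ r := by rw [ev]; linarith
  have bY : ‖Y 0‖ ≤ r := by rw [S.Y_init]; linarith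
  have bZ : ‖Yt T Y 0‖ ≤ r := by rw [S.Yt_init]; linarith
  have hsmall : ε ^ 2 * ‖Y 0‖ ≤ κ := by
    have hs : ε * √Γ < √κ := (lt_div_iff₀ (Real.sqrt_pos.2 hΓ)).1 hεκ
    have h := pow_le_pow_left₀ (by positivity) hs.le 2
    rw [mul_pow, Real.sq_sqrt hΓ.le, Real.sq_sqrt hκ.le] at h
    rw [S.Y_init]
    exact (mul_le_mul_of_nonneg_left hY₀.le (sq_nonneg ε)).trans h
  -- The initial acceleration is not prescribed; it is bounded through the equation for q at t = 0.
  have ba := Ha (q 0) (S.q_mem 0 h0) ε r _ _ _ _ hε.le hε1 hr1 bv bY bZ hsmall (S.q_eq 0 h0)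
  have i1 := H2 ε T 0 r q₀ q₁ Y₀ Y₁ q Y hε hε1 hT S h0 hr1 bv bY bZ
  have i2 : ⟪drift b ψ ε T q 0, jacobiY ψ q Y 0⟫ ≤ C3 * (Ca * r ^ 3 + r ^ 2) * (C4 * r) := by
    refine (real_inner_le_norm _ _).trans (mul_le_mul ?_ ?_ (norm_nonneg _) (by positivity))
    · exact (H3 ε T 0 q (S.q_mem 0 h0)).trans (mul_le_mul_of_nonneg_left
        (add_le_add ba (pow_le_pow_left₀ (norm_nonneg _) bv 2)) h3)
    · exact (H4 0 q Y (S.q_mem 0 h0)).trans (mul_le_mul_of_nonneg_left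
        ((norm_inclL_le _ _).trans bY) h4)
  have i3 : -⟪drift b ψ ε T q t, jacobiY ψ q Y t⟫
      ≤ C3 * (‖slowDeriv ε T 2 q t‖ + ‖slowDeriv ε T 1 q t‖ ^ 2)
        * (C4 * ‖incl (m := 2) (by norm_num) (Y t)‖) :=
    (neg_le_abs _).trans ((abs_real_inner_le_norm _ _).trans (mul_le_mul
      (H3 ε T t q (S.q_mem t ht)) (H4 t q Y (S.q_mem t ht)) (norm_nonneg _) (by positivity)))
  have key := S.E2_add_inner_sub hψ hKU hε hT ht
  have hI {f : ℝ → ℝ} (hf : ContinuousOn f (Icc 0 T)) : IntervalIntegrable f volume 0 t :=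
    (hf.mono (by rw [uIcc_of_le ht.1]; exact Icc_subset_Icc_right ht.2)).intervalIntegrable
  have hc : ContinuousOn (fun s => ε * ((C1 + 1) * (1 + ∑ i, ![‖slowDeriv ε T 1 q s‖,
      ‖slowDeriv ε T 2 q s‖, ‖slowDeriv ε T 3 q s‖, ‖Y s‖, ‖Yt T Y s‖] i) ^ 5)) (Icc 0 T) :=
    continuousOn_const.mul (continuousOn_const.mul ((continuousOn_const.add
      (continuousOn_finsetSum _ fun i _ => continuousOn_pi.1 (continuousOn_size S hT) i)).pow 5))
  -- At each time the pointwise bound is used with r equal to one plus the sum of the five norms at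
  -- that time.
  have hmono := intervalIntegral.integral_mono_on ht.1
    (hI (S.continuousOn_energyRate hψ hKU hε hT)) (hI hc) fun s hs => by
    have hsz := sizeLE_sum ε T s q Y
    refine (H1 ε T s _ q Y hε hε1 (S.q_mem s ⟨hs.1, hs.2.trans ht.2⟩) hsz).trans ?_
    have := pow_nonneg (zero_le_one.trans hsz.one_le) 5
    exact mul_le_mul_of_nonneg_left (mul_le_mul_of_nonneg_right (by linarith) this) hε.le
  rw [intervalIntegral.integral_const_mul, ← key] at hmono
  have i4 : 0 ≤ (‖slowDeriv ε T 2 q t‖ + ‖slowDeriv ε T 1 q t‖ ^ 2)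
      * ‖incl (m := 2) (by norm_num) (Y t)‖ := by positivity
  linear_combination hmono + i1 + i2 + i3 + i4

end Bounding

end

end WaveMapTorus

theorem theorem7p2 (b : Module.Basis (Fin 2) ℝ Plane) (n : ℕ) (hn : 2 ≤ n)
    (U : Set (Coord n)) (ψ : Coord n → Plane → R3) (hψ : IsParametrization b n U ψ)
    (K : Set (Coord n)) (hK : IsCompact K) (hKU : K ⊆ U) :
    ∃ κ > (0 : ℝ), ∃ C > (0 : ℝ), ∃ c : (Fin 5 → ℝ) → ℝ, IsBoundingFunction c ∧
      ∀ (q₀ q₁ : Coord n) (Y₀ : H b 3) (Y₁ : H b 2), ∃ C₀ > (0 : ℝ),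
        ∀ Γ d ε T : ℝ, 0 < Γ → 0 < d →
          q₀ ∈ K → d < Metric.infDist q₀ (frontier K) →
          ‖q₁‖ < Γ → ‖Y₀‖ < Γ → ‖Y₁‖ < Γ →
          0 < ε → ε ≤ 1 → ε < κ / √Γ → 0 < T →
          ∀ (q : ℝ → Coord n) (Y : ℝ → H b 3), IsSolution b ψ K ε T q₀ q₁ Y₀ Y₁ q Y →
            ∀ t ∈ Set.Icc 0 T,
              E2 ψ T q Y t
                ≤ C₀ + C * (‖slowDeriv ε T 2 q t‖ + ‖slowDeriv ε T 1 q t‖ ^ 2)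
                      * ‖incl (m := 2) (by norm_num) (Y t)‖
                  + ε * ∫ s in (0 : ℝ)..t,
                      c ![‖slowDeriv ε T 1 q s‖, ‖slowDeriv ε T 2 q s‖, ‖slowDeriv ε T 3 q s‖,
                        ‖Y s‖, ‖Yt T Y s‖] := by
  exact hψ.exists_E2_le hK hKU
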